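/- A Tanner graph is a finite bipartite graph $G=(L\cup R,E)$ without parallel edges, with variable nodes $L$ and check nodes $R$. It is left-regular with left degree $d_l$ if every variable node has degree $d_l$; its girth $g$ is the length of its shortest cycle. For $S\subseteq L$ let $\Gamma(S)\subseteq R$ be the set of neighbours of $S$, and let $G(S)$ be the subgraph induced on $S\cup\Gamma(S)$. A check node of $\Gamma(S)$ is satisfied (unsatisfied) if its degree in $G(S)$ is even (odd). The set $S$ is an $(a,b)$ elementary trapping set (ETS) if $|S|=a$, exactly $b$ check nodes are unsatisfied, and every check node of $G(S)$ has degree $1$ or $2$. It is absorbing if every $v\in S$ has more satisfied than unsatisfied neighbours in $\Gamma(S)$. It belongs to $\mathcal T$ if $G(S)$ is connected and every $v\in S$ has at least two satisfied neighbours in $\Gamma(S)$. Two ETSs (possibly of different Tanner graphs) have the same structure if their induced subgraphs are isomorphic graphs. An ETS $S\in\mathcal T$ is a layered superset (LSS) of $C\subseteq S$ if there are ETSs $C=S^{(0)}\subset S^{(1)}\subset\dots\subset S^{(k)}=S$ ($k\ge 0$), all in $\mathcal T$, with $|S^{(i)}|=|C|+i$. It is an LSS of a cycle of length $x$ if it is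 an LSS of some $C\subseteq S$ that is the set of variable nodes of a cycle of length $x$ of $G$. It has type $\mathrm{LSS}_x$ if $x$ is the smallest length such that $S$ is an LSS of a cycle of length $x$, and type $\mathrm{NA}$ if there is no such $x$. **Theorem.** Let $d_l=5$ and $g=6$. For all $4\le a\le 9$ and $0\le b\le 9$, the numbers of non-isomorphic structures of $(a,b)$ ETSs in $\mathcal T$, and of those that are absorbing sets, occurring in left-regular Tanner graphs with left degree $5$ and girth $6$, are as follows. An item $x:n$ means that exactly $n$ non-isomorphic structures have type $\mathrm{LSS}_x$, and $\mathrm{NA}:n$ that exactly $n$ have type $\mathrm{NA}$; there are no structures of the types and of the classes $(a,b)$ that are not listed. - $(4,8)$: ETS $6:1$; absorbing $6:1$ - $(5,5)$: ETS $6:1$; absorbing $6:1$ - $(5,7)$: ETS $6:1$; absorbing $6:1$ - $(5,9)$: ETS $6:2$; absorbing $6:1$ - $(6,0)$: ETS $6:1$; absorbing $6:1$ - $(6,2)$: ETS $6:1$; absorbing $6:1$ - $(6,4)$: ETS $6:2$; absorbing $6:2$ - $(6,6)$: ETS $6:5$; absorbing $6:4$ - $(6,8)$: ETS $6:8$; absorbing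 $6:5$ - $(7,1)$: ETS $6:1$; absorbing $6:1$ - $(7,3)$: ETS $6:6$; absorbing $6:5$ - $(7,5)$: ETS $6:18$; absorbing $6:14$ - $(7,7)$: ETS $6:37$; absorbing $6:23$ - $(7,9)$: ETS $6:61$, $8:1$; absorbing $6:25$ - $(8,0)$: ETS $6:3$; absorbing $6:3$ - $(8,2)$: ETS $6:16$; absorbing $6:16$ - $(8,4)$: ETS $6:75$; absorbing $6:68$ - $(8,6)$: ETS $6:222$, $10:1$; absorbing $6:165$ - $(8,8)$: ETS $6:453$, $8:5$, $10:2$, $\mathrm{NA}:1$; absorbing $6:249$, $8:3$ - $(9,1)$: ETS $6:28$; absorbing $6:28$ - $(9,3)$: ETS $6:289$; absorbing $6:276$ - $(9,5)$: ETS $6:1355$, $8:2$; absorbing $6:1149$, $8:2$ - $(9,7)$: ETS $6:3768$, $8:9$, $10:6$, $12:1$, $\mathrm{NA}:3$; absorbing $6:2533$, $8:7$, $10:1$ - $(9,9)$: ETS $6:6957$, $8:66$, $10:43$, $12:7$, $\mathrm{NA}:19$; absorbing $6:3243$, $8:33$, $10:7$, $\mathrm{NA}:1$ In particular, every $(a,b)$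 ETS in $\mathcal T$ with $a<10$ and $b<5$ in a left-regular Tanner graph with $d_l=5$ and $g=6$ is an LSS of a cycle of length $6$. -/

import Mathlib

/-- A (finite) Tanner graph: a bipartite graph with variable nodes `L`, check nodes `R` and no
parallel edges. -/
structure TannerGraph where
  L : Type
  R : Type
  finite_L : Finite L
  finite_R : Finite R
  Adj : L → R → Prop

namespace TannerGraph

/-- The Tanner graph as a simple graph on the disjoint union of its two sides. -/
def toSimpleGraph (G : TannerGraph) : SimpleGraph (G.L ⊕ G.R) where
  Adj x y := (∃ v c, G.Adj v c ∧ x = Sum.inl v ∧ y = Sum.inr c) ∨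
    (∃ v c, G.Adj v c ∧ x = Sum.inr c ∧ y = Sum.inl v)
  symm := ⟨by
    rintro x y (⟨v, c, h, rfl, rfl⟩ | ⟨v, c, h, rfl, rfl⟩)
    · exact Or.inr ⟨v, c, h, rfl, rfl⟩
    · exact Or.inl ⟨v, c, h, rfl, rfl⟩⟩
  loopless := ⟨by
    rintro x (⟨v, c, -, rfl, h⟩ | ⟨v, c, -, rfl, h⟩) <;> cases h⟩

/-- Every variable node has degree `d`. -/
def LeftRegular (G : TannerGraph) (d : ℕ) : Prop :=
  ∀ v : G.L, {c | G.Adj v c}.ncard = d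

/-- `Γ(S)`: the check nodes adjacent to `S`. -/
def checks (G : TannerGraph) (S : Set G.L) : Set G.R :=
  {c | ∃ v ∈ S, G.Adj v c}

/-- The degree of the check node `c` in the induced subgraph `G(S)`. -/
noncomputable def checkDegree (G : TannerGraph) (S : Set G.L) (c : G.R) : ℕ :=
  {v | v ∈ S ∧ G.Adj v c}.ncard

/-- `Γₒ(S)`: the unsatisfied check nodes. -/
def unsatisfied (G : TannerGraph) (S : Set G.L) : Set G.R :=
  {c | c ∈ G.checks S ∧ Odd (G.checkDegree S c)}

/-- `Γₑ(S)`: the satisfied check nodes. -/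
def satisfied (G : TannerGraph) (S : Set G.L) : Set G.R :=
  {c | c ∈ G.checks S ∧ Even (G.checkDegree S c)}

/-- The node set `S ∪ Γ(S)` of the induced subgraph of `S`. -/
def inducedNodes (G : TannerGraph) (S : Set G.L) : Set (G.L ⊕ G.R) :=
  Sum.inl '' S ∪ Sum.inr '' G.checks S

/-- `G(S)`: the induced subgraph of `S`, as a graph without a marking of its two sides. -/
def inducedSubgraph (G : TannerGraph) (S : Set G.L) : SimpleGraph (G.inducedNodes S) :=
  G.toSimpleGraph.induce (G.inducedNodes S)

/-- `S` is an `(a, b)` trapping set. -/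
def IsTrappingSet (G : TannerGraph) (S : Set G.L) (a b : ℕ) : Prop :=
  S.ncard = a ∧ (G.unsatisfied S).ncard = b

/-- All check nodes of `G(S)` have degree one or two. -/
def IsElementary (G : TannerGraph) (S : Set G.L) : Prop :=
  ∀ c ∈ G.checks S, G.checkDegree S c = 1 ∨ G.checkDegree S c = 2

/-- `S` belongs to the class `𝒯`: `G(S)` is connected, and every node of `S` is adjacent to at
least two satisfied check nodes. -/
def MemT (G : TannerGraph) (S : Set G.L) : Prop :=
  (G.inducedSubgraph S).Connected ∧
    ∀ v ∈ S, 2 ≤ {c | c ∈ G.satisfied S ∧ G.Adj v c}.ncard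

/-- Every node of `S` is adjacent to more satisfied than unsatisfied check nodes. -/
def IsAbsorbing (G : TannerGraph) (S : Set G.L) : Prop :=
  ∀ v ∈ S, {c | c ∈ G.unsatisfied S ∧ G.Adj v c}.ncard <
    {c | c ∈ G.satisfied S ∧ G.Adj v c}.ncard

/-- `C` is the set of variable nodes of some cycle of length `x` of the Tanner graph. -/
def IsCycleSet (G : TannerGraph) (x : ℕ) (C : Set G.L) : Prop :=
  ∃ (u : G.L ⊕ G.R) (w : G.toSimpleGraph.Walk u u),
    w.IsCycle ∧ w.length = x ∧ C = {v | Sum.inl v ∈ w.support}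

/-- `S` is a layered superset of `C`: there is a nested sequence of elementary trapping sets in `𝒯`
that starts at `C`, ends at `S` and grows by one variable node at a time. The sequence of length
zero is allowed, so that a cycle is trivially a layered superset of itself. -/
def IsLSS (G : TannerGraph) (S C : Set G.L) : Prop :=
  ∃ (k : ℕ) (T : ℕ → Set G.L), T 0 = C ∧ T k = S ∧
    (∀ i < k, T i ⊂ T (i + 1)) ∧
    ∀ i ≤ k, G.IsElementary (T i) ∧ G.MemT (T i) ∧ (T i).ncard = C.ncard + i

/-- `S` is a layered superset of (the variable nodes of) one of its cycles of length `x`. -/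
def IsLSSOfCycle (G : TannerGraph) (S : Set G.L) (x : ℕ) : Prop :=
  ∃ C ⊆ S, G.IsCycleSet x C ∧ G.IsLSS S C

/-- `S` has type `some x` if `x` is the smallest length such that `S` is a layered superset of one
of its cycles of length `x`, that is, if `S` is an `LSSₓ` structure. It has type `none` ("NA") if
`S` is not a layered superset of any of its cycles. -/
def HasLSSType (G : TannerGraph) (S : Set G.L) : Option ℕ → Prop
  | some x => IsLeast {y | G.IsLSSOfCycle S y} x
  | none => ∀ y, ¬ G.IsLSSOfCycle S y

end TannerGraph

/-- The `(a, b)` elementary trapping sets in `𝒯` of the left-regular Tanner graphs with left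
degree `d` and girth `g`. -/
structure ETS (d g a b : ℕ) where
  G : TannerGraph
  leftRegular : G.LeftRegular d
  girth_eq : G.toSimpleGraph.egirth = (g : ℕ∞)
  S : Set G.L
  isTrappingSet : G.IsTrappingSet S a b
  isElementary : G.IsElementary S
  memT : G.MemT S

namespace ETS

/-- Two elementary trapping sets have the same structure if their induced subgraphs are
isomorphic. -/
instance isoSetoid (d g a b : ℕ) : Setoid (ETS d g a b) where
  r X Y := Nonempty (X.G.inducedSubgraph X.S ≃g Y.G.inducedSubgraph Y.S)
  iseqv :=
    { refl := fun _ => ⟨SimpleGraph.Iso.refl⟩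
      symm := fun ⟨f⟩ => ⟨f.symm⟩
      trans := fun ⟨f⟩ ⟨h⟩ => ⟨f.trans h⟩ }

/-- The number of non-isomorphic structures of `(a, b)` elementary trapping sets in `𝒯` with the
property `P`. -/
noncomputable def numStructures (d g a b : ℕ) (P : ETS d g a b → Prop) : ℕ∞ :=
  ((fun X : ETS d g a b => Quotient.mk (isoSetoid d g a b) X) '' {X | P X}).encard

/-- The number of non-isomorphic elementary trapping set structures of the type `t`. -/
noncomputable def numTS (d g a b : ℕ) (t : Option ℕ) : ℕ∞ :=
  numStructures d g a b fun X => X.G.HasLSSType X.S t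

/-- The number of non-isomorphic absorbing set structures of the type `t`. -/
noncomputable def numAS (d g a b : ℕ) (t : Option ℕ) : ℕ∞ :=
  numStructures d g a b fun X => X.G.IsAbsorbing X.S ∧ X.G.HasLSSType X.S t

end ETS

namespace TableD5G6

/-- An entry of the table: the multiplicities of the types `LSS₆`, `LSS₈`, `LSS₁₀`, `LSS₁₂` and
"NA", in this order. There are no structures of any other type. -/
def entry (n6 n8 n10 n12 na : ℕ) : Option ℕ → ℕ
  | some 6 => n6
  | some 8 => n8
  | some 10 => n10
  | some 12 => n12
  | some _ => 0
  | none => na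

/-- Elementary trapping sets: `ts a b` is the entry of the class `(a, b)`. -/
def ts : ℕ → ℕ → Option ℕ → ℕ
  | 4, 8 => entry 1 0 0 0 0
  | 5, 5 => entry 1 0 0 0 0
  | 5, 7 => entry 1 0 0 0 0
  | 5, 9 => entry 2 0 0 0 0
  | 6, 0 => entry 1 0 0 0 0
  | 6, 2 => entry 1 0 0 0 0
  | 6, 4 => entry 2 0 0 0 0
  | 6, 6 => entry 5 0 0 0 0
  | 6, 8 => entry 8 0 0 0 0
  | 7, 1 => entry 1 0 0 0 0
  | 7, 3 => entry 6 0 0 0 0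
  | 7, 5 => entry 18 0 0 0 0
  | 7, 7 => entry 37 0 0 0 0
  | 7, 9 => entry 61 1 0 0 0
  | 8, 0 => entry 3 0 0 0 0
  | 8, 2 => entry 16 0 0 0 0
  | 8, 4 => entry 75 0 0 0 0
  | 8, 6 => entry 222 0 1 0 0
  | 8, 8 => entry 453 5 2 0 1
  | 9, 1 => entry 28 0 0 0 0
  | 9, 3 => entry 289 0 0 0 0
  | 9, 5 => entry 1355 2 0 0 0
  | 9, 7 => entry 3768 9 6 1 3
  | 9, 9 => entry 6957 66 43 7 19
  | _, _ => entry 0 0 0 0 0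

/-- Absorbing sets: `as a b` is the entry of the class `(a, b)`. -/
def as : ℕ → ℕ → Option ℕ → ℕ
  | 4, 8 => entry 1 0 0 0 0
  | 5, 5 => entry 1 0 0 0 0
  | 5, 7 => entry 1 0 0 0 0
  | 5, 9 => entry 1 0 0 0 0
  | 6, 0 => entry 1 0 0 0 0
  | 6, 2 => entry 1 0 0 0 0
  | 6, 4 => entry 2 0 0 0 0
  | 6, 6 => entry 4 0 0 0 0
  | 6, 8 => entry 5 0 0 0 0
  | 7, 1 => entry 1 0 0 0 0
  | 7, 3 => entry 5 0 0 0 0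
  | 7, 5 => entry 14 0 0 0 0
  | 7, 7 => entry 23 0 0 0 0
  | 7, 9 => entry 25 0 0 0 0
  | 8, 0 => entry 3 0 0 0 0
  | 8, 2 => entry 16 0 0 0 0
  | 8, 4 => entry 68 0 0 0 0
  | 8, 6 => entry 165 0 0 0 0
  | 8, 8 => entry 249 3 0 0 0
  | 9, 1 => entry 28 0 0 0 0
  | 9, 3 => entry 276 0 0 0 0
  | 9, 5 => entry 1149 2 0 0 0
  | 9, 7 => entry 2533 7 1 0 0
  | 9, 9 => entry 3243 33 7 0 1
  | _, _ => entry 0 0 0 0 0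

end TableD5G6

/-! Since the girth is 6, two variable nodes share at most one check node, and in an elementary set
every check node meets one or two nodes of S. The induced subgraph is therefore encoded by its
normal graph: the simple graph on S whose edges are the check nodes of degree two. The number of
satisfied neighbours of a node becomes its degree, the degree sum is 5a - b, membership in the class
T means connected with all degrees at least 2, and absorbing means all degrees at least 3
(`memT_iff`, `isAbsorbing_iff`). Isomorphic structures correspond to isomorphic normal graphs, and
every graph with the right degrees is realised; a triangle placed outside S forces the girth to be 6
(`numStructures_eq`). In a layered chain each new node has two neighbours among the old ones. So S
is a layered superset of a cycle of length 2k exactly if its normal graph has a percolating k-cycle: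
one from which all of S is reached by repeatedly adding vertices with two neighbours in the current
set (`hasLSSType_iff`).

What remains is to classify the graphs on at most 9 vertices with degrees from 2 to 5 by degree sum,
minimum degree and smallest percolating cycle. Almost all of them have a percolating triangle. These
are only counted; the remaining exceptional graphs are listed.

The number of all graphs, connected or not, comes from Burnside's lemma. The graphs fixed by a
permutation are the unions of its orbits on pairs of vertices, and a polynomial with one variable
per cycle of the permutation records their degrees. Eliminating the variables one at a time turns
degrees into weights and leaves a single integer whose digits in base 2^56 are the required numbers
(`coefN_eq`, `numClasses_bounded`).

In an exceptional graph every triangle lies in a proper two-closed set. Bounds on the degree sum and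
on the sizes of such sets define classes that contain the exceptional graphs and survive the
deletion of a vertex of minimal degree (`Cls.del`). Hence they can be generated one vertex at a
time; isomorphism certificates prove the resulting lists complete (`complete_codes`), and a
numerical invariant separates the exceptional graphs in them.

A graph with a percolating triangle is connected, so the number of structures of type LSS_6 is the
Burnside total minus the number of exceptional graphs (`numClasses_bounded_eq_add`), and the other
types are read off the list. All exceptional graphs have b at least 5, which gives the final claim.
-/

namespace TrappingSets

/-! ### Degrees, percolation and their invariance under isomorphism -/

section Graph

variable {V W : Type*}

/-- The degree of a vertex, as the cardinality of its neighbour set. -/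
noncomputable def ndeg (H : SimpleGraph V) (v : V) : ℕ := (H.neighborSet v).ncard

/-- The sum of all degrees. -/
noncomputable def dsum [Fintype V] (H : SimpleGraph V) : ℕ := ∑ v, ndeg H v

/-- A set of vertices that contains every vertex with two neighbours in it. -/
def TwoClosed (H : SimpleGraph V) (A : Set V) : Prop :=
  ∀ v u w, u ∈ A → w ∈ A → u ≠ w → H.Adj v u → H.Adj v w → v ∈ A

/-- A set of vertices whose only two-closed superset is the whole vertex set. -/
def Percolates (H : SimpleGraph V) (C : Set V) : Prop :=
  ∀ A, TwoClosed H A → C ⊆ A → A = Set.univ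

/-- The vertices `f 0, …, f (k - 1)`, in this order, form a cycle. -/
def CycleOn (H : SimpleGraph V) (k : ℕ) (f : ℕ → V) : Prop :=
  3 ≤ k ∧ f k = f 0 ∧ Set.InjOn f (Set.Iio k) ∧ ∀ i < k, H.Adj (f i) (f (i + 1))

/-- Some cycle of length `k` percolates. -/
def PercCyc (H : SimpleGraph V) (k : ℕ) : Prop :=
  ∃ f, CycleOn H k f ∧ Percolates H (f '' Set.Iio k)

lemma ndeg_iso {H : SimpleGraph V} {K : SimpleGraph W} (φ : H ≃g K) (v : V) :
    ndeg K (φ v) = ndeg H v := by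
  unfold ndeg
  have : K.neighborSet (φ v) = φ '' H.neighborSet v := by
    ext w
    simp only [SimpleGraph.mem_neighborSet, Set.mem_image]
    constructor
    · intro h
      exact ⟨φ.symm w, by simpa using (φ.symm.map_adj_iff).2 h, by simp⟩
    · rintro ⟨x, hx, rfl⟩
      exact φ.map_adj_iff.2 hx
  rw [this, Set.ncard_image_of_injective _ φ.injective]

lemma dsum_iso [Fintype V] [Fintype W] {H : SimpleGraph V} {K : SimpleGraph W} (φ : H ≃g K) :
    dsum K = dsum H := by
  unfold dsum
  rw [← Equiv.sum_comp φ.toEquiv]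
  exact Finset.sum_congr rfl fun v _ => ndeg_iso φ v

lemma TwoClosed.preimage {H : SimpleGraph V} {K : SimpleGraph W} (φ : H ↪g K) {A : Set W}
    (h : TwoClosed K A) : TwoClosed H (φ ⁻¹' A) := fun v u w hu hw huw h1 h2 =>
  h (φ v) (φ u) (φ w) hu hw (fun e => huw (φ.injective e)) (φ.map_adj_iff.2 h1)
    (φ.map_adj_iff.2 h2)

lemma PercCyc.of_iso {H : SimpleGraph V} {K : SimpleGraph W} (φ : H ≃g K) {k : ℕ}
    (h : PercCyc H k) : PercCyc K k := by
  obtain ⟨f, ⟨h3, h0, hinj, hadj⟩, hp⟩ := h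
  refine ⟨fun i => φ (f i), ⟨h3, by simp [h0], fun i hi j hj e => hinj hi hj (φ.injective e),
    fun i hi => φ.map_adj_iff.2 (hadj i hi)⟩, fun A hA hC => ?_⟩
  have := hp (φ ⁻¹' A) (hA.preimage φ.toEmbedding) (by
    rintro _ ⟨i, hi, rfl⟩
    exact hC ⟨i, hi, rfl⟩)
  ext w
  simp only [Set.mem_univ, iff_true]
  have h' : φ.symm w ∈ (φ ⁻¹' A : Set V) := by rw [this]; trivial
  simpa using h'

lemma percCyc_iso {H : SimpleGraph V} {K : SimpleGraph W} (φ : H ≃g K) (k : ℕ) :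
    PercCyc H k ↔ PercCyc K k := ⟨.of_iso φ, .of_iso φ.symm⟩

end Graph

/-! ### Cycles of a Tanner graph as cyclic sequences, and girth six -/

section Tanner

variable (G : TannerGraph)

lemma adj_inl_inr {v : G.L} {c : G.R} :
    G.toSimpleGraph.Adj (Sum.inl v) (Sum.inr c) ↔ G.Adj v c := by
  simp [TannerGraph.toSimpleGraph]

lemma adj_inr_inl {v : G.L} {c : G.R} :
    G.toSimpleGraph.Adj (Sum.inr c) (Sum.inl v) ↔ G.Adj v c := by
  simp [TannerGraph.toSimpleGraph]

lemma not_adj_inl_inl {v w : G.L} : ¬ G.toSimpleGraph.Adj (Sum.inl v) (Sum.inl w) := by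
  simp [TannerGraph.toSimpleGraph]

lemma not_adj_inr_inr {c d : G.R} : ¬ G.toSimpleGraph.Adj (Sum.inr c) (Sum.inr d) := by
  simp [TannerGraph.toSimpleGraph]

/-- A cyclic sequence of `k` variable nodes `f i` and `k` check nodes `c i`. -/
def TCycle (k : ℕ) (f : ℕ → G.L) (c : ℕ → G.R) : Prop :=
  2 ≤ k ∧ f k = f 0 ∧ Set.InjOn f (Set.Iio k) ∧ Set.InjOn c (Set.Iio k) ∧
    ∀ i < k, G.Adj (f i) (c i) ∧ G.Adj (f (i + 1)) (c i)

variable {G}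

/-- The exact support is carried through the induction, so that injectivity of `f` and `c` shows
each of the two appended nodes to be new. -/
lemma exists_path {k : ℕ} {f : ℕ → G.L} {c : ℕ → G.R} (h : TCycle G k f c) (i : ℕ) (hi : i < k) :
    ∃ q : G.toSimpleGraph.Walk (Sum.inl (f 0)) (Sum.inl (f i)), q.IsPath ∧ q.length = 2 * i ∧
      ∀ x, x ∈ q.support ↔ (∃ j ≤ i, x = Sum.inl (f j)) ∨ ∃ j < i, x = Sum.inr (c j) := by
  induction i with
  | zero => exact ⟨.nil, by simp, by simp, by simp⟩
  | succ i ih =>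
    obtain ⟨q, hq, hl, hs⟩ := ih (by omega)
    obtain ⟨h2, h0, hf, hc, ha⟩ := h
    have a1 := (adj_inl_inr G).2 (ha i (by omega)).1
    have a2 := (adj_inr_inl G).2 (ha i (by omega)).2
    have n1 : Sum.inr (c i) ∉ q.support := by
      rw [hs]
      rintro (⟨j, hj, e⟩ | ⟨j, hj, e⟩)
      · simp at e
      · have := hc (x₁ := i) (x₂ := j) (by simp; omega) (by simp; omega) (by simpa using e)
        omega
    have n2 : Sum.inl (f (i + 1)) ∉ (q.concat a1).support := by
      simp only [SimpleGraph.Walk.support_concat, List.mem_append, hs,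
        List.mem_singleton, reduceCtorEq, or_false]
      rintro (⟨j, hj, e⟩ | ⟨j, hj, e⟩)
      · have := hf (x₁ := i + 1) (x₂ := j) (by simp; omega) (by simp; omega) (by simpa using e)
        omega
      · simp at e
    refine ⟨(q.concat a1).concat a2, (hq.concat n1 a1).concat n2 a2, by simp [hl]; ring, ?_⟩
    intro x
    simp only [SimpleGraph.Walk.support_concat, List.mem_append, hs,
      List.mem_singleton]
    constructor
    · rintro (((⟨j, hj, e⟩ | ⟨j, hj, e⟩) | e) | e)
      · exact .inl ⟨j, by omega, e⟩
      · exact .inr ⟨j, by omega, e⟩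
      · exact .inr ⟨i, by omega, e⟩
      · exact .inl ⟨i + 1, le_rfl, e⟩
    · rintro (⟨j, hj, e⟩ | ⟨j, hj, e⟩)
      · rcases Nat.lt_or_ge i j with h | h
        · obtain rfl : j = i + 1 := by omega
          exact .inr e
        · exact .inl (.inl (.inl ⟨j, h, e⟩))
      · rcases Nat.lt_or_ge j i with h | h
        · exact .inl (.inl (.inr ⟨j, h, e⟩))
        · obtain rfl : j = i := by omega
          exact .inl (.inr e)

/-- The path from `f 0` to `f (k - 1)` is closed by two edges through the last check node, which
serves as the base point. -/
lemma TCycle.exists_walk {k : ℕ} {f : ℕ → G.L} {c : ℕ → G.R} (h : TCycle G k f c) :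
    ∃ (u : G.L ⊕ G.R) (w : G.toSimpleGraph.Walk u u), w.IsCycle ∧ w.length = 2 * k ∧
      {v | Sum.inl v ∈ w.support} = f '' Set.Iio k := by
  have h' := h
  obtain ⟨h2, h0, hf, hc, ha⟩ := h'
  obtain ⟨q, hq, hl, hs⟩ := exists_path h (k - 1) (by omega)
  have hk : k - 1 + 1 = k := by omega
  have a1 := (adj_inl_inr G).2 (ha (k - 1) (by omega)).1
  have a2 := (adj_inr_inl G).2 (ha (k - 1) (by omega)).2
  rw [hk, h0] at a2
  have n1 : Sum.inr (c (k - 1)) ∉ q.support := by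
    rw [hs]
    rintro (⟨j, hj, e⟩ | ⟨j, hj, e⟩)
    · simp at e
    · have := hc (x₁ := k - 1) (x₂ := j) (by simp; omega) (by simp; omega) (by simpa using e)
      omega
  refine ⟨_, .cons a2 (q.concat a1), ?_, by simp [hl]; omega, ?_⟩
  · rw [SimpleGraph.Walk.cons_isCycle_iff]
    refine ⟨hq.concat n1 a1, ?_⟩
    rw [SimpleGraph.Walk.edges_concat]
    simp only [List.concat_eq_append, List.mem_append, List.mem_singleton, not_or]
    refine ⟨fun h => n1 (q.fst_mem_support_of_mem_edges h), ?_⟩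
    intro e
    rw [Sym2.eq_iff] at e
    rcases e with ⟨e, _⟩ | ⟨_, e⟩
    · simp at e
    · have := hf (x₁ := 0) (x₂ := k - 1) (by simp; omega) (by simp; omega) (by simpa using e)
      omega
  · ext v
    simp only [SimpleGraph.Walk.support_cons, SimpleGraph.Walk.support_concat, List.mem_cons, hs,
 List.mem_append, Set.mem_image, Set.mem_Iio]
    constructor
    · rintro (e | (⟨j, hj, e⟩ | ⟨j, hj, e⟩) | e | e) <;> simp at e
      exact ⟨j, by omega, e.symm⟩
    · rintro ⟨j, hj, rfl⟩
      exact .inr (.inl (.inl ⟨j, by omega, rfl⟩))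

/-- The two sides alternate along a walk: starting from a variable node, even positions are variable
nodes and odd positions are check nodes. -/
lemma exists_tcycle_of_inl {u : G.L} (w : G.toSimpleGraph.Walk (Sum.inl u) (Sum.inl u))
    (hw : w.IsCycle) :
    ∃ k f c, TCycle G k f c ∧ w.length = 2 * k ∧
      {v | Sum.inl v ∈ w.support} = f '' Set.Iio k := by
  have hside : ∀ i, i ≤ w.length → (i % 2 = 0 → ∃ v, w.getVert i = Sum.inl v) ∧
      (i % 2 = 1 → ∃ c, w.getVert i = Sum.inr c) := by
    intro i
    induction i with
    | zero => intro _; exact ⟨fun _ => ⟨u, by simp⟩, by simp⟩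
    | succ i ih =>
      intro hi
      have ha := w.adj_getVert_succ (i := i) (by omega)
      obtain ⟨h1, h2⟩ := ih (by omega)
      refine ⟨fun h => ?_, fun h => ?_⟩
      · obtain ⟨c, hc⟩ := h2 (by omega)
        rw [hc] at ha
        rcases hx : w.getVert (i + 1) with v | d
        · exact ⟨v, rfl⟩
        · rw [hx] at ha; exact (not_adj_inr_inr G ha).elim
      · obtain ⟨c, hc⟩ := h1 (by omega)
        rw [hc] at ha
        rcases hx : w.getVert (i + 1) with v | d
        · rw [hx] at ha; exact (not_adj_inl_inl G ha).elim
        · exact ⟨d, rfl⟩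
  have hl3 := hw.three_le_length
  have heven : w.length % 2 = 0 := by
    by_contra h
    obtain ⟨c, hc⟩ := (hside w.length le_rfl).2 (by omega)
    simp at hc
  obtain ⟨k, hk⟩ : ∃ k, w.length = 2 * k := ⟨w.length / 2, by omega⟩
  -- A check node to serve as the value of `c` at indices from `k` on, where nothing is required.
  obtain ⟨c0, hc0⟩ := (hside 1 (by omega)).2 rfl
  have hf : ∀ i, ∃ v, i ≤ k → w.getVert (2 * i) = Sum.inl v := fun i => by
    by_cases h : i ≤ k
    · obtain ⟨v, hv⟩ := (hside (2 * i) (by omega)).1 (by omega)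
      exact ⟨v, fun _ => hv⟩
    · exact ⟨u, fun h' => (h h').elim⟩
  have hc : ∀ i, ∃ v, i < k → w.getVert (2 * i + 1) = Sum.inr v := fun i => by
    by_cases h : i < k
    · obtain ⟨v, hv⟩ := (hside (2 * i + 1) (by omega)).2 (by omega)
      exact ⟨v, fun _ => hv⟩
    · exact ⟨c0, fun h' => (h h').elim⟩
  choose f hf using hf
  choose c hc using hc
  have hinj := hw.getVert_injOn'
  refine ⟨k, f, c, ⟨by omega, ?_, ?_, ?_, ?_⟩, hk, ?_⟩
  · have h1 := hf k le_rfl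
    have h2 := hf 0 (by omega)
    rw [← hk, SimpleGraph.Walk.getVert_length] at h1
    rw [Nat.mul_zero, SimpleGraph.Walk.getVert_zero] at h2
    rw [h1] at h2
    simpa using h2
  · intro i hi j hj e
    simp only [Set.mem_Iio] at hi hj
    have := hinj (x₁ := 2 * i) (x₂ := 2 * j) (by simp; omega) (by simp; omega)
      (by rw [hf i (by omega), hf j (by omega), e])
    omega
  · intro i hi j hj e
    simp only [Set.mem_Iio] at hi hj
    have := hinj (x₁ := 2 * i + 1) (x₂ := 2 * j + 1) (by simp; omega) (by simp; omega)
      (by rw [hc i (by omega), hc j (by omega), e])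
    omega
  · intro i hi
    have h1 := w.adj_getVert_succ (i := 2 * i) (by omega)
    have h2 := w.adj_getVert_succ (i := 2 * i + 1) (by omega)
    rw [hf i (by omega), hc i hi, adj_inl_inr] at h1
    rw [show 2 * i + 1 + 1 = 2 * (i + 1) by ring, hf (i + 1) (by omega), hc i hi,
      adj_inr_inl] at h2
    exact ⟨h1, h2⟩
  · ext v
    simp only [Set.mem_image, Set.mem_Iio]
    constructor
    · intro h
      obtain ⟨n, hn, hle⟩ := SimpleGraph.Walk.mem_support_iff_exists_getVert.1 h
      have hev : n % 2 = 0 := by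
        by_contra h'
        obtain ⟨d, hd⟩ := (hside n hle).2 (by omega)
        rw [hd] at hn
        simp at hn
      obtain ⟨m, rfl⟩ : ∃ m, n = 2 * m := ⟨n / 2, by omega⟩
      rcases Nat.lt_or_ge m k with hm | hm
      · rw [hf m (by omega)] at hn
        exact ⟨m, hm, by simpa using hn⟩
      · obtain rfl : m = k := by omega
        refine ⟨0, by omega, ?_⟩
        rw [← hk, SimpleGraph.Walk.getVert_length] at hn
        have h2 := hf 0 (by omega)
        rw [Nat.mul_zero, SimpleGraph.Walk.getVert_zero, hn] at h2
        simpa using h2.symm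
    · rintro ⟨m, hm, rfl⟩
      exact SimpleGraph.Walk.mem_support_iff_exists_getVert.2 ⟨2 * m, hf m (by omega), by omega⟩

lemma exists_tcycle {u : G.L ⊕ G.R} (w : G.toSimpleGraph.Walk u u) (hw : w.IsCycle) :
    ∃ k f c, TCycle G k f c ∧ w.length = 2 * k ∧
      {v | Sum.inl v ∈ w.support} = f '' Set.Iio k := by
  classical
  obtain ⟨v, hv⟩ : ∃ v, Sum.inl v ∈ w.support := by
    rcases u with u | u
    · exact ⟨u, w.start_mem_support⟩
    · have ha := w.adj_getVert_succ (i := 0) (by have := hw.three_le_length; omega)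
      rcases hx : w.getVert 1 with v | d
      · exact ⟨v, hx ▸ w.getVert_mem_support 1⟩
      · simp only [SimpleGraph.Walk.getVert_zero, zero_add, hx] at ha
        exact (not_adj_inr_inr G ha).elim
  -- Rotation makes a variable node the base point; neither length nor support changes.
  obtain ⟨k, f, c, h1, h2, h3⟩ := exists_tcycle_of_inl (w.rotate _ hv) (hw.rotate hv)
  refine ⟨k, f, c, h1, ?_, ?_⟩
  · rw [← h2]; simp
  · rw [← h3]; ext x; simp

/-- Two variable nodes have at most one common neighbour. -/
def NoFour (G : TannerGraph) : Prop :=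
  ∀ v w c d, v ≠ w → G.Adj v c → G.Adj w c → G.Adj v d → G.Adj w d → c = d

/-- Two nodes with two common check nodes would span a cycle of length four. -/
lemma noFour_of_egirth (h : G.toSimpleGraph.egirth = 6) : NoFour G := by
  intro v w c d hvw h1 h2 h3 h4
  by_contra hcd
  have : TCycle G 2 (fun i => if i = 1 then w else v) (fun i => if i = 1 then d else c) := by
    refine ⟨le_rfl, by simp, ?_, ?_, ?_⟩
    · intro i hi j hj e
      simp only [Set.mem_Iio] at hi hj
      interval_cases i <;> interval_cases j <;> simp_all
    · intro i hi j hj e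
      simp only [Set.mem_Iio] at hi hj
      interval_cases i <;> interval_cases j <;> simp_all
    · intro i hi
      interval_cases i <;> simp_all
  obtain ⟨u, q, hq, hl, -⟩ := this.exists_walk
  have := SimpleGraph.egirth_le_length hq
  rw [h, hl] at this
  norm_cast at this

/-- Cycles have even length 2k with k at least 2, and k = 2 is what `NoFour` rules out; the given
hexagon attains the bound. -/
lemma egirth_eq_six (h : NoFour G) {f : ℕ → G.L} {c : ℕ → G.R} (hc : TCycle G 3 f c) :
    G.toSimpleGraph.egirth = 6 := by
  apply le_antisymm
  · obtain ⟨u, q, hq, hl, -⟩ := hc.exists_walk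
    have := SimpleGraph.egirth_le_length hq
    rw [hl] at this
    exact_mod_cast this
  · rw [SimpleGraph.le_egirth]
    intro a w hw
    obtain ⟨k, f, c, ⟨h2, h0, hf, hc, ha⟩, hl, -⟩ := exists_tcycle w hw
    have : 3 ≤ k := by
      by_contra hk
      obtain rfl : k = 2 := by omega
      have e := h (f 0) (f 1) (c 0) (c 1)
        (fun e => by simpa using hf (x₁ := 0) (x₂ := 1) (by simp) (by simp) e)
        (ha 0 (by simp)).1 (ha 0 (by simp)).2 (h0 ▸ (ha 1 (by simp)).2) (ha 1 (by simp)).1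
      simpa using hc (x₁ := 0) (x₂ := 1) (by simp) (by simp) e
    rw [hl]
    exact_mod_cast (by omega : 6 ≤ 2 * k)

end Tanner

end TrappingSets

namespace TrappingSets

/-! ### From trapping sets to normal graphs: degrees and connectivity -/

section TrappingSet

variable {G : TannerGraph} {S : Set G.L}

instance : Finite G.L := G.finite_L
instance : Finite G.R := G.finite_R

/-- The graph on the variable nodes in which two nodes are adjacent if they share a check node. -/
def normal (G : TannerGraph) : SimpleGraph G.L where
  Adj v w := v ≠ w ∧ ∃ c, G.Adj v c ∧ G.Adj w c
  symm := ⟨fun _ _ ⟨h, c, h1, h2⟩ => ⟨h.symm, c, h2, h1⟩⟩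
  loopless := ⟨fun _ h => h.1 rfl⟩

/-- The normal graph of a set of variable nodes. -/
abbrev sgraph (G : TannerGraph) (S : Set G.L) : SimpleGraph S := (normal G).induce S

lemma checkDegree_le {D : Set G.L} (h : D ⊆ S) (c : G.R) :
    G.checkDegree D c ≤ G.checkDegree S c :=
  Set.ncard_le_ncard (fun _ hv => ⟨h hv.1, hv.2⟩) (Set.toFinite _)

lemma checkDegree_pos {c : G.R} (h : c ∈ G.checks S) : 1 ≤ G.checkDegree S c := by
  obtain ⟨v, hv, hc⟩ := h
  exact (Set.ncard_pos (Set.toFinite _)).2 ⟨v, hv, hc⟩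

/-- Check degrees can only drop in a subset and remain positive. Hence all members of a chain inside
an elementary set are elementary, and only membership in the class T has to be checked. -/
lemma elementary_mono {D : Set G.L} (h : D ⊆ S) (hS : G.IsElementary S) : G.IsElementary D := by
  rintro c hc
  have h1 := checkDegree_pos hc
  have h2 := checkDegree_le h c
  obtain ⟨v, hv, ha⟩ := hc
  have := hS c ⟨v, h hv, ha⟩
  omega

lemma two_le_checkDegree {v w : G.L} {c : G.R} (hv : v ∈ S) (hw : w ∈ S) (h : v ≠ w)
    (hvc : G.Adj v c) (hwc : G.Adj w c) : 2 ≤ G.checkDegree S c := by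
  have : ({v, w} : Set G.L).ncard ≤ G.checkDegree S c := by
    apply Set.ncard_le_ncard _ (Set.toFinite _)
    rintro x (rfl | rfl)
    · exact ⟨hv, hvc⟩
    · exact ⟨hw, hwc⟩
  rwa [Set.ncard_pair h] at this

lemma mem_satisfied_of_two (hS : G.IsElementary S) {v w : G.L} {c : G.R} (hv : v ∈ S)
    (hw : w ∈ S) (h : v ≠ w) (hvc : G.Adj v c) (hwc : G.Adj w c) : c ∈ G.satisfied S := by
  have hc : c ∈ G.checks S := ⟨v, hv, hvc⟩
  refine ⟨hc, ?_⟩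
  have := two_le_checkDegree hv hw h hvc hwc
  rcases hS c hc with h' | h'
  · omega
  · rw [h']; exact even_two

lemma exists_other {v : G.L} {c : G.R} (hc : c ∈ G.satisfied S) :
    ∃ w ∈ S, w ≠ v ∧ G.Adj w c := by
  have h1 := checkDegree_pos hc.1
  have h2 : 2 ≤ G.checkDegree S c := by
    obtain ⟨m, hm⟩ := hc.2
    omega
  obtain ⟨w, hw, hwv⟩ := Set.exists_ne_of_one_lt_ncard (s := {v | v ∈ S ∧ G.Adj v c}) h2 v
  exact ⟨w, hw.1, hwv, hw.2⟩

lemma eq_or_eq_of_adj (hS : G.IsElementary S) {v w x : G.L} {c : G.R} (hv : v ∈ S)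
    (hw : w ∈ S) (hx : x ∈ S) (h : v ≠ w) (hvc : G.Adj v c) (hwc : G.Adj w c)
    (hxc : G.Adj x c) : x = v ∨ x = w := by
  by_contra hcon
  push Not at hcon
  have : ({v, w, x} : Set G.L).ncard ≤ G.checkDegree S c := by
    apply Set.ncard_le_ncard _ (Set.toFinite _)
    rintro y (rfl | rfl | rfl)
    · exact ⟨hv, hvc⟩
    · exact ⟨hw, hwc⟩
    · exact ⟨hx, hxc⟩
  rw [Set.ncard_eq_three.2 ⟨v, w, x, h, hcon.1.symm, hcon.2.symm, rfl⟩] at this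
  have := hS c ⟨v, hv, hvc⟩
  omega

lemma eq_of_unsatisfied (hS : G.IsElementary S) {v w : G.L} {c : G.R} (hc : c ∈ G.unsatisfied S)
    (hv : v ∈ S) (hw : w ∈ S) (hvc : G.Adj v c) (hwc : G.Adj w c) : v = w := by
  by_contra h
  have h1 := (mem_satisfied_of_two hS hv hw h hvc hwc).2
  exact (Nat.not_even_iff_odd.2 hc.2) h1

/-- A satisfied check node at `v` has exactly one further end in `S`, a neighbour of `v`. Conversely
a neighbour determines the shared check node, by `NoFour`. -/
lemma ncard_satisfied (hG : NoFour G) (hS : G.IsElementary S) (v : S) :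
    {c | c ∈ G.satisfied S ∧ G.Adj v c}.ncard = ndeg (sgraph G S) v := by
  have hex : ∀ w, w ∈ (sgraph G S).neighborSet v → ∃ c, G.Adj v c ∧ G.Adj w c :=
    fun w hw => hw.2
  choose c hc using hex
  symm
  refine Set.ncard_congr c ?_ ?_ ?_
  · intro w hw
    exact ⟨mem_satisfied_of_two hS v.2 w.2 hw.1 (hc w hw).1 (hc w hw).2, (hc w hw).1⟩
  · intro w x hw hx e
    have h1 := hc w hw
    have h2 := hc x hx
    rw [← e] at h2
    rcases eq_or_eq_of_adj hS v.2 w.2 x.2 hw.1 h1.1 h1.2 h2.2 with h | h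
    · exact (hx.1 h.symm).elim
    · exact Subtype.ext h.symm
  · rintro d ⟨hd, hvd⟩
    obtain ⟨w, hw, hwv, hwd⟩ := exists_other (v := v.1) hd
    have hn : (⟨w, hw⟩ : S) ∈ (sgraph G S).neighborSet v := ⟨hwv.symm, d, hvd, hwd⟩
    exact ⟨⟨w, hw⟩, hn, hG _ _ _ _ hwv.symm (hc _ hn).1 (hc _ hn).2 hvd hwd⟩

lemma ncard_unsatisfied {d : ℕ} (hd : G.LeftRegular d) (hG : NoFour G) (hS : G.IsElementary S)
    (v : S) :
    {c | c ∈ G.unsatisfied S ∧ G.Adj v c}.ncard + ndeg (sgraph G S) v = d := by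
  rw [← ncard_satisfied hG hS, ← hd v, ← Set.ncard_union_eq]
  · congr 1
    ext c
    simp only [Set.mem_union, Set.mem_ofPred_eq]
    constructor
    · rintro (h | h) <;> exact h.2
    · intro h
      have hc : c ∈ G.checks S := ⟨v, v.2, h⟩
      rcases Nat.even_or_odd (G.checkDegree S c) with h' | h'
      · exact .inr ⟨⟨hc, h'⟩, h⟩
      · exact .inl ⟨⟨hc, h'⟩, h⟩
  · rw [Set.disjoint_left]
    rintro c h1 h2
    exact (Nat.not_even_iff_odd.2 h1.1.2) h2.1.2

/-- Every unsatisfied check node has a unique end in `S`, so the unsatisfied ones are counted node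
by node, with `d` minus the degree at each. -/
lemma ncard_unsatisfied_add_dsum [Fintype S] {d : ℕ} (hd : G.LeftRegular d) (hG : NoFour G)
    (hS : G.IsElementary S) :
    (G.unsatisfied S).ncard + dsum (sgraph G S) = d * S.ncard := by
  have hbij : Function.Bijective (fun p : (Σ v : S, {c // c ∈ G.unsatisfied S ∧ G.Adj v c}) =>
      (⟨p.2.1, p.2.2.1⟩ : G.unsatisfied S)) := by
    constructor
    · rintro ⟨v, c, hc, hvc⟩ ⟨w, d, hd, hwd⟩ e
      obtain rfl : c = d := by simpa using e
      obtain rfl : v = w := Subtype.ext (eq_of_unsatisfied hS hc v.2 w.2 hvc hwd)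
      rfl
    · rintro ⟨c, hc⟩
      obtain ⟨v, hv, hvc⟩ := hc.1
      exact ⟨⟨⟨v, hv⟩, c, hc, hvc⟩, rfl⟩
  have h1 := Nat.card_congr (Equiv.ofBijective _ hbij)
  rw [Nat.card_sigma] at h1
  have h2 : ∀ v : S, Nat.card {c // c ∈ G.unsatisfied S ∧ G.Adj v c} + ndeg (sgraph G S) v = d :=
    fun v => by
      rw [← ncard_unsatisfied hd hG hS v]
      exact congrArg (· + _) (Nat.card_coe_set_eq _)
  rw [← Nat.card_coe_set_eq, ← h1, dsum, ← Finset.sum_add_distrib,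
    Finset.sum_congr rfl fun v _ => h2 v, Finset.sum_const,
    Finset.card_univ, ← Nat.card_eq_fintype_card, Nat.card_coe_set_eq, smul_eq_mul, mul_comm]

/-- Walks alternate between the two sides, and two steps through a check node are one step (or none)
in the normal graph. Elementarity plays no role here. -/
lemma connected_inducedSubgraph_iff {D : Set G.L} :
    (G.inducedSubgraph D).Connected ↔ (sgraph G D).Connected := by
  have hl : ∀ {v}, v ∈ D → (Sum.inl v : G.L ⊕ G.R) ∈ G.inducedNodes D := fun h =>
    .inl ⟨_, h, rfl⟩
  have hr : ∀ {c}, c ∈ G.checks D → (Sum.inr c : G.L ⊕ G.R) ∈ G.inducedNodes D := fun h =>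
    .inr ⟨_, h, rfl⟩
  constructor
  · intro h
    -- The induction along a walk needs a claim for check nodes too: once a check node is reached,
    -- all its neighbours in `D` are reachable in the normal graph.
    have key : ∀ (v : D) (x : G.inducedNodes D),
        (G.inducedSubgraph D).Reachable ⟨Sum.inl v, hl v.2⟩ x →
        (∀ w : D, x.1 = Sum.inl w.1 → (sgraph G D).Reachable v w) ∧
        (∀ c, x.1 = Sum.inr c → ∀ w : D, G.Adj w c → (sgraph G D).Reachable v w) := by
      intro v x hx
      rw [SimpleGraph.reachable_iff_reflTransGen] at hx
      induction hx with
      | refl =>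
        refine ⟨fun w hw => ?_, fun c hc => by simp at hc⟩
        obtain rfl : v = w := Subtype.ext (by simpa using hw)
        exact .refl _
      | @tail y z _ hyz ih =>
        obtain ⟨y, hy⟩ := y
        obtain ⟨z, hz⟩ := z
        have hyz' : G.toSimpleGraph.Adj y z := hyz
        rcases y with y | y
        · rcases z with z | z
          · exact (not_adj_inl_inl G hyz').elim
          · rw [adj_inl_inr] at hyz'
            refine ⟨fun w hw => by simp at hw, fun c hc w hw => ?_⟩
            obtain rfl : z = c := by simpa using hc
            have hyD : y ∈ D := by
              rcases hy with ⟨_, h, e⟩ | ⟨_, h, e⟩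
              · simp only [Sum.inl.injEq] at e; exact e ▸ h
              · simp at e
            have h1 := ih.1 ⟨y, hyD⟩ rfl
            by_cases hyw : y = w
            · obtain rfl : (⟨y, hyD⟩ : D) = w := Subtype.ext hyw
              exact h1
            · exact h1.trans (SimpleGraph.Adj.reachable ⟨hyw, z, hyz', hw⟩)
        · rcases z with z | z
          · rw [adj_inr_inl] at hyz'
            refine ⟨fun w hw => ?_, fun c hc => by simp at hc⟩
            obtain rfl : z = w := by simpa using hw
            exact ih.2 y rfl w hyz'
          · exact (not_adj_inr_inr G hyz').elim
    obtain ⟨hp, ⟨x⟩⟩ := (SimpleGraph.connected_iff _).1 h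
    refine (SimpleGraph.connected_iff _).2 ⟨fun v w => (key v _ (hp _ ⟨_, hl w.2⟩)).1 w rfl, ?_⟩
    obtain ⟨x, ⟨v, hv, -⟩ | ⟨c, ⟨v, hv, -⟩, -⟩⟩ := x <;> exact ⟨⟨v, hv⟩⟩
  · intro h
    obtain ⟨hp, ⟨v0⟩⟩ := (SimpleGraph.connected_iff _).1 h
    have key : ∀ v w : D, (G.inducedSubgraph D).Reachable ⟨Sum.inl v, hl v.2⟩
        ⟨Sum.inl w, hl w.2⟩ := by
      intro v w
      have hx := hp v w
      rw [SimpleGraph.reachable_iff_reflTransGen] at hx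
      induction hx with
      | refl => exact .refl _
      | @tail y z _ hyz ih =>
        obtain ⟨hne, c, h1, h2⟩ := hyz
        have a1 : (G.inducedSubgraph D).Adj ⟨Sum.inl y, hl y.2⟩ ⟨Sum.inr c, hr ⟨y, y.2, h1⟩⟩ :=
          (adj_inl_inr G).2 h1
        have a2 : (G.inducedSubgraph D).Adj ⟨Sum.inr c, hr ⟨y, y.2, h1⟩⟩ ⟨Sum.inl z, hl z.2⟩ :=
          (adj_inr_inl G).2 h2
        exact ih.trans (a1.reachable.trans a2.reachable)
    have key2 : ∀ x, (G.inducedSubgraph D).Reachable ⟨Sum.inl v0, hl v0.2⟩ x := by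
      rintro ⟨x, ⟨v, hv, rfl⟩ | ⟨c, ⟨v, hv, hc⟩, rfl⟩⟩
      · exact key v0 ⟨v, hv⟩
      · have a1 : (G.inducedSubgraph D).Adj ⟨Sum.inl v, hl hv⟩ ⟨Sum.inr c, hr ⟨v, hv, hc⟩⟩ :=
          (adj_inl_inr G).2 hc
        exact (key v0 ⟨v, hv⟩).trans a1.reachable
    exact (SimpleGraph.connected_iff _).2 ⟨fun x y => (key2 x).symm.trans (key2 y), ⟨⟨_, hl v0.2⟩⟩⟩

lemma memT_iff (hG : NoFour G) (hS : G.IsElementary S) :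
    G.MemT S ↔ (sgraph G S).Connected ∧ ∀ v, 2 ≤ ndeg (sgraph G S) v := by
  unfold TannerGraph.MemT
  rw [connected_inducedSubgraph_iff]
  refine and_congr_right fun _ => ⟨fun h v => ?_, fun h v hv => ?_⟩
  · rw [← ncard_satisfied hG hS]
    exact h v v.2
  · exact (ncard_satisfied hG hS ⟨v, hv⟩).symm ▸ h ⟨v, hv⟩

/-- A node of degree m has m satisfied and 5 - m unsatisfied neighbours, and 5 - m < m means that m
is at least 3. -/
lemma isAbsorbing_iff (hd : G.LeftRegular 5) (hG : NoFour G) (hS : G.IsElementary S) :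
    G.IsAbsorbing S ↔ ∀ v, 3 ≤ ndeg (sgraph G S) v := by
  have key : ∀ v : S, ({c | c ∈ G.unsatisfied S ∧ G.Adj v c}.ncard <
      {c | c ∈ G.satisfied S ∧ G.Adj v c}.ncard) ↔ 3 ≤ ndeg (sgraph G S) v := fun v => by
    have h1 := ncard_satisfied hG hS v
    have h2 := ncard_unsatisfied hd hG hS v
    omega
  exact ⟨fun h v => (key v).1 (h v v.2), fun h v hv => (key ⟨v, hv⟩).2 (h ⟨v, hv⟩)⟩

lemma ndeg_le (hd : G.LeftRegular 5) (hG : NoFour G) (hS : G.IsElementary S) (v : S) :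
    ndeg (sgraph G S) v ≤ 5 := by
  have h2 := ncard_unsatisfied hd hG hS v
  omega

end TrappingSet

end TrappingSets

namespace TrappingSets

/-! ### Layered supersets of cycles as percolating cycles -/

section LSS

variable {G : TannerGraph} {S : Set G.L}

lemma CycleOn.adj_pred {V : Type*} {H : SimpleGraph V} {k : ℕ} {f : ℕ → V} (h : CycleOn H k f)
    {i : ℕ} (hi : i < k) : ∃ j < k, ∃ l < k, f j ≠ f l ∧ H.Adj (f i) (f j) ∧ H.Adj (f i) (f l) := by
  obtain ⟨h3, h0, hinj, hadj⟩ := h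
  obtain ⟨j, hj, hj1, hj2⟩ : ∃ j < k, H.Adj (f i) (f j) ∧ (i + 1 = j ∨ i + 1 = k ∧ j = 0) := by
    by_cases h : i + 1 < k
    · exact ⟨i + 1, h, hadj i hi, .inl rfl⟩
    · obtain rfl : k = i + 1 := by omega
      exact ⟨0, by omega, h0 ▸ hadj i hi, .inr ⟨rfl, rfl⟩⟩
  obtain ⟨l, hl, hl1, hl2⟩ : ∃ l < k, H.Adj (f i) (f l) ∧ (l + 1 = i ∨ l + 1 = k ∧ i = 0) := by
    by_cases h : i = 0
    · subst h
      refine ⟨k - 1, by omega, ?_, by omega⟩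
      have := hadj (k - 1) (by omega)
      rw [Nat.sub_add_cancel (by omega), h0] at this
      exact this.symm
    · refine ⟨i - 1, by omega, ?_, by omega⟩
      have := hadj (i - 1) (by omega)
      rw [Nat.sub_add_cancel (by omega)] at this
      exact this.symm
  -- Successor and predecessor on the cycle differ because its length is at least three.
  refine ⟨j, hj, l, hl, fun e => ?_, hj1, hl1⟩
  have := hinj hj hl e
  omega

lemma two_le_ndeg {D : Set G.L} {v u w : D} (huw : u ≠ w) (hu : (sgraph G D).Adj v u)
    (hw : (sgraph G D).Adj v w) : 2 ≤ ndeg (sgraph G D) v := by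
  rw [← Set.ncard_pair huw]
  apply Set.ncard_le_ncard _ (Set.toFinite _)
  rintro x (rfl | rfl)
  · exact hu
  · exact hw

lemma exists_two_adj {D : Set G.L} {v : D} (h : 2 ≤ ndeg (sgraph G D) v) :
    ∃ u w : D, u ≠ w ∧ (sgraph G D).Adj v u ∧ (sgraph G D).Adj v w := by
  obtain ⟨u, hu, w, hw, h⟩ := (Set.one_lt_ncard (Set.toFinite _)).1 h
  exact ⟨u, w, h, hu, hw⟩

lemma memT_insert (hG : NoFour G) (hS : G.IsElementary S) {D : Set G.L} (hD : D ⊆ S)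
    (hT : G.MemT D) {v u w : G.L} (hv : v ∈ S) (hu : u ∈ D) (hw : w ∈ D) (huw : u ≠ w)
    (hvu : (normal G).Adj v u) (hvw : (normal G).Adj v w) : G.MemT (insert v D) := by
  rw [memT_iff hG (elementary_mono hD hS)] at hT
  rw [memT_iff hG (elementary_mono (Set.insert_subset hv hD) hS)]
  refine ⟨?_, ?_⟩
  · have h := SimpleGraph.induce_union_connected
      (SimpleGraph.induce_pair_connected_of_adj hvu).preconnected hT.1.preconnected
      ⟨u, by simp, hu⟩
    have e : ({v, u} : Set G.L) ∪ D = insert v D := by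
      rw [Set.insert_union, Set.singleton_union, Set.insert_eq_of_mem hu]
    rwa [e] at h
  · rintro ⟨x, rfl | hx⟩
    · exact two_le_ndeg (u := ⟨u, .inr hu⟩) (w := ⟨w, .inr hw⟩)
        (fun e => huw (congrArg Subtype.val e)) hvu hvw
    · obtain ⟨a, b, hab, ha, hb⟩ := exists_two_adj (hT.2 ⟨x, hx⟩)
      exact two_le_ndeg (u := ⟨a, .inr a.2⟩) (w := ⟨b, .inr b.2⟩)
        (by simpa [Subtype.ext_iff] using hab) ha hb

/-- A proper subset `D` containing `C` is not two-closed, so some outside vertex has two neighbours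
in `D`; adding it stays in the class T. The induction is on the number of missing vertices. -/
lemma isLSS_of_percolates (hG : NoFour G) (hS : G.IsElementary S) {C : Set S}
    (hC : Percolates (sgraph G S) C) :
    ∀ (n : ℕ) (D : Set G.L), D ⊆ S → (Subtype.val '' C) ⊆ D → G.MemT D → (S \ D).ncard = n →
      G.IsLSS S D := by
  intro n
  induction n with
  | zero =>
    intro D hD _ hT hn
    rw [Set.ncard_eq_zero (Set.toFinite _), Set.sdiff_eq_empty] at hn
    obtain rfl : D = S := hD.antisymm hn
    exact ⟨0, fun _ => D, rfl, rfl, by simp, fun i hi => ⟨hS, hT, by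
        obtain rfl : i = 0 := by omega
        rfl⟩⟩
  | succ n ih =>
    intro D hD hCD hT hn
    have hnu : (Subtype.val ⁻¹' D : Set S) ≠ Set.univ := by
      intro e
      have : S \ D = ∅ := by
        rw [Set.sdiff_eq_empty]
        intro x hx
        have : (⟨x, hx⟩ : S) ∈ (Subtype.val ⁻¹' D : Set S) := e ▸ Set.mem_univ _
        exact this
      rw [this] at hn
      simp at hn
    have hnc : ¬ TwoClosed (sgraph G S) (Subtype.val ⁻¹' D) := fun h => hnu (hC _ h (by
      intro x hx
      exact hCD ⟨x, hx, rfl⟩))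
    unfold TwoClosed at hnc
    push Not at hnc
    obtain ⟨v, u, w, hu, hw, huw, hvu, hvw, hvD⟩ := hnc
    have hvD' : v.1 ∉ D := hvD
    have hins : insert v.1 D ⊆ S := Set.insert_subset v.2 hD
    have hcard : (insert v.1 D).ncard = D.ncard + 1 := Set.ncard_insert_of_notMem hvD'
    obtain ⟨k, T, h0, hk, hss, hT'⟩ := ih (insert v.1 D) hins (hCD.trans (Set.subset_insert _ _))
      (memT_insert hG hS hD hT v.2 hu hw (by simpa [Subtype.ext_iff] using huw) hvu hvw) (by
        have : S \ insert v.1 D = (S \ D) \ {v.1} := by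
          ext x; simp only [Set.mem_sdiff, Set.mem_insert_iff, Set.mem_singleton_iff]; tauto
        rw [this, Set.ncard_sdiff_singleton_of_mem (show v.1 ∈ S \ D from ⟨v.2, hvD'⟩), hn]
        rfl)
    refine ⟨k + 1, fun i => if i = 0 then D else T (i - 1), by simp, by simp [hk], ?_, ?_⟩
    · intro i hi
      rcases i with _ | i
      · simp only [if_true, zero_add, one_ne_zero, if_false, Nat.sub_self, h0]
        exact Set.ssubset_insert hvD'
      · simpa using hss i (by omega)
    · intro i hi
      rcases i with _ | i
      · simpa using ⟨elementary_mono hD hS, hT⟩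
      · obtain ⟨h1, h2, h3⟩ := hT' i (by omega)
        simp only [Nat.add_eq_zero_iff, one_ne_zero, and_false, if_false, Nat.add_sub_cancel]
        exact ⟨h1, h2, by rw [h3, hcard]; ring⟩

lemma memT_cycle (hG : NoFour G) (hS : G.IsElementary S) {k : ℕ} {f : ℕ → S}
    (hf : CycleOn (sgraph G S) k f) : G.MemT (Subtype.val '' (f '' Set.Iio k)) := by
  have hsub : Subtype.val '' (f '' Set.Iio k) ⊆ S := by
    rintro _ ⟨x, -, rfl⟩
    exact x.2
  have hmem : ∀ i, i < k → (f i).1 ∈ Subtype.val '' (f '' Set.Iio k) := fun i hi =>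
    ⟨_, ⟨i, hi, rfl⟩, rfl⟩
  rw [memT_iff hG (elementary_mono hsub hS)]
  constructor
  · have h3 := hf.1
    have key : ∀ i (hi : i < k), (sgraph G (Subtype.val '' (f '' Set.Iio k))).Reachable
        ⟨_, hmem 0 (by omega)⟩ ⟨_, hmem i hi⟩ := by
      intro i
      induction i with
      | zero => intro _; exact .refl _
      | succ i ih =>
        intro hi
        refine (ih (by omega)).trans (SimpleGraph.Adj.reachable ?_)
        exact hf.2.2.2 i (by omega)
    refine (SimpleGraph.connected_iff _).2 ⟨?_, ⟨⟨_, hmem 0 (by omega)⟩⟩⟩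
    rintro ⟨_, _, ⟨i, hi, rfl⟩, rfl⟩ ⟨_, _, ⟨j, hj, rfl⟩, rfl⟩
    exact (key i hi).symm.trans (key j hj)
  · rintro ⟨_, _, ⟨i, hi, rfl⟩, rfl⟩
    obtain ⟨j, hj, l, hl, hne, h1, h2⟩ := hf.adj_pred hi
    exact two_le_ndeg (u := ⟨_, hmem j hj⟩) (w := ⟨_, hmem l hl⟩)
      (by simpa [Subtype.ext_iff] using hne) h1 h2

/-- The edges of the cycle use distinct check nodes: a check node has at most two ends in `S`, so a
repetition would identify two edges, impossible for length at least three. -/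
lemma exists_tcycle_of_cycleOn (hS : G.IsElementary S) {k : ℕ} {f : ℕ → S}
    (hf : CycleOn (sgraph G S) k f) : ∃ c, TCycle G k (fun i => (f i).1) c := by
  obtain ⟨h3, h0, hinj, hadj⟩ := hf
  have hex : ∀ i, ∃ c, i < k → G.Adj (f i) c ∧ G.Adj (f (i + 1)) c := by
    intro i
    by_cases hi : i < k
    · obtain ⟨-, c, hc⟩ := hadj i hi
      exact ⟨c, fun _ => hc⟩
    · obtain ⟨-, c, hc⟩ := hadj 0 (by omega)
      exact ⟨c, fun h => (hi h).elim⟩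
  choose c hc using hex
  refine ⟨c, by omega, by simp [h0], fun i hi j hj e => hinj hi hj (Subtype.ext e), ?_, hc⟩
  have key : ∀ i < k, ∀ j < k, f j = f (i + 1) → i + 1 = j ∨ i + 1 = k ∧ j = 0 := by
    intro i hi j hj e
    by_cases h : i + 1 < k
    · exact .inl (hinj hj h e).symm
    · obtain rfl : k = i + 1 := by omega
      rw [h0] at e
      exact .inr ⟨rfl, hinj hj (by simp) e⟩
  intro i hi j hj e
  by_contra hij
  simp only [Set.mem_Iio] at hi hj
  have hi' := hc i hi
  have hj' := hc j hj
  rw [← e] at hj'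
  have hne : (f i).1 ≠ (f (i + 1)).1 := (hadj i hi).1
  have e1 : f j = f (i + 1) := by
    rcases eq_or_eq_of_adj hS (f i).2 (f (i + 1)).2 (f j).2 hne hi'.1 hi'.2 hj'.1 with h | h
    · exact (hij (hinj hi hj (Subtype.ext h.symm))).elim
    · exact Subtype.ext h
  have hne' : (f j).1 ≠ (f (j + 1)).1 := (hadj j hj).1
  have e2 : f i = f (j + 1) := by
    rcases eq_or_eq_of_adj hS (f j).2 (f (j + 1)).2 (f i).2 hne' hj'.1 hj'.2 hi'.1 with h | h
    · exact (hij (hinj hi hj (Subtype.ext h))).elim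
    · exact Subtype.ext h
  have := key i hi j hj e1
  have := key j hj i hi e2
  omega

lemma isLSSOfCycle_of_percCyc (hG : NoFour G) (hS : G.IsElementary S) {k : ℕ}
    (h : PercCyc (sgraph G S) k) : G.IsLSSOfCycle S (2 * k) := by
  obtain ⟨f, hf, hp⟩ := h
  obtain ⟨c, hc⟩ := exists_tcycle_of_cycleOn hS hf
  obtain ⟨u, w, hw, hl, hs⟩ := hc.exists_walk
  have hsub : Subtype.val '' (f '' Set.Iio k) ⊆ S := by
    rintro _ ⟨x, -, rfl⟩
    exact x.2
  refine ⟨_, hsub, ⟨u, w, hw, hl, ?_⟩,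
    isLSS_of_percolates hG hS hp _ _ hsub subset_rfl (memT_cycle hG hS hf) rfl⟩
  rw [hs, Set.image_image]

/-- Each set of the chain adds one node, whose two satisfied check nodes lead to two different old
nodes. So a two-closed set that contains the cycle absorbs the whole chain. -/
lemma percCyc_of_isLSSOfCycle (hG : NoFour G) {x : ℕ} (h : G.IsLSSOfCycle S x) :
    ∃ k, x = 2 * k ∧ PercCyc (sgraph G S) k := by
  obtain ⟨C, hCS, ⟨u, w, hw, hl, hC⟩, n, T, hT0, hTn, hss, hT⟩ := h
  obtain ⟨k, f, c, ⟨h2, h0, hf, hc, ha⟩, hl', hs⟩ := exists_tcycle w hw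
  rw [hs] at hC
  have hfS : ∀ i, i < k → f i ∈ S := fun i hi => hCS (hC ▸ ⟨i, hi, rfl⟩)
  have hfS' : ∀ i, i ≤ k → f i ∈ S := fun i hi => by
    rcases hi.lt_or_eq with h | rfl
    · exact hfS i h
    · rw [h0]; exact hfS 0 (by omega)
  have hne : ∀ i < k, f i ≠ f (i + 1) := by
    intro i hi e
    by_cases h : i + 1 < k
    · have := hf hi h e
      omega
    · obtain rfl : k = i + 1 := by omega
      rw [h0] at e
      have := hf hi (by simp : 0 ∈ Set.Iio (i + 1)) e
      omega
  have h3 : 3 ≤ k := by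
    by_contra hk
    obtain rfl : k = 2 := by omega
    have e := hG (f 0) (f 1) (c 0) (c 1) (hne 0 (by simp))
      (ha 0 (by simp)).1 (ha 0 (by simp)).2 (h0 ▸ (ha 1 (by simp)).2) (ha 1 (by simp)).1
    simpa using hc (x₁ := 0) (x₂ := 1) (by simp) (by simp) e
  have : ∀ i, ∃ v : S, i ≤ k → f i = v := fun i => by
    by_cases h : i ≤ k
    · exact ⟨⟨f i, hfS' i h⟩, fun _ => rfl⟩
    · exact ⟨⟨f 0, hfS' 0 (by omega)⟩, fun h' => (h h').elim⟩
  choose F hF using this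
  refine ⟨k, by omega, F, ⟨h3, Subtype.ext ?_, ?_, ?_⟩, ?_⟩
  · rw [← hF k le_rfl, ← hF 0 (by omega), h0]
  · intro i hi j hj e
    simp only [Set.mem_Iio] at hi hj
    exact hf hi hj (by rw [hF i (by omega), hF j (by omega), e])
  · intro i hi
    have h1 := hne i hi
    have h2 := ha i hi
    rw [hF i (by omega), hF (i + 1) (by omega)] at h1 h2
    exact ⟨h1, c i, h2.1, h2.2⟩
  · intro A hA hCA
    -- Induction downwards from the top of the chain, where the set is `S`.
    have hmono : ∀ j, j ≤ n → T (n - j) ⊆ S := by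
      intro j
      induction j with
      | zero => intro _; simp [hTn]
      | succ j ih =>
        intro hj
        have := hss (n - (j + 1)) (by omega)
        rw [show n - (j + 1) + 1 = n - j by omega] at this
        exact this.1.trans (ih (by omega))
    have hTS : ∀ i, i ≤ n → T i ⊆ S := fun i hi => by
      have := hmono (n - i) (by omega)
      rwa [show n - (n - i) = i by omega] at this
    have key : ∀ i, i ≤ n → ∀ v : S, v.1 ∈ T i → v ∈ A := by
      intro i
      induction i with
      | zero =>
        intro _ v hv
        rw [hT0, hC] at hv
        obtain ⟨j, hj, e⟩ := hv
        simp only [Set.mem_Iio] at hj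
        refine hCA ⟨j, hj, Subtype.ext ?_⟩
        rw [← hF j (by omega), e]
      | succ i ih =>
        intro hi v hv
        by_cases hvi : v.1 ∈ T i
        · exact ih (by omega) v hvi
        -- The size grows by exactly one, so `v` is the only new node.
        have hTi : T (i + 1) = insert v.1 (T i) := by
          symm
          refine Set.eq_of_subset_of_ncard_le
            (Set.insert_subset hv (hss i (by omega)).1) ?_ (Set.toFinite _)
          rw [Set.ncard_insert_of_notMem hvi, (hT i (by omega)).2.2, (hT (i + 1) hi).2.2]
          omega
        obtain ⟨c1, hc1, c2, hc2, hcc⟩ := (Set.one_lt_ncard (Set.toFinite _)).1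
          ((hT (i + 1) hi).2.1.2 v hv)
        obtain ⟨u1, hu1, hne1, hadj1⟩ := exists_other (v := v.1) hc1.1
        obtain ⟨u2, hu2, hne2, hadj2⟩ := exists_other (v := v.1) hc2.1
        have m1 : u1 ∈ T i := by
          rw [hTi] at hu1
          exact hu1.resolve_left hne1
        have m2 : u2 ∈ T i := by
          rw [hTi] at hu2
          exact hu2.resolve_left hne2
        -- Equal other ends would share two check nodes with `v`, against `NoFour`.
        have hu12 : u1 ≠ u2 := by
          rintro rfl
          exact hcc (hG _ _ _ _ hne1.symm hc1.2 hadj1 hc2.2 hadj2)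
        have s1 := hTS i (by omega) m1
        have s2 := hTS i (by omega) m2
        exact hA v ⟨u1, s1⟩ ⟨u2, s2⟩ (ih (by omega) _ m1) (ih (by omega) _ m2)
          (by simpa using hu12) ⟨hne1.symm, c1, hc1.2, hadj1⟩ ⟨hne2.symm, c2, hc2.2, hadj2⟩
    ext v
    simp only [Set.mem_univ, iff_true]
    exact key n le_rfl v (by rw [hTn]; exact v.2)

/-- The type of a layered superset structure, in terms of its normal graph. -/
def GraphType {V : Type*} (H : SimpleGraph V) : Option ℕ → Prop
  | some x => IsLeast {y | ∃ k, y = 2 * k ∧ PercCyc H k} x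
  | none => ∀ k, ¬ PercCyc H k

lemma hasLSSType_iff (hG : NoFour G) (hS : G.IsElementary S) (t : Option ℕ) :
    G.HasLSSType S t ↔ GraphType (sgraph G S) t := by
  have key : ∀ y, G.IsLSSOfCycle S y ↔ ∃ k, y = 2 * k ∧ PercCyc (sgraph G S) k := fun y =>
    ⟨percCyc_of_isLSSOfCycle hG, by
      rintro ⟨k, rfl, h⟩
      exact isLSSOfCycle_of_percCyc hG hS h⟩
  rcases t with _ | x
  · simp only [TannerGraph.HasLSSType, GraphType, key]
    exact ⟨fun h k hk => h _ ⟨k, rfl, hk⟩, fun h y ⟨k, _, hk⟩ => h k hk⟩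
  · simp only [TannerGraph.HasLSSType, GraphType, key]

end LSS

end TrappingSets

namespace TrappingSets

/-! ### Isomorphic structures and isomorphic normal graphs -/

section Iso

variable {G G' : TannerGraph} {S : Set G.L} {S' : Set G'.L}

/-- A variable node of `S`, as a node of the induced subgraph. -/
def nodeL (G : TannerGraph) (S : Set G.L) (v : S) : G.inducedNodes S :=
  ⟨Sum.inl v, .inl ⟨v, v.2, rfl⟩⟩

/-- A check node of `S`, as a node of the induced subgraph. -/
def nodeR (G : TannerGraph) (S : Set G.L) (c : G.checks S) : G.inducedNodes S :=
  ⟨Sum.inr c, .inr ⟨c, c.2, rfl⟩⟩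

lemma node_cases (x : G.inducedNodes S) : (∃ v, x = nodeL G S v) ∨ ∃ c, x = nodeR G S c := by
  obtain ⟨x, ⟨v, hv, rfl⟩ | ⟨c, hc, rfl⟩⟩ := x
  · exact .inl ⟨⟨v, hv⟩, rfl⟩
  · exact .inr ⟨⟨c, hc⟩, rfl⟩

lemma nodeL_injective : Function.Injective (nodeL G S) := fun v w h => by
  simpa [nodeL, Subtype.ext_iff] using h

lemma nodeR_injective : Function.Injective (nodeR G S) := fun v w h => by
  simpa [nodeR, Subtype.ext_iff] using h

lemma nodeL_ne_nodeR (v : S) (c : G.checks S) : nodeL G S v ≠ nodeR G S c := fun h =>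
  Sum.inl_ne_inr (congrArg Subtype.val h)

lemma adj_nodeL_nodeR (v : S) (c : G.checks S) :
    (G.inducedSubgraph S).Adj (nodeL G S v) (nodeR G S c) ↔ G.Adj v c := adj_inl_inr G

lemma adj_nodeR_nodeL (v : S) (c : G.checks S) :
    (G.inducedSubgraph S).Adj (nodeR G S c) (nodeL G S v) ↔ G.Adj v c := adj_inr_inl G

lemma not_adj_nodeL (v w : S) : ¬ (G.inducedSubgraph S).Adj (nodeL G S v) (nodeL G S w) :=
  not_adj_inl_inl G

lemma not_adj_nodeR (c d : G.checks S) :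
    ¬ (G.inducedSubgraph S).Adj (nodeR G S c) (nodeR G S d) := not_adj_inr_inr G

lemma ndeg_nodeL {d : ℕ} (hd : G.LeftRegular d) (v : S) :
    ndeg (G.inducedSubgraph S) (nodeL G S v) = d := by
  rw [← hd v]
  symm
  refine Set.ncard_congr (fun c hc => nodeR G S ⟨c, v, v.2, hc⟩) ?_ ?_ ?_
  · intro c hc
    exact (adj_nodeL_nodeR _ _).2 hc
  · intro c d hc hd e
    exact congrArg Subtype.val (nodeR_injective e)
  · intro x hx
    rcases node_cases x with ⟨w, rfl⟩ | ⟨c, rfl⟩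
    · exact (not_adj_nodeL _ _ hx).elim
    · exact ⟨c, (adj_nodeL_nodeR _ _).1 hx, rfl⟩

lemma ndeg_nodeR (hS : G.IsElementary S) (c : G.checks S) :
    ndeg (G.inducedSubgraph S) (nodeR G S c) ≤ 2 := by
  have : G.checkDegree S c = ndeg (G.inducedSubgraph S) (nodeR G S c) := by
    refine Set.ncard_congr (fun v hv => nodeL G S ⟨v, hv.1⟩) ?_ ?_ ?_
    · intro v hv
      exact (adj_nodeR_nodeL _ _).2 hv.2
    · intro c d hc hd e
      exact congrArg Subtype.val (nodeL_injective e)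
    · intro x hx
      rcases node_cases x with ⟨w, rfl⟩ | ⟨c, rfl⟩
      · exact ⟨w, ⟨w.2, (adj_nodeR_nodeL _ _).1 hx⟩, rfl⟩
      · exact (not_adj_nodeR _ _ hx).elim
  have := hS c c.2
  omega

/-- Adjacency in the normal graph is expressed by common neighbours in the induced subgraph, a
notion that isomorphisms preserve. -/
lemma sgraph_adj_iff (v w : S) : (sgraph G S).Adj v w ↔ v ≠ w ∧
    ∃ x, (G.inducedSubgraph S).Adj (nodeL G S v) x ∧ (G.inducedSubgraph S).Adj (nodeL G S w) x := by
  constructor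
  · rintro ⟨h, c, h1, h2⟩
    exact ⟨fun e => h (congrArg _ e), nodeR G S ⟨c, v, v.2, h1⟩, (adj_nodeL_nodeR _ _).2 h1,
      (adj_nodeL_nodeR _ _).2 h2⟩
  · rintro ⟨h, x, h1, h2⟩
    rcases node_cases x with ⟨w, rfl⟩ | ⟨c, rfl⟩
    · exact (not_adj_nodeL _ _ h1).elim
    · exact ⟨fun e => h (Subtype.ext e), c, (adj_nodeL_nodeR _ _).1 h1,
        (adj_nodeL_nodeR _ _).1 h2⟩

/-- An isomorphism of unmarked graphs cannot swap the sides: variable nodes have degree 5, check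
nodes at most 2. -/
lemma exists_nodeL_of_iso (hd : G.LeftRegular 5) (hS' : G'.IsElementary S')
    (φ : G.inducedSubgraph S ≃g G'.inducedSubgraph S') (v : S) :
    ∃ w, φ (nodeL G S v) = nodeL G' S' w := by
  rcases node_cases (φ (nodeL G S v)) with h | ⟨c, hc⟩
  · exact h
  · have h1 := ndeg_iso φ (nodeL G S v)
    rw [ndeg_nodeL hd, hc] at h1
    have := ndeg_nodeR hS' c
    omega

lemma sgraph_iso_of_iso (hd : G.LeftRegular 5) (hS : G.IsElementary S) (hd' : G'.LeftRegular 5)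
    (hS' : G'.IsElementary S') (φ : G.inducedSubgraph S ≃g G'.inducedSubgraph S') :
    Nonempty (sgraph G S ≃g sgraph G' S') := by
  choose f hf using exists_nodeL_of_iso hd hS' φ
  choose g hg using exists_nodeL_of_iso hd' hS φ.symm
  have hgf : ∀ v, g (f v) = v := fun v => nodeL_injective (by rw [← hg, ← hf]; simp)
  have hfg : ∀ v, f (g v) = v := fun v => nodeL_injective (by rw [← hf, ← hg]; simp)
  refine ⟨⟨⟨f, g, hgf, hfg⟩, ?_⟩⟩
  intro v w
  simp only [Equiv.coe_fn_mk, sgraph_adj_iff]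
  refine and_congr (not_congr ⟨fun h => by rw [← hgf v, ← hgf w, h], fun h => h ▸ rfl⟩) ?_
  rw [← hf, ← hf]
  constructor
  · rintro ⟨x, h1, h2⟩
    refine ⟨φ.symm x, ?_, ?_⟩
    · rwa [← φ.map_adj_iff, φ.apply_symm_apply]
    · rwa [← φ.map_adj_iff, φ.apply_symm_apply]
  · rintro ⟨x, h1, h2⟩
    exact ⟨φ x, φ.map_adj_iff.2 h1, φ.map_adj_iff.2 h2⟩

/-- The nodes of `S` adjacent to a check node. -/
def ends (S : Set G.L) (c : G.checks S) : Set S := {v | G.Adj v c}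

lemma ends_cases (hS : G.IsElementary S) (c : G.checks S) :
    (∃ v, ends S c = {v}) ∨ ∃ v w, v ≠ w ∧ ends S c = {v, w} := by
  obtain ⟨c, v, hv, hc⟩ := c
  by_cases h : ∃ w : S, w ≠ ⟨v, hv⟩ ∧ G.Adj w c
  · obtain ⟨w, hw, hwc⟩ := h
    refine .inr ⟨⟨v, hv⟩, w, hw.symm, ?_⟩
    ext x
    simp only [ends, Set.mem_ofPred_eq, Set.mem_insert_iff, Set.mem_singleton_iff]
    constructor
    · intro hx
      rcases eq_or_eq_of_adj hS hv w.2 x.2 (fun e => hw (Subtype.ext e.symm)) hc hwc hx with h | h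
      · exact .inl (Subtype.ext h)
      · exact .inr (Subtype.ext h)
    · rintro (rfl | rfl)
      · exact hc
      · exact hwc
  · push Not at h
    refine .inl ⟨⟨v, hv⟩, ?_⟩
    ext x
    simp only [ends, Set.mem_ofPred_eq, Set.mem_singleton_iff]
    exact ⟨fun hx => by_contra fun hne => h x hne hx, by rintro rfl; exact hc⟩

lemma card_ends_eq_singleton (hd : G.LeftRegular 5) (hG : NoFour G) (hS : G.IsElementary S)
    (v : S) : Nat.card {c // ends S c = {v}} + ndeg (sgraph G S) v = 5 := by
  rw [← ncard_unsatisfied hd hG hS v, ← Nat.card_coe_set_eq]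
  congr 1
  refine Nat.card_congr ⟨fun c => ⟨c.1.1, ?_⟩, fun c => ⟨⟨c.1, c.2.1.1⟩, ?_⟩, fun _ => rfl,
    fun _ => rfl⟩
  · have hv : v ∈ ends S c.1 := by rw [c.2]; rfl
    refine ⟨⟨c.1.2, ?_⟩, hv⟩
    by_contra h
    obtain ⟨w, hw, hne, hwc⟩ := exists_other (v := v.1) (S := S)
      (c := c.1.1) ⟨c.1.2, Nat.not_odd_iff_even.1 h⟩
    have : (⟨w, hw⟩ : S) ∈ ends S c.1 := hwc
    rw [c.2] at this
    exact hne (congrArg Subtype.val this)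
  · ext w
    simp only [ends, Set.mem_ofPred_eq, Set.mem_singleton_iff]
    exact ⟨fun h => Subtype.ext (eq_of_unsatisfied hS c.2.1 w.2 v.2 h c.2.2),
      by rintro rfl; exact c.2.2⟩

open Classical in
lemma card_ends_eq_pair (hG : NoFour G) (hS : G.IsElementary S) {v w : S} (h : v ≠ w) :
    Nat.card {c // ends S c = {v, w}} = if (sgraph G S).Adj v w then 1 else 0 := by
  have h' : v.1 ≠ w.1 := fun e => h (Subtype.ext e)
  have hends : ∀ c : {c // ends S c = {v, w}}, G.Adj v c.1 ∧ G.Adj w c.1 := by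
    rintro ⟨c, hc⟩
    have hv : v ∈ ends S c := by rw [hc]; simp
    have hw : w ∈ ends S c := by rw [hc]; simp
    exact ⟨hv, hw⟩
  split_ifs with hadj
  · rw [Nat.card_eq_one_iff_unique]
    refine ⟨⟨fun c d => ?_⟩, ?_⟩
    · exact Subtype.ext (Subtype.ext (hG v w _ _ h' (hends c).1 (hends c).2 (hends d).1
        (hends d).2))
    · obtain ⟨-, c, hvc, hwc⟩ := hadj
      refine ⟨⟨⟨c, v, v.2, hvc⟩, ?_⟩⟩
      ext x
      simp only [ends, Set.mem_ofPred_eq, Set.mem_insert_iff, Set.mem_singleton_iff]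
      constructor
      · intro hx
        rcases eq_or_eq_of_adj hS v.2 w.2 x.2 h' hvc hwc hx with e | e
        · exact .inl (Subtype.ext e)
        · exact .inr (Subtype.ext e)
      · rintro (rfl | rfl)
        · exact hvc
        · exact hwc
  · rw [Nat.card_eq_zero]
    exact .inl ⟨fun c => hadj ⟨h', c.1, (hends c).1, (hends c).2⟩⟩

/-- Used to match the check nodes of two sets according to their sets of ends. -/
lemma exists_equiv_of_fibers {A B T : Type*} [Finite A] [Finite B] (f : A → T) (g : B → T)
    (h : ∀ t, Nat.card {a // f a = t} = Nat.card {b // g b = t}) :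
    ∃ e : A ≃ B, ∀ a, g (e a) = f a := by
  let E := fun t => Classical.choice (Finite.card_eq.1 (h t))
  refine ⟨(Equiv.sigmaFiberEquiv f).symm.trans ((Equiv.sigmaCongrRight E).trans
    (Equiv.sigmaFiberEquiv g)), fun a => ?_⟩
  exact (E (f a) ⟨a, rfl⟩).2

/-- The normal graph determines how many check nodes have a given set of ends: 5 minus the degree
for a single node, one for an edge, none otherwise. Check nodes with corresponding ends can then be
matched arbitrarily. -/
lemma iso_of_sgraph_iso (hd : G.LeftRegular 5) (hG : NoFour G) (hS : G.IsElementary S)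
    (hd' : G'.LeftRegular 5) (hG' : NoFour G') (hS' : G'.IsElementary S')
    (ψ : sgraph G S ≃g sgraph G' S') :
    Nonempty (G.inducedSubgraph S ≃g G'.inducedSubgraph S') := by
  classical
  have himg : ∀ (A : Set S) (B : Set S'), ψ '' A = B ↔ A = ψ.symm '' B := fun A B => by
    constructor
    · rintro rfl
      rw [Set.image_image]; simp
    · rintro rfl
      rw [Set.image_image]; simp
  obtain ⟨β, hβ⟩ := exists_equiv_of_fibers (fun c => ψ '' ends S c) (fun c => ends S' c) (by
    intro T
    simp only [himg]
    by_cases h1 : ∃ v, T = {v}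
    · obtain ⟨v, rfl⟩ := h1
      rw [Set.image_singleton]
      have e1 := card_ends_eq_singleton hd hG hS (ψ.symm v)
      have e2 := card_ends_eq_singleton hd' hG' hS' v
      rw [ndeg_iso ψ.symm v] at e1
      omega
    by_cases h2 : ∃ v w, v ≠ w ∧ T = {v, w}
    · obtain ⟨v, w, h, rfl⟩ := h2
      rw [Set.image_pair, card_ends_eq_pair hG hS (fun e => h (ψ.symm.injective e)),
        card_ends_eq_pair hG' hS' h]
      exact if_congr ψ.symm.map_adj_iff rfl rfl
    · have e1 : IsEmpty {c // ends S c = ψ.symm '' T} := ⟨fun ⟨c, hc⟩ => by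
        rw [← himg] at hc
        rcases ends_cases hS c with ⟨v, hv⟩ | ⟨v, w, h, hv⟩
        · rw [hv, Set.image_singleton] at hc
          exact h1 ⟨_, hc.symm⟩
        · rw [hv, Set.image_pair] at hc
          exact h2 ⟨_, _, fun e => h (ψ.injective e), hc.symm⟩⟩
      have e2 : IsEmpty {c // ends S' c = T} := ⟨fun ⟨c, hc⟩ => by
        rcases ends_cases hS' c with ⟨v, hv⟩ | ⟨v, w, h, hv⟩
        · exact h1 ⟨_, hc.symm.trans hv⟩
        · exact h2 ⟨_, _, h, hc.symm.trans hv⟩⟩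
      rw [Nat.card_of_isEmpty, Nat.card_of_isEmpty])
  have hadj : ∀ v c, G'.Adj (ψ v) (β c) ↔ G.Adj v c := by
    intro v c
    have : ψ v ∈ ends S' (β c) ↔ v ∈ ends S c := by
      rw [hβ, Set.mem_image]
      exact ⟨by rintro ⟨w, hw, e⟩; rwa [← ψ.injective e], fun h => ⟨v, h, rfl⟩⟩
    exact this
  have hbij : ∀ {G : TannerGraph} (S : Set G.L),
      Function.Bijective (Sum.elim (nodeL G S) (nodeR G S)) := by
    intro G S
    constructor
    · rintro (v | c) (w | d) h
      · exact congrArg _ (nodeL_injective h)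
      · exact (nodeL_ne_nodeR _ _ h).elim
      · exact (nodeL_ne_nodeR _ _ h.symm).elim
      · exact congrArg _ (nodeR_injective h)
    · intro x
      rcases node_cases x with ⟨v, rfl⟩ | ⟨c, rfl⟩
      · exact ⟨.inl v, rfl⟩
      · exact ⟨.inr c, rfl⟩
  let N := Equiv.ofBijective _ (hbij S)
  let N' := Equiv.ofBijective _ (hbij S')
  refine ⟨⟨N.symm.trans ((Equiv.sumCongr ψ.toEquiv β).trans N'), ?_⟩⟩
  intro x y
  obtain ⟨x, rfl⟩ := N.surjective x
  obtain ⟨y, rfl⟩ := N.surjective y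
  simp only [Equiv.trans_apply, Equiv.symm_apply_apply]
  rcases x with v | c <;> rcases y with w | d
  · exact iff_of_false (not_adj_nodeL _ _) (not_adj_nodeL _ _)
  · exact (adj_nodeL_nodeR _ _).trans ((hadj v d).trans (adj_nodeL_nodeR _ _).symm)
  · exact (adj_nodeR_nodeL _ _).trans ((hadj w c).trans (adj_nodeR_nodeL _ _).symm)
  · exact iff_of_false (not_adj_nodeR _ _) (not_adj_nodeR _ _)

end Iso

/-! ### Tanner graphs with a prescribed normal graph -/

section Realization

variable {V : Type} [Finite V] (K : SimpleGraph V)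

/-- The Tanner graph with a check node for every edge of `K` and with pendant check nodes that
raise the degree of every variable node to five. -/
def tannerOf : TannerGraph where
  L := V
  R := K.edgeSet ⊕ (Σ v : V, Fin (5 - ndeg K v))
  finite_L := inferInstance
  finite_R := inferInstance
  Adj v c := Sum.elim (fun e => v ∈ e.1) (fun p => p.1 = v) c

variable {K}

lemma tannerOf_leftRegular (h : ∀ v, ndeg K v ≤ 5) : (tannerOf K).LeftRegular 5 := by
  intro (v : V)
  have e : {c | (tannerOf K).Adj v c} =
      ((Sum.inl '' {e : K.edgeSet | v ∈ e.1} ∪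
        Sum.inr '' (Set.range (fun i => ⟨v, i⟩)) : Set (K.edgeSet ⊕ Σ v, Fin (5 - ndeg K v)))) := by
    ext c
    constructor
    · intro hc
      rcases c with c | ⟨w, i⟩
      · exact .inl ⟨c, hc, rfl⟩
      · obtain rfl : w = v := hc
        exact .inr ⟨_, ⟨i, rfl⟩, rfl⟩
    · rintro (⟨c, hc, rfl⟩ | ⟨_, ⟨i, rfl⟩, rfl⟩)
      · exact hc
      · exact rfl
  have e1 : {e : K.edgeSet | v ∈ e.1}.ncard = ndeg K v := by
    symm
    refine Set.ncard_congr (fun w hw => ⟨s(v, w), hw⟩) ?_ ?_ ?_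
    · intro w hw
      exact Sym2.mem_mk_left v w
    · intro w x hw hx e
      exact Sym2.congr_right.1 (congrArg Subtype.val e)
    · rintro ⟨e, he⟩ hve
      obtain ⟨w, rfl⟩ := hve
      exact ⟨w, he, rfl⟩
  have e2 : (Set.range (fun i => (⟨v, i⟩ : Σ v, Fin (5 - ndeg K v)))).ncard =
      5 - ndeg K v := by
    rw [← Set.image_univ, Set.ncard_image_of_injective _ (fun i j h => by simpa using h),
      Set.ncard_univ, Nat.card_fin]
  refine (congrArg Set.ncard e).trans
    (?_ : Set.ncard (α := K.edgeSet ⊕ Σ v, Fin (5 - ndeg K v)) _ = 5)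
  rw [Set.ncard_union_eq, Set.ncard_image_of_injective _ Sum.inl_injective,
    Set.ncard_image_of_injective _ Sum.inr_injective, e1, e2]
  · have := h v
    omega
  · rw [Set.disjoint_left]
    rintro _ ⟨x, -, rfl⟩ ⟨y, -, hy⟩
    simp at hy

lemma tannerOf_eq {v w : V} (h : v ≠ w) {c : (tannerOf K).R} (hv : (tannerOf K).Adj v c)
    (hw : (tannerOf K).Adj w c) : ∃ h : s(v, w) ∈ K.edgeSet, c = Sum.inl ⟨_, h⟩ := by
  rcases c with ⟨e, he⟩ | p
  · obtain rfl : e = s(v, w) := (Sym2.mem_and_mem_iff h).1 ⟨hv, hw⟩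
    exact ⟨he, rfl⟩
  · exact (h (hv.symm.trans hw)).elim

lemma tannerOf_noFour : NoFour (tannerOf K) := by
  intro v w c d h h1 h2 h3 h4
  obtain ⟨_, rfl⟩ := tannerOf_eq h h1 h2
  obtain ⟨_, rfl⟩ := tannerOf_eq h h3 h4
  rfl

lemma normal_tannerOf : normal (tannerOf K) = K := by
  ext v w
  constructor
  · rintro ⟨h, c, h1, h2⟩
    exact (tannerOf_eq h h1 h2).1
  · intro h
    exact ⟨h.ne, Sum.inl ⟨s(v, w), h⟩, Sym2.mem_mk_left v w, Sym2.mem_mk_right v w⟩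

lemma tannerOf_elementary (S : Set V) : (tannerOf K).IsElementary S := by
  intro c hc
  have h1 := checkDegree_pos hc
  have h2 : (tannerOf K).checkDegree S c ≤ 2 := by
    rcases c with ⟨e, he⟩ | p
    · induction e using Sym2.ind with
      | _ x y =>
        refine le_trans (Set.ncard_le_ncard (t := ({x, y} : Set V)) ?_ (Set.toFinite _))
          ((Set.ncard_insert_le _ _).trans (by simp))
        rintro v ⟨-, hv⟩
        exact Sym2.mem_iff.1 hv
    · refine le_trans (Set.ncard_le_ncard (t := ({p.1} : Set V)) ?_ (Set.toFinite _)) (by simp)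
      rintro v ⟨-, hv⟩
      exact (show p.1 = v from hv).symm
  omega

/-- A triangle of `K` becomes a hexagon through its three edge check nodes. -/
lemma tannerOf_egirth {x y z : V} (hxy : K.Adj x y) (hyz : K.Adj y z) (hzx : K.Adj z x) :
    (tannerOf K).toSimpleGraph.egirth = 6 := by
  let f : ℕ → V := fun i => if i = 1 then y else if i = 2 then z else x
  let c : ℕ → K.edgeSet ⊕ (Σ v, Fin (5 - ndeg K v)) := fun i => if i = 0 then
    Sum.inl ⟨s(x, y), hxy⟩ else if i = 1 then Sum.inl ⟨s(y, z), hyz⟩ else Sum.inl ⟨s(z, x), hzx⟩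
  have a1 := hxy.ne
  have a2 := hyz.ne
  have a3 := hzx.ne
  have hf : Set.InjOn f (Set.Iio 3) := by
    intro i hi j hj e
    simp only [Set.mem_Iio] at hi hj
    interval_cases i <;> interval_cases j <;> simp_all [f]
  have hc : Set.InjOn c (Set.Iio 3) := by
    intro i hi j hj e
    simp only [Set.mem_Iio] at hi hj
    -- Check nodes are compared through the underlying unordered pairs; the value `s(x, x)` for
    -- pendant check nodes never occurs.
    have e' := congrArg (Sum.elim Subtype.val fun _ => s(x, x)) e
    clear e
    interval_cases i <;> interval_cases j <;> simp_all [c]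
  have ha : ∀ i < 3, (tannerOf K).Adj (f i) (c i) ∧ (tannerOf K).Adj (f (i + 1)) (c i) := by
    intro i hi
    interval_cases i
    · exact ⟨Sym2.mem_mk_left x y, Sym2.mem_mk_right x y⟩
    · exact ⟨Sym2.mem_mk_left y z, Sym2.mem_mk_right y z⟩
    · exact ⟨Sym2.mem_mk_left z x, Sym2.mem_mk_right z x⟩
  have : TCycle (tannerOf K) 3 f c := ⟨by norm_num, rfl, hf, hc, ha⟩
  exact egirth_eq_six tannerOf_noFour this

end Realization

/-! ### Structures correspond to isomorphism classes of normal graphs -/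

section Structures

/-- Two graphs on `Fin n` are equivalent if they are isomorphic. -/
instance graphSetoid (n : ℕ) : Setoid (SimpleGraph (Fin n)) where
  r H K := Nonempty (H ≃g K)
  iseqv :=
    { refl := fun _ => ⟨SimpleGraph.Iso.refl⟩
      symm := fun ⟨f⟩ => ⟨f.symm⟩
      trans := fun ⟨f⟩ ⟨h⟩ => ⟨f.trans h⟩ }

/-- The normal graphs of the elementary trapping sets. -/
def Normal (a b : ℕ) (H : SimpleGraph (Fin a)) : Prop :=
  H.Connected ∧ (∀ v, 2 ≤ ndeg H v ∧ ndeg H v ≤ 5) ∧ b + dsum H = 5 * a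

variable {a b : ℕ}

lemma noFour_ets (X : ETS 5 6 a b) : NoFour X.G := noFour_of_egirth (by simpa using X.girth_eq)

/-- Numbering the nodes of `S` transports the normal graph to `Fin a`, with all conditions restated
through degrees. -/
lemma exists_normal (X : ETS 5 6 a b) :
    ∃ H : SimpleGraph (Fin a), Normal a b H ∧ Nonempty (sgraph X.G X.S ≃g H) := by
  have hfin : Finite X.S := inferInstance
  have hcard : Nat.card X.S = a := by rw [Nat.card_coe_set_eq]; exact X.isTrappingSet.1
  let e : X.S ≃ Fin a := Finite.equivFinOfCardEq hcard
  let φ : (sgraph X.G X.S).comap e.symm ≃g sgraph X.G X.S := SimpleGraph.Iso.comap e.symm _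
  have hT := (memT_iff (noFour_ets X) X.isElementary).1 X.memT
  refine ⟨_, ⟨φ.connected_iff.2 hT.1, fun v => ?_, ?_⟩, ⟨φ.symm⟩⟩
  · rw [← ndeg_iso φ]
    exact ⟨hT.2 _, ndeg_le X.leftRegular (noFour_ets X) X.isElementary _⟩
  · have : Fintype X.S := Fintype.ofFinite _
    rw [← dsum_iso φ]
    have h := ncard_unsatisfied_add_dsum X.leftRegular (noFour_ets X) X.isElementary
    rw [X.isTrappingSet.1, X.isTrappingSet.2] at h
    exact h

lemma exists_ets {H : SimpleGraph (Fin a)} (hH : Normal a b H) :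
    ∃ X : ETS 5 6 a b, Nonempty (sgraph X.G X.S ≃g H) := by
  -- The additional disjoint triangle, outside `S`, makes the girth six even if `H` has no triangle.
  let K : SimpleGraph (Fin a ⊕ Fin 3) := H ⊕g ⊤
  let S : Set (Fin a ⊕ Fin 3) := Set.range Sum.inl
  have hdeg : ∀ v, ndeg K v ≤ 5 := by
    rintro (v | v)
    · have : ndeg K (Sum.inl v) = ndeg H v := by
        symm
        refine Set.ncard_congr (fun w _ => Sum.inl w) ?_ ?_ ?_
        · intro w hw
          exact hw
        · intro w x _ _ e
          exact Sum.inl_injective e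
        · rintro (w | w) hw
          · exact ⟨w, hw, rfl⟩
          · simp [K] at hw
      rw [this]
      exact (hH.2.1 v).2
    · refine le_trans (Set.ncard_le_ncard (t := Set.range Sum.inr) ?_ (Set.toFinite _)) ?_
      · rintro (w | w) hw
        · simp [K] at hw
        · exact ⟨w, rfl⟩
      · rw [← Set.image_univ, Set.ncard_image_of_injective _ Sum.inr_injective, Set.ncard_univ]
        simp
  let φ : K.induce S ≃g H := SimpleGraph.Iso.symm
    ⟨Equiv.ofInjective _ Sum.inl_injective, Iff.rfl⟩
  have hreg := tannerOf_leftRegular hdeg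
  let S' : Set (tannerOf K).L := S
  have hel : (tannerOf K).IsElementary S' := tannerOf_elementary (K := K) S
  have e : sgraph (tannerOf K) S' = K.induce S :=
    congrArg (SimpleGraph.induce S) normal_tannerOf
  have ψ : sgraph (tannerOf K) S' ≃g H := e ▸ φ
  have hScard : S'.ncard = a := by
    change (Set.range (Sum.inl : Fin a → Fin a ⊕ Fin 3)).ncard = a
    rw [← Set.image_univ, Set.ncard_image_of_injective _ Sum.inl_injective, Set.ncard_univ]
    simp
  have : Fintype S' := Fintype.ofFinite _
  have hb := ncard_unsatisfied_add_dsum (G := tannerOf K) hreg tannerOf_noFour hel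
  rw [← dsum_iso ψ] at hb
  refine ⟨⟨tannerOf K, hreg, ?_, S', ⟨hScard, ?_⟩, hel, ?_⟩, ⟨ψ⟩⟩
  · exact_mod_cast tannerOf_egirth (x := Sum.inr 0) (y := Sum.inr 1) (z := Sum.inr 2)
      (by simp [K]) (by simp [K]) (by simp [K])
  · have := hH.2.2
    rw [hScard] at hb
    omega
  · rw [memT_iff tannerOf_noFour hel]
    exact ⟨ψ.connected_iff.2 hH.1, fun v => by rw [← ndeg_iso ψ]; exact (hH.2.1 _).1⟩

lemma ets_equiv_iff (X Y : ETS 5 6 a b) :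
    X ≈ Y ↔ Nonempty (sgraph X.G X.S ≃g sgraph Y.G Y.S) :=
  ⟨fun ⟨φ⟩ => sgraph_iso_of_iso X.leftRegular X.isElementary Y.leftRegular Y.isElementary φ,
    fun ⟨ψ⟩ => iso_of_sgraph_iso X.leftRegular (noFour_ets X) X.isElementary Y.leftRegular (noFour_ets Y)
      Y.isElementary ψ⟩

/-- Counting structures of elementary trapping sets amounts to counting isomorphism classes of
normal graphs. -/
theorem numStructures_eq (P : ETS 5 6 a b → Prop) (Q : SimpleGraph (Fin a) → Prop)
    (hPQ : ∀ X H, Nonempty (sgraph X.G X.S ≃g H) → (P X ↔ Q H)) :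
    ETS.numStructures 5 6 a b P =
      ((fun H => Quotient.mk (graphSetoid a) H) '' {H | Normal a b H ∧ Q H}).encard := by
  choose N hN hiso using fun X : ETS 5 6 a b => exists_normal X
  have hNeq : ∀ X Y : ETS 5 6 a b, X ≈ Y ↔ N X ≈ N Y := by
    intro X Y
    rw [ets_equiv_iff]
    obtain ⟨f⟩ := hiso X
    obtain ⟨g⟩ := hiso Y
    exact ⟨fun ⟨φ⟩ => ⟨f.symm.trans (φ.trans g)⟩, fun ⟨φ⟩ => ⟨f.trans (φ.trans g.symm)⟩⟩
  -- Taking normal graphs is well defined and injective on classes; realisability makes the image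
  -- equal to the right-hand set.
  let Φ : Quotient (ETS.isoSetoid 5 6 a b) → Quotient (graphSetoid a) :=
    Quotient.map N fun X Y h => (hNeq X Y).1 h
  have hΦ : Function.Injective Φ := by
    intro x y
    induction x using Quotient.inductionOn
    induction y using Quotient.inductionOn
    intro h
    exact Quotient.sound ((hNeq _ _).2 (Quotient.exact h))
  unfold ETS.numStructures
  rw [← hΦ.encard_image]
  congr 1
  ext x
  constructor
  · rintro ⟨_, ⟨X, hX, rfl⟩, rfl⟩
    exact ⟨N X, ⟨hN X, (hPQ X _ (hiso X)).1 hX⟩, rfl⟩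
  · rintro ⟨H, ⟨hH, hQ⟩, rfl⟩
    obtain ⟨X, ⟨f⟩⟩ := exists_ets hH
    refine ⟨_, ⟨X, (hPQ X H ⟨f⟩).2 hQ, rfl⟩, ?_⟩
    obtain ⟨g⟩ := hiso X
    exact Quotient.sound ⟨g.symm.trans f⟩

end Structures

end TrappingSets

namespace TrappingSets

/-! ### Polynomials as nested coefficient lists -/

section Polynomials

/-- Polynomials in `k` variables, as nested lists of coefficients. -/
def DPoly : ℕ → Type
  | 0 => ℕ
  | k + 1 => List (DPoly k)

/-- Pointwise addition of lists of coefficients. -/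
noncomputable def zipL {α : Type} (f : α → α → α) (l : List α) : List α → List α :=
  List.rec (motive := fun _ => List α → List α) (fun l => l) (fun a as ih l' =>
    List.rec (motive := fun _ => List α) (a :: as) (fun b bs _ => f a b :: ih bs) l') l

/-- `List.map`, with fast kernel reduction. -/
noncomputable def mapL {α β : Type} (f : α → β) (l : List α) : List β :=
  List.rec (motive := fun _ => List β) [] (fun a _ ih => f a :: ih) l

/-- Prepend `d` copies of `z`. -/
noncomputable def repA {α : Type} (z : α) (d : ℕ) (l : List α) : List α :=
  Nat.rec (motive := fun _ => List α) l (fun _ ih => z :: ih) d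

/-- The entry with index `d`, or `z` if there is none. -/
noncomputable def nthP {α : Type} (z : α) (l : List α) : ℕ → α :=
  List.rec (motive := fun _ => ℕ → α) (fun _ => z) (fun a _ ih d =>
    Nat.rec (motive := fun _ => α) a (fun d _ => ih d) d) l

/-- The zero polynomial. -/
noncomputable def zeroP (k : ℕ) : DPoly k :=
  Nat.rec (motive := DPoly) Nat.zero (fun _ _ => []) k

/-- The constant polynomial one. -/
noncomputable def oneP (k : ℕ) : DPoly k :=
  Nat.rec (motive := DPoly) (1 : ℕ) (fun _ ih => [ih]) k

/-- Addition of polynomials. -/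
noncomputable def addP (k : ℕ) : DPoly k → DPoly k → DPoly k :=
  Nat.rec (motive := fun k => DPoly k → DPoly k → DPoly k) Nat.add (fun _ ih => zipL ih) k

/-- Multiplication by the monomial with the exponents `ds`. -/
noncomputable def shiftP (ds : List ℕ) : (k : ℕ) → DPoly k → DPoly k :=
  List.rec (motive := fun _ => (k : ℕ) → DPoly k → DPoly k) (fun _ P => P)
    (fun d _ ih k => Nat.rec (motive := fun k => DPoly k → DPoly k) (fun P => P)
      (fun k _ P => repA (zeroP k) d (mapL (ih k) P)) k) ds

/-- Multiplication by `2 ^ s`. -/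
noncomputable def scaleP (s k : ℕ) : DPoly k → DPoly k :=
  Nat.rec (motive := fun k => DPoly k → DPoly k) (fun P => Nat.shiftLeft P s)
    (fun _ ih => mapL ih) k

/-- The weight of a vertex of degree `d`. -/
def wt (d : ℕ) : ℕ := (5 - d) + bif Nat.beq d 2 then 40 else 0

/-- Sum over the admissible degrees of the first variable. -/
noncomputable def elimP (len k : ℕ) (P : DPoly (k + 1)) : DPoly k :=
  addP k (scaleP (56 * (len * wt 2)) k (nthP (zeroP k) P 2))
    (addP k (scaleP (56 * (len * wt 3)) k (nthP (zeroP k) P 3))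
      (addP k (scaleP (56 * (len * wt 4)) k (nthP (zeroP k) P 4))
        (scaleP (56 * (len * wt 5)) k (nthP (zeroP k) P 5))))

/-- Multiplication by the product of the `1 + X ^ ds`. -/
noncomputable def mulsP (k : ℕ) (l : List (ℕ × List ℕ)) : DPoly k → DPoly k :=
  List.rec (motive := fun _ => DPoly k → DPoly k) (fun P => P)
    (fun d _ ih P => ih (addP k P (shiftP d.2 k P))) l

/-- Multiply and eliminate all variables, one after the other. -/
noncomputable def runP (len : ℕ → ℕ) (orbs : ℕ → List (ℕ × List ℕ)) (k : ℕ) :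
    ℕ → DPoly k → ℕ :=
  Nat.rec (motive := fun k => ℕ → DPoly k → ℕ) (fun _ P => P)
    (fun k ih p P => ih (p + 1) (elimP (len p) k (mulsP (k + 1) (orbs p) P))) k

/-- A coefficient of a polynomial. -/
noncomputable def coefP (k : ℕ) : DPoly k → (ℕ → ℕ) → ℕ :=
  Nat.rec (motive := fun k => DPoly k → (ℕ → ℕ) → ℕ) (fun P _ => P)
    (fun k ih P v => ih (nthP (zeroP k) P (v 0)) fun i => v (i + 1)) k

lemma coefP_succ (k : ℕ) (P : DPoly (k + 1)) (v : ℕ → ℕ) :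
    coefP (k + 1) P v = coefP k (nthP (zeroP k) P (v 0)) fun i => v (i + 1) := rfl

lemma nthP_nil {α : Type} (z : α) (d : ℕ) : nthP z [] d = z := rfl
lemma nthP_zero {α : Type} (z a : α) (l : List α) : nthP z (a :: l) 0 = a := rfl
lemma nthP_succ {α : Type} (z a : α) (l : List α) (d : ℕ) :
    nthP z (a :: l) (d + 1) = nthP z l d := rfl

lemma coefP_zeroP (k : ℕ) (v : ℕ → ℕ) : coefP k (zeroP k) v = 0 := by
  induction k generalizing v with
  | zero => rfl
  | succ k ih => exact ih _

lemma coefP_oneP (k : ℕ) (v : ℕ → ℕ) :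
    coefP k (oneP k) v = if ∀ i < k, v i = 0 then 1 else 0 := by
  induction k generalizing v with
  | zero =>
    change (1 : ℕ) = _
    simp
  | succ k ih =>
    rw [coefP_succ]
    change coefP k (nthP (zeroP k) [oneP k] (v 0)) _ = _
    rcases h : v 0 with _ | d
    · rw [nthP_zero, ih]
      refine if_congr ⟨fun h' i hi => ?_, fun h' i hi => h' (i + 1) (by omega)⟩ rfl rfl
      rcases i with _ | i
      · exact h
      · exact h' i (by omega)
    · rw [nthP_succ, nthP_nil, coefP_zeroP, if_neg]
      intro h'
      have := h' 0 (by omega)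
      omega

lemma coefP_addP (k : ℕ) (P Q : DPoly k) (v : ℕ → ℕ) :
    coefP k (addP k P Q) v = coefP k P v + coefP k Q v := by
  induction k generalizing v with
  | zero => rfl
  | succ k ih =>
    have key : ∀ (P Q : List (DPoly k)) (d : ℕ) (v : ℕ → ℕ),
        coefP k (nthP (zeroP k) (zipL (addP k) P Q) d) v =
          coefP k (nthP (zeroP k) P d) v + coefP k (nthP (zeroP k) Q d) v := by
      intro P
      induction P with
      | nil =>
        intro Q d v
        rw [nthP_nil, coefP_zeroP, zero_add]
        rfl
      | cons a P ihP =>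
        intro Q d v
        rcases Q with _ | ⟨b, Q⟩
        · rw [nthP_nil, coefP_zeroP, add_zero]
          rfl
        · rcases d with _ | d
          · exact ih a b v
          · exact ihP Q d v
    exact key P Q (v 0) _

lemma coefP_scaleP (s k : ℕ) (P : DPoly k) (v : ℕ → ℕ) :
    coefP k (scaleP s k P) v = 2 ^ s * coefP k P v := by
  induction k generalizing v with
  | zero =>
    have h : ∀ N : ℕ, Nat.shiftLeft N s = 2 ^ s * N := fun N => by
      rw [mul_comm]
      exact Nat.shiftLeft_eq N s
    exact h P
  | succ k ih =>
    have key : ∀ (P : List (DPoly k)) (d : ℕ) (v : ℕ → ℕ),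
        coefP k (nthP (zeroP k) (mapL (scaleP s k) P) d) v =
          2 ^ s * coefP k (nthP (zeroP k) P d) v := by
      intro P
      induction P with
      | nil =>
        intro d v
        rw [nthP_nil, coefP_zeroP, mul_zero]
        exact coefP_zeroP k v
      | cons a P ihP =>
        intro d v
        rcases d with _ | d
        · exact ih a v
        · exact ihP d v
    exact key P (v 0) _

lemma coefP_shiftP (ds : List ℕ) (k : ℕ) (P : DPoly k) (v : ℕ → ℕ) :
    coefP k (shiftP ds k P) v =
      if ∀ i < k, ds.getD i 0 ≤ v i then coefP k P (fun i => v i - ds.getD i 0) else 0 := by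
  induction ds generalizing k v with
  | nil => simp [shiftP]
  | cons d ds ih =>
    rcases k with _ | k
    · rw [if_pos (by intro i hi; omega)]
      rfl
    · have key : ∀ (P : List (DPoly k)) (e : ℕ) (v : ℕ → ℕ),
          coefP k (nthP (zeroP k) (mapL (shiftP ds k) P) e) v =
            if ∀ i < k, ds.getD i 0 ≤ v i then
              coefP k (nthP (zeroP k) P e) (fun i => v i - ds.getD i 0) else 0 := by
        intro P
        induction P with
        | nil =>
          intro e v
          rw [nthP_nil, coefP_zeroP, ite_self]
          exact coefP_zeroP k v
        | cons a P ihP =>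
          intro e v
          rcases e with _ | e
          · exact ih k a v
          · exact ihP e v
      have key2 : ∀ (d : ℕ) (Q : List (DPoly k)) (e : ℕ),
          nthP (zeroP k) (repA (zeroP k) d Q) e =
            if d ≤ e then nthP (zeroP k) Q (e - d) else zeroP k := by
        intro d
        induction d with
        | zero => intro Q e; simp [repA]
        | succ d ihd =>
          intro Q e
          rcases e with _ | e
          · simp [repA, nthP]
          · have := ihd Q e
            simp only [Nat.add_le_add_iff_right, Nat.add_sub_add_right]
            exact this
      change coefP k (nthP (zeroP k) (repA (zeroP k) d (mapL (shiftP ds k) P)) (v 0)) _ = _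
      rw [key2]
      by_cases h : d ≤ v 0
      · rw [if_pos h, coefP_succ]
        refine (key P (v 0 - d) fun i => v (i + 1)).trans ?_
        refine if_congr ⟨fun h' i hi => ?_, fun h' i hi => ?_⟩ rfl rfl
        · rcases i with _ | i
          · simpa using h
          · simpa using h' i (by omega)
        · simpa using h' (i + 1) (by omega)
      · rw [if_neg h, coefP_zeroP, if_neg]
        intro h'
        exact h (by simpa using h' 0 (by omega))

/-- Only degrees from 2 to 5 survive the elimination; the power of two records the weight of a cycle
of `len` vertices of that degree. -/
lemma coefP_elimP (len k : ℕ) (P : DPoly (k + 1)) (v : ℕ → ℕ) :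
    coefP k (elimP len k P) v = ∑ d ∈ Finset.Icc 2 5, 2 ^ (56 * (len * wt d)) *
      coefP (k + 1) P (fun i => Nat.casesOn i d v) := by
  have h : Finset.Icc 2 5 = {2, 3, 4, 5} := rfl
  rw [h, elimP]
  simp only [coefP_addP, coefP_scaleP]
  rw [Finset.sum_insert (by decide), Finset.sum_insert (by decide), Finset.sum_insert (by decide),
    Finset.sum_singleton]
  rfl

end Polynomials

/-! ### Degree enumeration of unions of orbits -/

section Configurations

variable (c : ℕ → ℕ → ℕ) (len : ℕ → ℕ)

/-- The degree of the cycle `q`, if the orbits in `χ` are selected. -/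
def cdeg (χ : Finset ℕ) (q : ℕ) : ℕ := ∑ r ∈ χ, c r q

/-- The selection `χ` has admissible degrees at the first `p` cycles. -/
def COk (p : ℕ) (χ : Finset ℕ) : Prop := ∀ q < p, 2 ≤ cdeg c χ q ∧ cdeg c χ q ≤ 5

/-- The total weight of the first `p` cycles. -/
def cwt (p : ℕ) (χ : Finset ℕ) : ℕ := ∑ q ∈ Finset.range p, len q * wt (cdeg c χ q)

open Classical in
/-- The polynomial `P` in `k` variables represents the selections within `T`, after the elimination
of the first `p` variables. -/
def Represents (p k : ℕ) (T : Finset ℕ) (P : DPoly k) : Prop :=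
  ∀ v : ℕ → ℕ, coefP k P v = ∑ χ ∈ T.powerset,
    if COk c p χ ∧ ∀ i < k, cdeg c χ (p + i) = v i then 2 ^ (56 * cwt c len p χ) else 0

variable {c len}

lemma represents_oneP (k : ℕ) : Represents c len 0 k ∅ (oneP k) := by
  classical
  intro v
  simp only [Finset.powerset_empty, Finset.sum_singleton, coefP_oneP, cwt, Finset.range_zero,
    Finset.sum_empty, mul_zero, pow_zero]
  refine if_congr ⟨fun h => ⟨fun q hq => by omega, fun i hi => ?_⟩, fun h i hi => ?_⟩ rfl rfl
  · rw [h i hi]; simp [cdeg]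
  · rw [← h.2 i hi]; simp [cdeg]

lemma cdeg_insert {r : ℕ} {χ : Finset ℕ} (hr : r ∉ χ) (q : ℕ) :
    cdeg c (insert r χ) q = c r q + cdeg c χ q := Finset.sum_insert hr

/-- A selection within `insert r T` either omits `r` or adds it to a selection within `T`, which
shifts the degree vector by `ds`. Weights are unaffected because `r` misses the cycles already
eliminated. -/
lemma Represents.mul {p k : ℕ} {T : Finset ℕ} {P : DPoly k} (h : Represents c len p k T P)
    {r : ℕ} {ds : List ℕ} (hr : r ∉ T) (h0 : ∀ q < p, c r q = 0)
    (hds : ∀ i < k, c r (p + i) = ds.getD i 0) :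
    Represents c len p k (insert r T) (addP k P (shiftP ds k P)) := by
  classical
  intro v
  rw [Finset.sum_powerset_insert hr, coefP_addP, h v, coefP_shiftP]
  congr 1
  have hdeg : ∀ χ ∈ T.powerset, ∀ q < p, cdeg c (insert r χ) q = cdeg c χ q := by
    intro χ hχ q hq
    rw [cdeg_insert (fun h' => hr (Finset.mem_powerset.1 hχ h')), h0 q hq, zero_add]
  have hdeg' : ∀ χ ∈ T.powerset, ∀ i < k,
      cdeg c (insert r χ) (p + i) = ds.getD i 0 + cdeg c χ (p + i) := by
    intro χ hχ i hi
    rw [cdeg_insert (fun h' => hr (Finset.mem_powerset.1 hχ h')), hds i hi]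
  have hok : ∀ χ ∈ T.powerset, (COk c p (insert r χ) ↔ COk c p χ) := by
    intro χ hχ
    refine forall₂_congr fun q hq => ?_
    rw [hdeg χ hχ q hq]
  have hwt : ∀ χ ∈ T.powerset, cwt c len p (insert r χ) = cwt c len p χ := by
    intro χ hχ
    refine Finset.sum_congr rfl fun q hq => ?_
    rw [hdeg χ hχ q (Finset.mem_range.1 hq)]
  split_ifs with hle
  · rw [h]
    refine Finset.sum_congr rfl fun χ hχ => ?_
    rw [hwt χ hχ]
    refine if_congr (and_congr (hok χ hχ).symm (forall₂_congr fun i hi => ?_)) rfl rfl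
    rw [hdeg' χ hχ i hi]
    have := hle i hi
    omega
  · symm
    refine Finset.sum_eq_zero fun χ hχ => if_neg ?_
    rintro ⟨-, h'⟩
    refine hle fun i hi => ?_
    rw [← h' i hi, hdeg' χ hχ i hi]
    omega

/-- Each selection contributes to exactly one exponent of the eliminated variable, namely its degree
at `p`, and is dropped if that degree is inadmissible. -/
lemma Represents.elim {p k : ℕ} {T : Finset ℕ} {P : DPoly (k + 1)}
    (h : Represents c len p (k + 1) T P) : Represents c len (p + 1) k T (elimP (len p) k P) := by
  classical
  intro v
  rw [coefP_elimP]
  simp only [h _, Finset.mul_sum]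
  rw [Finset.sum_comm]
  refine Finset.sum_congr rfl fun χ _ => ?_
  have hcond : ∀ d, (∀ i < k + 1, cdeg c χ (p + i) = (Nat.casesOn i d v : ℕ)) ↔
      cdeg c χ p = d ∧ ∀ i < k, cdeg c χ (p + 1 + i) = v i := by
    intro d
    constructor
    · intro h'
      refine ⟨h' 0 (by omega), fun i hi => ?_⟩
      have := h' (i + 1) (by omega)
      rwa [show p + (i + 1) = p + 1 + i by ring] at this
    · rintro ⟨h1, h2⟩ i hi
      rcases i with _ | i
      · exact h1
      · have := h2 i (by omega)
        rwa [show p + 1 + i = p + (i + 1) by ring] at this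
  simp only [hcond]
  have hok : COk c (p + 1) χ ↔ COk c p χ ∧ cdeg c χ p ∈ Finset.Icc 2 5 := by
    simp only [COk, Finset.mem_Icc]
    constructor
    · intro h'
      exact ⟨fun q hq => h' q (by omega), h' p (by omega)⟩
    · rintro ⟨h1, h2⟩ q hq
      rcases Nat.lt_succ_iff_lt_or_eq.1 hq with h' | rfl
      · exact h1 q h'
      · exact h2
  have hw : cwt c len (p + 1) χ = cwt c len p χ + len p * wt (cdeg c χ p) := by
    rw [cwt, Finset.sum_range_succ]; rfl
  by_cases hm : cdeg c χ p ∈ Finset.Icc 2 5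
  -- For a fixed selection only the term at its own degree is nonzero.
  · rw [Finset.sum_eq_single (cdeg c χ p) ?_ (fun h' => (h' hm).elim)]
    swap
    · intro d _ hd
      have : ¬ (COk c p χ ∧ cdeg c χ p = d ∧ ∀ i < k, cdeg c χ (p + 1 + i) = v i) :=
        fun h' => hd h'.2.1.symm
      rw [if_neg this, mul_zero]
    by_cases h1 : COk c p χ ∧ ∀ i < k, cdeg c χ (p + 1 + i) = v i
    · rw [if_pos ⟨h1.1, rfl, h1.2⟩, if_pos ⟨hok.2 ⟨h1.1, hm⟩, h1.2⟩, hw, ← pow_add]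
      ring
    · rw [if_neg (fun h' => h1 ⟨h'.1, h'.2.2⟩), if_neg (fun h' => h1 ⟨(hok.1 h'.1).1, h'.2⟩),
        mul_zero]
  · rw [if_neg (fun h' => hm (hok.1 h'.1).2)]
    refine Finset.sum_eq_zero fun d hd => ?_
    have : ¬ (COk c p χ ∧ cdeg c χ p = d ∧ ∀ i < k, cdeg c χ (p + 1 + i) = v i) :=
      fun h' => hm (h'.2.1 ▸ hd)
    rw [if_neg this, mul_zero]

lemma Represents.muls {p k : ℕ} {T : Finset ℕ} {P : DPoly k} (h : Represents c len p k T P)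
    (l : List (ℕ × List ℕ)) (hnd : (l.map Prod.fst).Nodup) (hT : ∀ x ∈ l, x.1 ∉ T)
    (h0 : ∀ x ∈ l, ∀ q < p, c x.1 q = 0) (hds : ∀ x ∈ l, ∀ i < k, c x.1 (p + i) = x.2.getD i 0) :
    Represents c len p k (T ∪ (l.map Prod.fst).toFinset) (mulsP k l P) := by
  induction l generalizing T P with
  | nil => simpa [mulsP] using h
  | cons x l ih =>
    rw [List.map_cons, List.nodup_cons] at hnd
    have h1 := h.mul (hT x (by simp)) (h0 x (by simp)) (hds x (by simp))
    have h2 := ih h1 hnd.2 (fun y hy hmem => ?_) (fun y hy => h0 y (by simp [hy]))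
      (fun y hy => hds y (by simp [hy]))
    · have e : T ∪ ((x :: l).map Prod.fst).toFinset =
          insert x.1 T ∪ (l.map Prod.fst).toFinset := by
        ext a; simp only [List.map_cons, List.toFinset_cons, Finset.mem_union,
          Finset.mem_insert]; tauto
      rw [e]
      exact h2
    · rcases Finset.mem_insert.1 hmem with e | e
      · exact hnd.1 (e ▸ List.mem_map_of_mem hy)
      · exact hT y (by simp [hy]) e

lemma runP_succ (orbs : ℕ → List (ℕ × List ℕ)) (k p : ℕ) (P : DPoly (k + 1)) :
    runP len orbs (k + 1) p P = runP len orbs k (p + 1)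
      (elimP (len p) k (mulsP (k + 1) (orbs p) P)) := rfl

open Classical in
-- By `h0` the orbits listed at `q` do not meet earlier cycles, so the degree at `p` is final once
-- the orbits listed at `p` have been multiplied in, and its variable can go. This keeps the
-- polynomials small.
lemma Represents.run {p k : ℕ} {T : Finset ℕ} {P : DPoly k} (h : Represents c len p k T P)
    (orbs : ℕ → List (ℕ × List ℕ))
    (hnd : ((List.range' p k).flatMap fun q => (orbs q).map Prod.fst).Nodup)
    (hT : ∀ q, p ≤ q → q < p + k → ∀ x ∈ orbs q, x.1 ∉ T)
    (h0 : ∀ q, p ≤ q → q < p + k → ∀ x ∈ orbs q, ∀ q' < q, c x.1 q' = 0)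
    (hds : ∀ q, p ≤ q → q < p + k → ∀ x ∈ orbs q, ∀ i < p + k - q,
      c x.1 (q + i) = x.2.getD i 0) :
    runP len orbs k p P = ∑ χ ∈ (T ∪ ((List.range' p k).flatMap fun q =>
      (orbs q).map Prod.fst).toFinset).powerset,
      if COk c (p + k) χ then 2 ^ (56 * cwt c len (p + k) χ) else 0 := by
  induction k generalizing p T with
  | zero =>
    have := h fun _ => 0
    simp only [Nat.not_lt_zero, false_implies, implies_true, and_true] at this
    refine Eq.trans this ?_
    simp
  | succ k ih =>
    rw [List.range'_succ, List.flatMap_cons, List.nodup_append] at hnd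
    obtain ⟨hn1, hn2, hn3⟩ := hnd
    have h1 := (h.muls (orbs p) hn1 (hT p le_rfl (by omega)) (h0 p le_rfl (by omega))
      (fun x hx i hi => hds p le_rfl (by omega) x hx i (by omega))).elim
    rw [runP_succ, ih h1 hn2 ?_ (fun q hq hq' => h0 q (by omega) (by omega))
      (fun q hq hq' x hx i hi => hds q (by omega) (by omega) x hx i (by omega))]
    · have e : p + 1 + k = p + (k + 1) := by ring
      rw [List.range'_succ, List.flatMap_cons, List.toFinset_append, ← Finset.union_assoc, e]
    · intro q hq hq' x hx hmem
      rcases Finset.mem_union.1 hmem with hmem | hmem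
      · exact hT q (by omega) (by omega) x hx hmem
      · rw [List.mem_toFinset] at hmem
        refine hn3 x.1 hmem x.1 (List.mem_flatMap.2 ⟨q, ?_, List.mem_map_of_mem hx⟩) rfl
        rw [List.mem_range'_1]
        omega

end Configurations

/-! ### Reading coefficients as digits in base 2^56 -/

section Extraction

/-- The coefficient of `(2 ^ 56) ^ e`. -/
def coefN (N e : ℕ) : ℕ := Nat.shiftRight N (56 * e) % 2 ^ 56

/-- The sum of all coefficients is below the base, so no carries occur and each digit is one
coefficient. -/
lemma coefN_sum {ι : Type*} (I : Finset ι) (a w : ι → ℕ) (h : ∑ i ∈ I, a i < 2 ^ 56) (e : ℕ) :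
    coefN (∑ i ∈ I, a i * 2 ^ (56 * w i)) e = ∑ i ∈ I with w i = e, a i := by
  have hsplit : ∑ i ∈ I, a i * 2 ^ (56 * w i) =
      (∑ i ∈ I with w i < e, a i * 2 ^ (56 * w i)) + 2 ^ (56 * e) *
        ((∑ i ∈ I with w i = e, a i) + 2 ^ 56 *
          ∑ i ∈ I with e < w i, a i * 2 ^ (56 * (w i - e - 1))) := by
    simp only [Finset.sum_filter, Finset.mul_sum, mul_add]
    rw [← Finset.sum_add_distrib, ← Finset.sum_add_distrib]
    refine Finset.sum_congr rfl fun i _ => ?_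
    rcases lt_trichotomy (w i) e with h | h | h
    · simp [h, h.ne, h.le.not_gt]
    · subst h; simp [mul_comm]
    · have e1 : 56 * w i = 56 * e + 56 + 56 * (w i - e - 1) := by omega
      simp only [h.le.not_gt, h.ne', h, if_true, if_false, mul_zero, zero_add]
      rw [e1, pow_add, pow_add]
      ring
  -- The lower digits together stay below the place value of digit `e`.
  have hlow : ∑ i ∈ I with w i < e, a i * 2 ^ (56 * w i) < 2 ^ (56 * e) := by
    rcases Nat.eq_zero_or_pos e with rfl | he
    · simp
    · calc ∑ i ∈ I with w i < e, a i * 2 ^ (56 * w i)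
          ≤ ∑ i ∈ I with w i < e, a i * 2 ^ (56 * (e - 1)) := by
            refine Finset.sum_le_sum fun i hi => Nat.mul_le_mul_left _ ?_
            have := (Finset.mem_filter.1 hi).2
            exact Nat.pow_le_pow_right (by norm_num) (by omega)
        _ ≤ (∑ i ∈ I, a i) * 2 ^ (56 * (e - 1)) := by
            rw [← Finset.sum_mul]
            exact Nat.mul_le_mul_right _ (Finset.sum_le_sum_of_subset (Finset.filter_subset _ _))
        _ < 2 ^ 56 * 2 ^ (56 * (e - 1)) := Nat.mul_lt_mul_of_pos_right h (by positivity)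
        _ = 2 ^ (56 * e) := by rw [← pow_add]; congr 1; omega
  have hmid : ∑ i ∈ I with w i = e, a i < 2 ^ 56 :=
    lt_of_le_of_lt (Finset.sum_le_sum_of_subset (Finset.filter_subset _ _)) h
  rw [coefN, show ∀ x y, Nat.shiftRight x y = x >>> y from fun _ _ => rfl,
    Nat.shiftRight_eq_div_pow, hsplit, Nat.add_mul_div_left _ _ (by positivity),
    Nat.div_eq_of_lt hlow, zero_add, Nat.add_mul_mod_self_left, Nat.mod_eq_of_lt hmid]

end Extraction

end TrappingSets

namespace TrappingSets

/-! ### Burnside's lemma for graphs and summation by cycle type -/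

section Burnside

open Equiv

/-- `σ` is an automorphism of `H`. -/
def Fixes {n : ℕ} (σ : Perm (Fin n)) (H : SimpleGraph (Fin n)) : Prop :=
  ∀ i j, H.Adj (σ i) (σ j) ↔ H.Adj i j

/-- The number of isomorphism classes of the graphs on `n` vertices with the property `P`. -/
noncomputable def numClasses {n : ℕ} (P : SimpleGraph (Fin n) → Prop) : ℕ :=
  ((fun H => Quotient.mk (graphSetoid n) H) '' {H | P H}).ncard

/-- The property `P` is invariant under isomorphisms. -/
def IsoInvariant {n : ℕ} (P : SimpleGraph (Fin n) → Prop) : Prop :=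
  ∀ H K, Nonempty (H ≃g K) → (P H ↔ P K)

lemma map_symm_adj {n : ℕ} (σ : Perm (Fin n)) (H : SimpleGraph (Fin n)) (i j : Fin n) :
    (H.map σ.toEmbedding).Adj (σ i) (σ j) ↔ H.Adj i j := by
  exact SimpleGraph.map_adj_apply (f := σ.toEmbedding)

lemma fixes_iff {n : ℕ} (σ : Perm (Fin n)) (H : SimpleGraph (Fin n)) :
    H.map σ.toEmbedding = H ↔ Fixes σ H := by
  constructor
  · intro h i j
    rw [← map_symm_adj σ H i j, h]
  · intro h
    ext i j
    obtain ⟨i, rfl⟩ := σ.surjective i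
    obtain ⟨j, rfl⟩ := σ.surjective j
    rw [map_symm_adj, h]

lemma map_iso_of_equiv {n : ℕ} {H K : SimpleGraph (Fin n)} (φ : H ≃g K) :
    H.map φ.toEquiv.toEmbedding = K := by
  ext i j
  obtain ⟨i, rfl⟩ := φ.toEquiv.surjective i
  obtain ⟨j, rfl⟩ := φ.toEquiv.surjective j
  rw [map_symm_adj]
  exact φ.map_adj_iff.symm

/-- The action of the permutations on the graphs with an invariant property. -/
@[reducible] def graphAction {n : ℕ} {P : SimpleGraph (Fin n) → Prop} (hP : IsoInvariant P) :
    MulAction (Perm (Fin n)) {H // P H} where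
  smul σ H := ⟨H.1.map σ.toEmbedding, (hP _ _ ⟨SimpleGraph.Iso.map σ H.1⟩).1 H.2⟩
  one_smul H := Subtype.ext ((fixes_iff 1 H.1).2 fun _ _ => Iff.rfl)
  mul_smul σ τ H := Subtype.ext (by
    change H.1.map (σ * τ).toEmbedding = (H.1.map τ.toEmbedding).map σ.toEmbedding
    rw [SimpleGraph.map_map]
    rfl)

/-- Burnside's lemma for graphs. -/
lemma numClasses_mul_factorial {n : ℕ} {P : SimpleGraph (Fin n) → Prop} (hP : IsoInvariant P) :
    numClasses P * n.factorial = ∑ σ : Perm (Fin n), {H | P H ∧ Fixes σ H}.ncard := by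
  classical
  let _ := graphAction hP
  have hb := MulAction.sum_card_fixedBy_eq_card_orbits_mul_card_group (Perm (Fin n)) {H // P H}
  rw [Fintype.card_perm, Fintype.card_fin] at hb
  -- Two graphs lie in one orbit of the relabelling action exactly if they are isomorphic.
  have h1 : numClasses P =
      Fintype.card (Quotient (MulAction.orbitRel (Perm (Fin n)) {H // P H})) := by
    rw [← Nat.card_eq_fintype_card, ← Set.ncard_univ, numClasses]
    symm
    refine Set.ncard_congr (fun q _ => Quotient.map' (s₂ := graphSetoid n) Subtype.val
      (fun H K h => ?_) q) ?_ ?_ ?_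
    · obtain ⟨σ, rfl⟩ := h
      exact ⟨(SimpleGraph.Iso.map σ K.1).symm⟩
    · intro q _
      induction q using Quotient.inductionOn with
      | _ H => exact ⟨H.1, H.2, rfl⟩
    · intro q r _ _ h
      induction q using Quotient.inductionOn with
      | _ H =>
      induction r using Quotient.inductionOn with
      | _ K =>
      obtain ⟨φ⟩ : Nonempty (H.1 ≃g K.1) := Quotient.exact h
      refine Quotient.sound ⟨φ.symm.toEquiv, Subtype.ext ?_⟩
      exact map_iso_of_equiv φ.symm
    · rintro _ ⟨H, hH, rfl⟩
      exact ⟨Quotient.mk _ ⟨H, hH⟩, trivial, rfl⟩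
  rw [h1, ← hb]
  refine Finset.sum_congr rfl fun σ _ => ?_
  rw [← Nat.card_eq_fintype_card, ← Nat.card_coe_set_eq]
  refine Nat.card_congr ?_
  refine ⟨fun H => ⟨H.1.1, H.1.2, (fixes_iff σ _).1 (congrArg Subtype.val H.2)⟩,
    fun H => ⟨⟨H.1, H.2.1⟩, Subtype.ext ((fixes_iff σ _).2 H.2.2)⟩, fun _ => rfl, fun _ => rfl⟩

/-- Relabelling by the conjugating permutation injects the graphs fixed by one permutation into
those fixed by the other, and the inverse gives the opposite inequality. -/
lemma ncard_fixed_congr {n : ℕ} {P : SimpleGraph (Fin n) → Prop} (hP : IsoInvariant P)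
    {σ τ : Perm (Fin n)} (h : σ.cycleType = τ.cycleType) :
    {H | P H ∧ Fixes σ H}.ncard = {H | P H ∧ Fixes τ H}.ncard := by
  obtain ⟨π, rfl⟩ := isConj_iff.1 (Perm.isConj_iff_cycleType_eq.2 h)
  have key : ∀ (π σ : Perm (Fin n)) (H : SimpleGraph (Fin n)), P H ∧ Fixes σ H →
      P (H.map π.toEmbedding) ∧ Fixes (π * σ * π⁻¹) (H.map π.toEmbedding) := by
    intro π σ H hH
    refine ⟨(hP _ _ ⟨SimpleGraph.Iso.map π H⟩).1 hH.1, fun i j => ?_⟩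
    obtain ⟨i, rfl⟩ := π.surjective i
    obtain ⟨j, rfl⟩ := π.surjective j
    have hinv : ∀ x, π⁻¹ (π x) = x := π.symm_apply_apply
    simp only [Perm.mul_apply, hinv]
    rw [map_symm_adj, map_symm_adj]
    exact hH.2 i j
  have hle : ∀ π σ : Perm (Fin n), {H | P H ∧ Fixes σ H}.ncard ≤
      {H | P H ∧ Fixes (π * σ * π⁻¹) H}.ncard := fun π σ =>
    Set.ncard_le_ncard_of_injOn (fun H => H.map π.toEmbedding) (fun H hH => key π σ H hH)
      (SimpleGraph.map_injective _).injOn (Set.toFinite _)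
  refine le_antisymm (hle π σ) ?_
  have := hle π⁻¹ (π * σ * π⁻¹)
  simpa [mul_assoc] using this

/-- Summation over permutations by cycle type. -/
lemma sum_perm_eq {n : ℕ} {ι : Type*} (I : Finset ι) (ρ : ι → Perm (Fin n)) (cls : ι → ℕ)
    (hinj : Set.InjOn (fun s => (ρ s).cycleType) I)
    (hcls : ∀ s ∈ I, (Finset.univ.filter fun g : Perm (Fin n) =>
      g.cycleType = (ρ s).cycleType).card = cls s)
    (htot : ∑ s ∈ I, cls s = n.factorial) (f : Perm (Fin n) → ℕ)
    (hf : ∀ σ τ : Perm (Fin n), σ.cycleType = τ.cycleType → f σ = f τ) :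
    ∑ σ, f σ = ∑ s ∈ I, cls s * f (ρ s) := by
  classical
  have hdisj : (I : Set ι).PairwiseDisjoint fun s => Finset.univ.filter
      fun g : Perm (Fin n) => g.cycleType = (ρ s).cycleType := by
    intro s hs t ht hst
    refine Finset.disjoint_left.2 fun g h1 h2 => hst (hinj hs ht ?_)
    exact (Finset.mem_filter.1 h1).2.symm.trans (Finset.mem_filter.1 h2).2
  -- The listed conjugacy classes are disjoint and their sizes add up to n!, so no cycle type is
  -- missing; partitions of n need not be enumerated in the proof.
  have huniv : I.biUnion (fun s => Finset.univ.filter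
      fun g : Perm (Fin n) => g.cycleType = (ρ s).cycleType) = Finset.univ := by
    rw [← Finset.card_eq_iff_eq_univ, Finset.card_biUnion hdisj, Finset.sum_congr rfl hcls, htot,
      Fintype.card_perm, Fintype.card_fin]
  rw [← huniv, Finset.sum_biUnion hdisj]
  refine Finset.sum_congr rfl fun s hs => ?_
  rw [← hcls s hs, ← smul_eq_mul, ← Finset.sum_const]
  exact Finset.sum_congr rfl fun g hg => hf _ _ (Finset.mem_filter.1 hg).2

lemma cycleType_prod_formPerm {α : Type*} [Fintype α] [DecidableEq α] (bs : List (List α))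
    (h2 : ∀ l ∈ bs, 2 ≤ l.length) (hnd : bs.flatten.Nodup) :
    ((bs.map List.formPerm).prod).cycleType = (bs.map List.length : List ℕ) := by
  rw [List.nodup_flatten] at hnd
  rw [Perm.cycleType_eq (bs.map List.formPerm) rfl, List.map_map]
  · congr 1
    refine List.map_congr_left fun l hl => ?_
    have hl2 := h2 l hl
    simp only [Function.comp_apply]
    rw [List.support_formPerm_of_nodup l (hnd.1 l hl) (by rintro x rfl; simp at hl2),
      List.toFinset_card_of_nodup (hnd.1 l hl)]
  · intro σ hσ
    obtain ⟨l, hl, rfl⟩ := List.mem_map.1 hσ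
    exact List.isCycle_formPerm (hnd.1 l hl) (h2 l hl)
  · rw [List.pairwise_map]
    refine List.Pairwise.imp_of_mem ?_ hnd.2
    intro l l' hl hl' hd
    exact (List.formPerm_disjoint_iff (hnd.1 l hl) (hnd.1 l' hl') (h2 l hl) (h2 l' hl')).2 hd

end Burnside

end TrappingSets

namespace TrappingSets

open Equiv

/-! ### Graphs fixed by a permutation as sets of orbit labels -/

section Fixed

variable {n : ℕ} (lab : Fin n → Fin n → ℕ)

/-- The graph whose edges are the pairs with a label in `χ`. -/
def labGraph (hsymm : ∀ i j, lab i j = lab j i) (χ : Finset ℕ) : SimpleGraph (Fin n) where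
  Adj i j := i ≠ j ∧ lab i j ∈ χ
  symm := ⟨fun i j h => ⟨h.1.symm, hsymm i j ▸ h.2⟩⟩
  loopless := ⟨fun _ h => h.1 rfl⟩

variable {lab}

/-- Labels name the orbits of `σ` on pairs. A graph fixed by `σ` contains an orbit entirely or not
at all, so it is determined by an arbitrary set of labels. -/
lemma ncard_fixed_eq {σ : Perm (Fin n)} {R : Finset ℕ} (hsymm : ∀ i j, lab i j = lab j i)
    (hinv : ∀ i j, lab (σ i) (σ j) = lab i j)
    (horb : ∀ i j i' j', lab i j = lab i' j' → ∀ H, Fixes σ H → (H.Adj i j → H.Adj i' j'))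
    (hR : ∀ i j, i ≠ j → lab i j ∈ R) (hR' : ∀ r ∈ R, ∃ i j, i ≠ j ∧ lab i j = r)
    (P : SimpleGraph (Fin n) → Prop) [DecidablePred fun χ => P (labGraph lab hsymm χ)] :
    {H | P H ∧ Fixes σ H}.ncard = (R.powerset.filter fun χ => P (labGraph lab hsymm χ)).card := by
  classical
  rw [← Set.ncard_coe_finset]
  symm
  refine Set.ncard_congr (fun χ _ => labGraph lab hsymm χ) ?_ ?_ ?_
  · intro χ hχ
    refine ⟨(Finset.mem_filter.1 hχ).2, fun i j => ?_⟩
    simp [labGraph, hinv]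
  · have key : ∀ χ ψ : Finset ℕ, χ ∈ R.powerset →
        labGraph lab hsymm χ = labGraph lab hsymm ψ → χ ⊆ ψ := by
      intro χ ψ hχ h r hr
      obtain ⟨i, j, hij, rfl⟩ := hR' r (Finset.mem_powerset.1 hχ hr)
      have : (labGraph lab hsymm χ).Adj i j := ⟨hij, hr⟩
      rw [h] at this
      exact this.2
    intro χ ψ hχ hψ h
    exact (key χ ψ (Finset.mem_filter.1 hχ).1 h).antisymm
      (key ψ χ (Finset.mem_filter.1 hψ).1 h.symm)
  · rintro H ⟨hP, hH⟩
    have e : labGraph lab hsymm (R.filter fun r => ∃ i j, H.Adj i j ∧ lab i j = r) = H := by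
      ext i j
      constructor
      · rintro ⟨hij, h⟩
        obtain ⟨-, i', j', h1, h2⟩ := Finset.mem_filter.1 h
        exact horb i' j' i j h2 H hH h1
      · intro h
        exact ⟨h.ne, Finset.mem_filter.2 ⟨hR i j h.ne, i, j, h, rfl⟩⟩
    exact ⟨_, Finset.mem_coe.2 (Finset.mem_filter.2 ⟨Finset.mem_powerset.2 (Finset.filter_subset _ _),
      by rwa [e]⟩), e⟩

lemma ndeg_labGraph (hsymm : ∀ i j, lab i j = lab j i) (χ : Finset ℕ) (v : Fin n) :
    ndeg (labGraph lab hsymm χ) v =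
      ∑ r ∈ χ, (Finset.univ.filter fun j => v ≠ j ∧ lab v j = r).card := by
  classical
  rw [← Finset.card_biUnion]
  · rw [ndeg, ← Set.ncard_coe_finset]
    congr 1
    ext j
    simp only [SimpleGraph.mem_neighborSet, labGraph, Finset.coe_biUnion, Set.mem_iUnion,
      Finset.coe_filter, Set.mem_ofPred_eq, Finset.mem_univ, true_and, Finset.mem_coe]
    constructor
    · rintro ⟨h1, h2⟩
      exact ⟨_, h2, h1, rfl⟩
    · rintro ⟨r, hr, h1, rfl⟩
      exact ⟨h1, hr⟩
  · intro r _ r' _ hne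
    refine Finset.disjoint_left.2 fun j h1 h2 => hne ?_
    exact (Finset.mem_filter.1 h1).2.2.symm.trans (Finset.mem_filter.1 h2).2.2

/-- The total weight of the vertices of `H`. -/
noncomputable def wsum (H : SimpleGraph (Fin n)) : ℕ := ∑ v, wt (ndeg H v)

/-- All degrees of `H` are between two and five, and the total weight is `e`. -/
def Weighted (e : ℕ) (H : SimpleGraph (Fin n)) : Prop :=
  (∀ v, 2 ≤ ndeg H v ∧ ndeg H v ≤ 5) ∧ wsum H = e

lemma weighted_isoInvariant (e : ℕ) : IsoInvariant (Weighted (n := n) e) := by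
  have key : ∀ H K : SimpleGraph (Fin n), (H ≃g K) → Weighted e K → Weighted e H := by
    intro H K φ h
    refine ⟨fun v => by rw [← ndeg_iso φ]; exact h.1 _, ?_⟩
    rw [← h.2, wsum, wsum, ← Equiv.sum_comp φ.toEquiv fun v => wt (ndeg K v)]
    exact Finset.sum_congr rfl fun v _ => congrArg wt (ndeg_iso φ v).symm
  rintro H K ⟨φ⟩
  exact ⟨key K H φ.symm, key H K φ⟩

open Classical in
-- All vertices of one cycle of `σ` have the same degree, so the conditions on vertices become
-- conditions on cycles, with weights multiplied by the cycle length.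
lemma ncard_fixed_weighted {σ : Perm (Fin n)} {R : Finset ℕ} (hsymm : ∀ i j, lab i j = lab j i)
    (hinv : ∀ i j, lab (σ i) (σ j) = lab i j)
    (horb : ∀ i j i' j', lab i j = lab i' j' → ∀ H, Fixes σ H → (H.Adj i j → H.Adj i' j'))
    (hR : ∀ i j, i ≠ j → lab i j ∈ R) (hR' : ∀ r ∈ R, ∃ i j, i ≠ j ∧ lab i j = r)
    {k : ℕ} {cyc : Fin n → ℕ} {len : ℕ → ℕ} {c : ℕ → ℕ → ℕ} (hcyc : ∀ v, cyc v < k)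
    (hlen : ∀ q < k, (Finset.univ.filter fun v => cyc v = q).card = len q ∧ 0 < len q)
    (hc : ∀ v, ∀ r ∈ R, (Finset.univ.filter fun j => v ≠ j ∧ lab v j = r).card = c r (cyc v))
    (e : ℕ) :
    {H | Weighted e H ∧ Fixes σ H}.ncard =
      (R.powerset.filter fun χ => COk c k χ ∧ cwt c len k χ = e).card := by
  rw [ncard_fixed_eq hsymm hinv horb hR hR']
  congr 1
  refine Finset.filter_congr fun χ hχ => ?_
  have hdeg : ∀ v, ndeg (labGraph lab hsymm χ) v = cdeg c χ (cyc v) := fun v => by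
    rw [ndeg_labGraph]
    exact Finset.sum_congr rfl fun r hr => hc v r (Finset.mem_powerset.1 hχ hr)
  have hw : wsum (labGraph lab hsymm χ) = cwt c len k χ := by
    rw [wsum, cwt]
    simp only [hdeg]
    rw [← Finset.sum_fiberwise_of_maps_to (t := Finset.range k) (g := cyc)
      (fun v _ => Finset.mem_range.2 (hcyc v))]
    refine Finset.sum_congr rfl fun q hq => ?_
    rw [← (hlen q (Finset.mem_range.1 hq)).1, ← smul_eq_mul, ← Finset.sum_const]
    exact Finset.sum_congr rfl fun v hv => by rw [(Finset.mem_filter.1 hv).2]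
  rw [Weighted, hw]
  refine and_congr_left fun _ => ?_
  simp only [hdeg, COk]
  constructor
  · intro h q hq
    obtain ⟨h1, h2⟩ := hlen q hq
    rw [← h1, Finset.card_pos] at h2
    obtain ⟨v, hv⟩ := h2
    rw [← (Finset.mem_filter.1 hv).2]
    exact h v
  · exact fun h v => h _ (hcyc v)

end Fixed

end TrappingSets

namespace TrappingSets

open Equiv

/-! ### Explicit orbit data for a permutation of given cycle type -/

section Data

/-- The index of the cycle of `v` in the permutation with the cycle lengths `s`. -/
def cycN (s : List ℕ) (v : ℕ) : ℕ :=
  List.rec (motive := fun _ => ℕ → ℕ) (fun _ => 0)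
    (fun l _ ih v => bif Nat.blt v l then 0 else ih (v - l) + 1) s v

/-- The image of `v` under the permutation with the cycle lengths `s`. -/
def permN (s : List ℕ) (v : ℕ) : ℕ :=
  List.rec (motive := fun _ => ℕ → ℕ) (fun v => v)
    (fun l _ ih v => bif Nat.blt v l then (bif Nat.blt (v + 1) l then v + 1 else 0)
      else l + ih (v - l)) s v

/-- The first element of the cycle `q`. -/
def startN (s : List ℕ) (q : ℕ) : ℕ := (s.take q).sum

/-- A number for the pair of `i` and `j`. -/
def codeN (i j : ℕ) : ℕ := bif Nat.blt i j then 10 * i + j else 10 * j + i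

/-- The smallest number of a pair in the orbit of the pair of `i` and `j`. -/
def labN (s : List ℕ) (i j : ℕ) : ℕ :=
  -- Twenty steps exhaust every orbit of pairs for n up to 9: the longest joins cycles of lengths 4
  -- and 5.
  Nat.rec (motive := fun _ => ℕ → ℕ → ℕ) codeN
    (fun _ ih i j => min (codeN i j) (ih (permN s i) (permN s j))) 20 i j

/-- The orbits of pairs whose first cycle is `p`, with the degrees at the cycles `p, p + 1, …`. -/
def orbsN (s : List ℕ) (p : ℕ) : List (ℕ × List ℕ) :=
  let l := s.getD p 0
  let a := startN s p
  -- Pairs inside a cycle of length `l` fall into orbits by distance. Each gives degree 2, except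
  -- that opposite points give degree 1. The least pair of the orbit is `(a, a + d + 1)`.
  (List.range (l / 2)).map (fun d => (11 * a + d + 1, [bif Nat.beq (2 * (d + 1)) l then 1 else 2])) ++
    (List.range' (p + 1) (s.length - (p + 1))).flatMap fun q =>
      let m := s.getD q 0
      let g := Nat.gcd l m
      -- Between cycles of lengths `l` and `m` there are gcd(l, m) orbits, with degree `m / g` on
      -- the first cycle and `l / g` on the second.
      (List.range g).map fun t =>
        (10 * a + startN s q + t, (m / g) :: (List.replicate (q - p - 1) 0 ++ [l / g]))

/-- All labels. -/
def labsN (s : List ℕ) : List ℕ :=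
  (List.range' 0 s.length).flatMap fun q => (orbsN s q).map Prod.fst

/-- The number of pairs with the label `r` at `v`. -/
def cntN (n : ℕ) (s : List ℕ) (r v : ℕ) : ℕ :=
  ((List.range n).filter fun j => !Nat.beq v j && Nat.beq (labN s v j) r).length

/-- The number of pairs with the label `r` at each element of the cycle `q`. -/
def degN (n : ℕ) (s : List ℕ) (r q : ℕ) : ℕ := cntN n s r (startN s q)

/-- The nontrivial cycles. -/
def blocksN (n : ℕ) (s : List ℕ) : List (List (Fin n)) :=
  ((List.range s.length).map fun q =>
    (List.finRange n).filter fun v : Fin n => Nat.beq (cycN s v.val) q).filter fun l => Nat.ble 2 l.length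

/-- The permutation with the cycle lengths `s`. -/
def repPerm (n : ℕ) (s : List ℕ) : Perm (Fin n) := ((blocksN n s).map List.formPerm).prod

/-- The nontrivial cycle lengths. -/
def typeN (s : List ℕ) : List ℕ := s.filter fun l => Nat.ble 2 l

/-- The size of the conjugacy class times this number is `n !`. -/
def zN (n : ℕ) (s : List ℕ) : ℕ :=
  (n - (typeN s).sum).factorial * (typeN s).prod *
    ((typeN s).dedup.map fun l => ((typeN s).count l).factorial).prod

/-- The conditions that make the formulas above correct. -/
def CycleData (n : ℕ) (s : List ℕ) (cls : ℕ) : Prop :=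
  (((∀ i : Fin n, (repPerm n s i).val = permN s i) ∧ (blocksN n s).flatten.Nodup) ∧
    ((blocksN n s).map List.length = typeN s ∧ zN n s * cls = n.factorial)) ∧
  ((∀ i < n, ∀ j < n, labN s (permN s i) (permN s j) = labN s i j) ∧
    ∀ i < n, ∀ j < n, i ≠ j → labN s i j ∈ labsN s) ∧
  ((labsN s).Nodup ∧
    ∀ r ∈ labsN s, r % 10 < n ∧ r / 10 < r % 10 ∧ labN s (r / 10) (r % 10) = r) ∧
  ((∀ v < n, ∀ r ∈ labsN s, cntN n s r v = degN n s r (cycN s v)) ∧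
    ∀ q < s.length, ∀ x ∈ orbsN s q, (∀ q' < q, degN n s x.1 q' = 0) ∧
      ∀ i < s.length - q, degN n s x.1 (q + i) = x.2.getD i 0) ∧
  (∀ v < n, cycN s v < s.length) ∧
  ∀ q < s.length, ((List.range n).filter fun v => Nat.beq (cycN s v) q).length = s.getD q 0 ∧
    0 < s.getD q 0

set_option synthInstance.maxSize 2000 in
instance (n : ℕ) (s : List ℕ) (cls : ℕ) : Decidable (CycleData n s cls) := by
  unfold CycleData; infer_instance

lemma codeN_eq (i j : ℕ) : codeN i j = if i < j then 10 * i + j else 10 * j + i := by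
  have : Nat.blt i j = decide (i < j) := by
    rw [Bool.eq_iff_iff, Nat.blt_eq, decide_eq_true_iff]
  rw [codeN, this, Bool.cond_decide]

lemma codeN_comm (i j : ℕ) : codeN i j = codeN j i := by
  rw [codeN_eq, codeN_eq]
  split_ifs <;> omega

lemma codeN_inj {i j i' j' : ℕ} (hi : i < 10) (hj : j < 10) (hi' : i' < 10) (hj' : j' < 10)
    (h : codeN i j = codeN i' j') : (i = i' ∧ j = j') ∨ (i = j' ∧ j = i') := by
  rw [codeN_eq, codeN_eq] at h
  split_ifs at h <;> omega

lemma labN_comm (s : List ℕ) (i j : ℕ) : labN s i j = labN s j i := by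
  have key : ∀ t i j, (Nat.rec (motive := fun _ => ℕ → ℕ → ℕ) codeN
      (fun _ ih i j => min (codeN i j) (ih (permN s i) (permN s j))) t i j : ℕ) =
      Nat.rec (motive := fun _ => ℕ → ℕ → ℕ) codeN
      (fun _ ih i j => min (codeN i j) (ih (permN s i) (permN s j))) t j i := by
    intro t
    induction t with
    | zero => exact codeN_comm
    | succ t ih =>
      intro i j
      exact congrArg₂ min (codeN_comm i j) (ih _ _)
  exact key 20 i j

/-- The minimum is attained at some image of the pair. Together with `codeN_inj` this shows that
pairs with equal labels lie in one orbit. -/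
lemma labN_spec (s : List ℕ) (i j : ℕ) :
    ∃ t, labN s i j = codeN ((permN s)^[t] i) ((permN s)^[t] j) := by
  have key : ∀ t i j, ∃ u, (Nat.rec (motive := fun _ => ℕ → ℕ → ℕ) codeN
      (fun _ ih i j => min (codeN i j) (ih (permN s i) (permN s j))) t i j : ℕ) =
      codeN ((permN s)^[u] i) ((permN s)^[u] j) := by
    intro t
    induction t with
    | zero => exact fun i j => ⟨0, rfl⟩
    | succ t ih =>
      intro i j
      obtain ⟨u, hu⟩ := ih (permN s i) (permN s j)
      rcases min_choice (codeN i j) (Nat.rec (motive := fun _ => ℕ → ℕ → ℕ) codeN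
        (fun _ ih i j => min (codeN i j) (ih (permN s i) (permN s j))) t (permN s i)
          (permN s j) : ℕ) with h | h
      · exact ⟨0, h⟩
      · exact ⟨u + 1, h.trans hu⟩
  exact key 20 i j

variable {n : ℕ} {s : List ℕ} {cls : ℕ}

lemma card_filter_fin (p : ℕ → Bool) :
    (Finset.univ.filter fun j : Fin n => p j = true).card = ((List.range n).filter p).length := by
  rw [← List.toFinset_card_of_nodup (List.nodup_range.filter p)]
  refine Finset.card_bij (fun j _ => j.val) ?_ ?_ ?_
  · intro j hj
    simpa using (Finset.mem_filter.1 hj).2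
  · intro i _ j _ h
    exact Fin.ext h
  · intro j hj
    rw [List.mem_toFinset, List.mem_filter, List.mem_range] at hj
    exact ⟨⟨j, hj.1⟩, by simpa using hj.2, rfl⟩

lemma cycleType_repPerm (h : CycleData n s cls) : (repPerm n s).cycleType = typeN s := by
  rw [repPerm, cycleType_prod_formPerm _ (fun l hl => ?_) h.1.1.2, h.1.2.1]
  exact Nat.le_of_ble_eq_true (List.mem_filter.1 hl).2

/-- Both the class size and `cls` give n! when multiplied by the order `zN` of the centralizer,
which is positive. -/
lemma card_cycleType_repPerm (h : CycleData n s cls) :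
    (Finset.univ.filter fun g : Perm (Fin n) => g.cycleType = (repPerm n s).cycleType).card =
      cls := by
  have h1 := Perm.card_of_cycleType_mul_eq (Fin n) (repPerm n s).cycleType
  have h2 : (repPerm n s).cycleType.sum ≤ Fintype.card (Fin n) ∧
      ∀ a ∈ (repPerm n s).cycleType, 2 ≤ a :=
    ⟨(Perm.sum_cycleType _).trans_le (Finset.card_le_univ _),
      fun a ha => Perm.two_le_of_mem_cycleType ha⟩
  have hz := h.1.2.2
  have e : ∏ m ∈ (repPerm n s).cycleType.toFinset,
      (Multiset.count m (repPerm n s).cycleType).factorial =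
      ((typeN s).dedup.map fun l => ((typeN s).count l).factorial).prod := by
    rw [cycleType_repPerm h]
    simp only [Multiset.coe_count]
    rfl
  rw [if_pos h2, e, cycleType_repPerm h, Fintype.card_fin, Multiset.sum_coe, Multiset.prod_coe,
    ← hz, mul_comm (zN n s)] at h1
  rw [cycleType_repPerm h]
  have hpos : 0 < zN n s := Nat.pos_of_ne_zero fun h0 => by
    rw [h0, zero_mul] at hz
    exact (Nat.factorial_pos n).ne hz
  exact Nat.eq_of_mul_eq_mul_right hpos h1

lemma iterate_repPerm (h : CycleData n s cls) (t : ℕ) (i : Fin n) :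
    (((repPerm n s)^[t] i : Fin n) : ℕ) = (permN s)^[t] i := by
  induction t generalizing i with
  | zero => rfl
  | succ t ih => rw [Function.iterate_succ_apply, ih, h.1.1.1 i, Function.iterate_succ_apply]

lemma Fixes.iterate {σ : Perm (Fin n)} {H : SimpleGraph (Fin n)} (h : Fixes σ H) (t : ℕ)
    (i j : Fin n) : H.Adj (σ^[t] i) (σ^[t] j) ↔ H.Adj i j := by
  induction t generalizing i j with
  | zero => rfl
  | succ t ih => rw [Function.iterate_succ_apply, Function.iterate_succ_apply, ih, h]

open Classical in
-- The bound on `n` is needed because pairs are coded by two decimal digits.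
lemma ncard_fixed_repPerm (hn : n ≤ 10) (h : CycleData n s cls) (e : ℕ) :
    {H | Weighted e H ∧ Fixes (repPerm n s) H}.ncard =
      ((labsN s).toFinset.powerset.filter fun χ => COk (degN n s) s.length χ ∧
        cwt (degN n s) (fun q => s.getD q 0) s.length χ = e).card := by
  refine ncard_fixed_weighted (lab := fun i j => labN s i j) (cyc := fun v => cycN s v)
    (fun i j => labN_comm s i j) ?_ ?_ ?_ ?_ ?_ ?_ ?_ e
  · intro i j
    rw [h.1.1.1, h.1.1.1]
    exact h.2.1.1 i i.2 j j.2
  · intro i j i' j' hl H hH hA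
    obtain ⟨t, ht⟩ := labN_spec s i j
    obtain ⟨t', ht'⟩ := labN_spec s i' j'
    rw [ht, ht', ← iterate_repPerm h, ← iterate_repPerm h, ← iterate_repPerm h,
      ← iterate_repPerm h] at hl
    have hlt : ∀ x : Fin n, x.val < 10 := fun x => x.2.trans_le hn
    rw [← hH.iterate t] at hA
    rw [← hH.iterate t']
    rcases codeN_inj (hlt _) (hlt _) (hlt _) (hlt _) hl with ⟨h1, h2⟩ | ⟨h1, h2⟩
    · rwa [← Fin.ext h1, ← Fin.ext h2]
    · rw [← Fin.ext h1, ← Fin.ext h2]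
      exact hA.symm
  · intro i j hij
    exact List.mem_toFinset.2 (h.2.1.2 i i.2 j j.2 fun e => hij (Fin.ext e))
  · intro r hr
    obtain ⟨h1, h2, h3⟩ := h.2.2.1.2 r (List.mem_toFinset.1 hr)
    exact ⟨⟨r / 10, h2.trans h1⟩, ⟨r % 10, h1⟩, fun e => h2.ne (congrArg Fin.val e), h3⟩
  · exact fun v => h.2.2.2.2.1 v v.2
  · intro q hq
    obtain ⟨h1, h2⟩ := h.2.2.2.2.2 q hq
    refine ⟨?_, h2⟩
    rw [← h1, ← card_filter_fin]
    congr 1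
    ext v
    simp
  · intro v r hr
    rw [← h.2.2.2.1.1 v v.2 r (List.mem_toFinset.1 hr), cntN, ← card_filter_fin]
    congr 1
    ext j
    simp only [Fin.ext_iff, Finset.mem_filter, Finset.mem_univ, true_and, Bool.and_eq_true,
      Bool.not_eq_true', Nat.beq_eq, ne_eq, ← Bool.not_eq_true]

/-- The generating function of the fixed graphs. -/
noncomputable def fixN (s : List ℕ) : ℕ :=
  runP (fun q => s.getD q 0) (orbsN s) s.length 0 (oneP s.length)

open Classical in
lemma fixN_eq (h : CycleData n s cls) :
    fixN s = ∑ χ ∈ (labsN s).toFinset.powerset, if COk (degN n s) s.length χ then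
      2 ^ (56 * cwt (degN n s) (fun q => s.getD q 0) s.length χ) else 0 := by
  have h1 := (represents_oneP (c := degN n s) (len := fun q => s.getD q 0) s.length).run (orbsN s)
    h.2.2.1.1 (by simp) (fun q _ hq x hx => (h.2.2.2.1.2 q (by omega) x hx).1)
    (fun q _ hq x hx i hi => (h.2.2.2.1.2 q (by omega) x hx).2 i (by omega))
  rw [Finset.empty_union, zero_add] at h1
  exact h1

open Classical in
/-- Burnside's lemma, with all fixed point numbers evaluated. -/
theorem coefN_eq (hn : n ≤ 10) (reps : List (List ℕ × ℕ)) (hdata : ∀ x ∈ reps, CycleData n x.1 x.2)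
    (hnd : (reps.map fun x => (typeN x.1 : Multiset ℕ)).Nodup)
    (htot : (reps.map Prod.snd).sum = n.factorial)
    (hbound : (reps.map fun x => x.2 * 2 ^ (labsN x.1).length).sum < 2 ^ 56) (e : ℕ) :
    coefN (reps.map fun x => x.2 * fixN x.1).sum e =
      n.factorial * numClasses (Weighted (n := n) e) := by
  have hnd' : reps.Nodup := hnd.of_map _
  rw [← List.sum_toFinset _ hnd'] at htot hbound ⊢
  -- One sum over pairs of a cycle type and a selection, so that a single carry bound covers all
  -- permutations.
  have h1 : ∑ x ∈ reps.toFinset, x.2 * fixN x.1 =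
      ∑ y ∈ (reps.toFinset.sigma fun x => (labsN x.1).toFinset.powerset.filter fun χ =>
        COk (degN n x.1) x.1.length χ), y.1.2 *
          2 ^ (56 * cwt (degN n y.1.1) (fun q => y.1.1.getD q 0) y.1.1.length y.2) := by
    rw [Finset.sum_sigma]
    refine Finset.sum_congr rfl fun x hx => ?_
    rw [fixN_eq (hdata x (List.mem_toFinset.1 hx)), ← Finset.sum_filter, Finset.mul_sum]
  rw [h1, coefN_sum, mul_comm, numClasses_mul_factorial (weighted_isoInvariant e),
    sum_perm_eq reps.toFinset (fun x => repPerm n x.1) Prod.snd ?_ ?_ htot _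
      (fun σ τ h => ncard_fixed_congr (weighted_isoInvariant e) h)]
  · rw [Finset.sum_filter, Finset.sum_sigma]
    refine Finset.sum_congr rfl fun x hx => ?_
    rw [ncard_fixed_repPerm hn (hdata x (List.mem_toFinset.1 hx)), ← Finset.sum_filter]
    dsimp only
    rw [Finset.sum_const, smul_eq_mul, mul_comm, Finset.filter_filter]
  · intro x hx y hy hxy
    have h1 := hdata x (List.mem_toFinset.1 hx)
    have h2 := hdata y (List.mem_toFinset.1 hy)
    simp only [cycleType_repPerm h1, cycleType_repPerm h2] at hxy
    exact List.inj_on_of_nodup_map hnd (List.mem_toFinset.1 hx) (List.mem_toFinset.1 hy) hxy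
  · exact fun x hx => card_cycleType_repPerm (hdata x (List.mem_toFinset.1 hx))
  -- A permutation has at most 2^r selections, where r is its number of orbits on pairs.
  · refine lt_of_le_of_lt ?_ hbound
    rw [Finset.sum_sigma]
    refine Finset.sum_le_sum fun x hx => ?_
    dsimp only
    rw [Finset.sum_const, smul_eq_mul, mul_comm]
    refine Nat.mul_le_mul_left _ ((Finset.card_filter_le _ _).trans ?_)
    rw [Finset.card_powerset]
    exact Nat.pow_le_pow_right (by norm_num) (List.toFinset_card_le _)

end Data

end TrappingSets

namespace TrappingSets

/-! ### The totals with minimum degree two and three -/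

section Numbers

/-- Representatives of the conjugacy classes of permutations, with the class sizes. -/
def permReps : ℕ → List (List ℕ × ℕ)
  | 4 => [([4], 6), ([3, 1], 8), ([2, 2], 3), ([2, 1, 1], 6), ([1, 1, 1, 1], 1)]
  | 5 => [([5], 24), ([4, 1], 30), ([3, 2], 20), ([3, 1, 1], 20), ([2, 2, 1], 15),
      ([2, 1, 1, 1], 10), ([1, 1, 1, 1, 1], 1)]
  | 6 => [([6], 120), ([5, 1], 144), ([4, 2], 90), ([4, 1, 1], 90), ([3, 3], 40),
      ([3, 2, 1], 120), ([3, 1, 1, 1], 40), ([2, 2, 2], 15), ([2, 2, 1, 1], 45),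
      ([2, 1, 1, 1, 1], 15), ([1, 1, 1, 1, 1, 1], 1)]
  | 7 => [([7], 720), ([6, 1], 840), ([5, 2], 504), ([5, 1, 1], 504), ([4, 3], 420),
      ([4, 2, 1], 630), ([4, 1, 1, 1], 210), ([3, 3, 1], 280), ([3, 2, 2], 210),
      ([3, 2, 1, 1], 420), ([3, 1, 1, 1, 1], 70), ([2, 2, 2, 1], 105),
      ([2, 2, 1, 1, 1], 105), ([2, 1, 1, 1, 1, 1], 21), ([1, 1, 1, 1, 1, 1, 1], 1)]
  | 8 => [([8], 5040), ([7, 1], 5760), ([6, 2], 3360), ([6, 1, 1], 3360), ([5, 3], 2688),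
      ([5, 2, 1], 4032), ([5, 1, 1, 1], 1344), ([4, 4], 1260), ([4, 3, 1], 3360),
      ([4, 2, 2], 1260), ([4, 2, 1, 1], 2520), ([4, 1, 1, 1, 1], 420), ([3, 3, 2], 1120),
      ([3, 3, 1, 1], 1120), ([3, 2, 2, 1], 1680), ([3, 2, 1, 1, 1], 1120),
      ([3, 1, 1, 1, 1, 1], 112), ([2, 2, 2, 2], 105), ([2, 2, 2, 1, 1], 420),
      ([2, 2, 1, 1, 1, 1], 210), ([2, 1, 1, 1, 1, 1, 1], 28), ([1, 1, 1, 1, 1, 1, 1, 1], 1)]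
  | 9 => [([9], 40320), ([8, 1], 45360), ([7, 2], 25920), ([7, 1, 1], 25920), ([6, 3], 20160),
      ([6, 2, 1], 30240), ([6, 1, 1, 1], 10080), ([5, 4], 18144), ([5, 3, 1], 24192),
      ([5, 2, 2], 9072), ([5, 2, 1, 1], 18144), ([5, 1, 1, 1, 1], 3024), ([4, 4, 1], 11340),
      ([4, 3, 2], 15120), ([4, 3, 1, 1], 15120), ([4, 2, 2, 1], 11340),
      ([4, 2, 1, 1, 1], 7560), ([4, 1, 1, 1, 1, 1], 756), ([3, 3, 3], 2240),
      ([3, 3, 2, 1], 10080), ([3, 3, 1, 1, 1], 3360), ([3, 2, 2, 2], 2520),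
      ([3, 2, 2, 1, 1], 7560), ([3, 2, 1, 1, 1, 1], 2520), ([3, 1, 1, 1, 1, 1, 1], 168),
      ([2, 2, 2, 2, 1], 945), ([2, 2, 2, 1, 1, 1], 1260), ([2, 2, 1, 1, 1, 1, 1], 378),
      ([2, 1, 1, 1, 1, 1, 1, 1], 36), ([1, 1, 1, 1, 1, 1, 1, 1, 1], 1)]
  | _ => []

/-- The numbers of isomorphism classes of graphs with `n` vertices, degrees from `2` to `5` and degree
sum `5 * n - b`. -/
def total2 : ℕ → ℕ → ℕ
  | 4, 8 => 1
  | 5, 5 => 1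
  | 5, 7 => 1
  | 5, 9 => 2
  | 6, 0 => 1
  | 6, 2 => 1
  | 6, 4 => 2
  | 6, 6 => 5
  | 6, 8 => 8
  | 7, 1 => 1
  | 7, 3 => 6
  | 7, 5 => 18
  | 7, 7 => 37
  | 7, 9 => 62
  | 8, 0 => 3
  | 8, 2 => 16
  | 8, 4 => 75
  | 8, 6 => 223
  | 8, 8 => 461
  | 9, 1 => 28
  | 9, 3 => 289
  | 9, 5 => 1357
  | 9, 7 => 3787
  | 9, 9 => 7093
  | _, _ => 0

/-- The numbers of isomorphism classes of graphs with `n` vertices, degrees from `3` to `5` and degree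
sum `5 * n - b`. -/
def total3 : ℕ → ℕ → ℕ
  | 4, 8 => 1
  | 5, 5 => 1
  | 5, 7 => 1
  | 5, 9 => 1
  | 6, 0 => 1
  | 6, 2 => 1
  | 6, 4 => 2
  | 6, 6 => 4
  | 6, 8 => 5
  | 7, 1 => 1
  | 7, 3 => 5
  | 7, 5 => 14
  | 7, 7 => 23
  | 7, 9 => 25
  | 8, 0 => 3
  | 8, 2 => 16
  | 8, 4 => 68
  | 8, 6 => 165
  | 8, 8 => 252
  | 9, 1 => 28
  | 9, 3 => 276
  | 9, 5 => 1151
  | 9, 7 => 2541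
  | 9, 9 => 3284
  | _, _ => 0

/-- Comparison of the totals with the coefficients of `N`. -/
def totalsOk (n N : ℕ) : Bool :=
  (List.range 10).all fun b =>
    Nat.beq (coefN N b) (n.factorial * total3 n b) &&
      Nat.beq (coefN N b + coefN N (b + 40) + coefN N (b + 80) + coefN N (b + 120))
        (n.factorial * total2 n b)

/-- Evaluation of `N` before the application of `f`. -/
def force {α : Type} (f : ℕ → α) (N : ℕ) : α :=
  Nat.rec (motive := fun _ => α) (f 0) (fun m _ => f (Nat.succ m)) N

lemma force_eq {α : Type} (f : ℕ → α) (N : ℕ) : force f N = f N := by cases N <;> rfl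

/-- A sum of products, with fast kernel reduction. -/
noncomputable def fixTotal (l : List (List ℕ × ℕ)) : ℕ :=
  List.rec (motive := fun _ => ℕ) 0 (fun x _ ih => Nat.add (Nat.mul x.2 (fixN x.1)) ih) l

lemma totalsOk_4 : force (totalsOk 4) (fixTotal (permReps 4)) = true := by decide +kernel
lemma totalsOk_5 : force (totalsOk 5) (fixTotal (permReps 5)) = true := by decide +kernel
lemma totalsOk_6 : force (totalsOk 6) (fixTotal (permReps 6)) = true := by decide +kernel
lemma totalsOk_7 : force (totalsOk 7) (fixTotal (permReps 7)) = true := by decide +kernel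
lemma totalsOk_8 : force (totalsOk 8) (fixTotal (permReps 8)) = true := by decide +kernel
lemma totalsOk_9 : force (totalsOk 9) (fixTotal (permReps 9)) = true := by decide +kernel

lemma cycleData_4 : ∀ x ∈ permReps 4, CycleData 4 x.1 x.2 := by decide +kernel

lemma cycleData_5 : ∀ x ∈ permReps 5, CycleData 5 x.1 x.2 := by decide +kernel

lemma cycleData_6 : ∀ x ∈ permReps 6, CycleData 6 x.1 x.2 := by decide +kernel

lemma cycleData_7 : ∀ x ∈ permReps 7, CycleData 7 x.1 x.2 := by decide +kernel

lemma cycleData_8 : ∀ x ∈ permReps 8, CycleData 8 x.1 x.2 := by decide +kernel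

lemma cycleData_9 : ∀ x ∈ permReps 9, CycleData 9 x.1 x.2 := by decide +kernel

lemma permReps_nodup : ∀ n ∈ [4, 5, 6, 7, 8, 9],
    ((permReps n).map fun x => (typeN x.1 : Multiset ℕ)).Nodup := by decide +kernel

lemma permReps_sum : ∀ n ∈ [4, 5, 6, 7, 8, 9],
    ((permReps n).map Prod.snd).sum = n.factorial := by decide +kernel

lemma permReps_bound : ∀ n ∈ [4, 5, 6, 7, 8, 9],
    ((permReps n).map fun x => x.2 * 2 ^ (labsN x.1).length).sum < 2 ^ 56 := by decide +kernel

lemma fixTotal_eq (l : List (List ℕ × ℕ)) : fixTotal l = (l.map fun x => x.2 * fixN x.1).sum := by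
  induction l with
  | nil => rfl
  | cons x l ih =>
    rw [List.map_cons, List.sum_cons, ← ih]
    rfl

lemma coefN_fixTotal {n : ℕ} (h4 : 4 ≤ n) (h9 : n ≤ 9) (e : ℕ) :
    coefN (fixTotal (permReps n)) e = n.factorial * numClasses (Weighted (n := n) e) := by
  have hmem : n ∈ [4, 5, 6, 7, 8, 9] := by
    interval_cases n <;> simp
  rw [fixTotal_eq]
  refine coefN_eq (by omega) _ ?_ (permReps_nodup n hmem) (permReps_sum n hmem)
    (permReps_bound n hmem) e
  interval_cases n
  exacts [cycleData_4, cycleData_5, cycleData_6, cycleData_7, cycleData_8, cycleData_9]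

/-- The multiples of 40 in the weight count the vertices of degree two, from zero to three of them;
weight `b` itself belongs to minimum degree three. -/
lemma totals_eq {n b : ℕ} (h4 : 4 ≤ n) (h9 : n ≤ 9) (hb : b ≤ 9) :
    numClasses (Weighted (n := n) b) = total3 n b ∧
      numClasses (Weighted (n := n) b) + numClasses (Weighted (n := n) (b + 40)) +
        numClasses (Weighted (n := n) (b + 80)) + numClasses (Weighted (n := n) (b + 120)) =
          total2 n b := by
  have h : totalsOk n (fixTotal (permReps n)) = true := by
    rw [← force_eq (totalsOk n)]
    interval_cases n
    exacts [totalsOk_4, totalsOk_5, totalsOk_6, totalsOk_7, totalsOk_8, totalsOk_9]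
  have hb' := List.all_eq_true.1 h b (List.mem_range.2 (by omega))
  simp only [Bool.and_eq_true, Nat.beq_eq, coefN_fixTotal h4 h9, ← Nat.mul_add] at hb'
  exact ⟨Nat.eq_of_mul_eq_mul_left n.factorial_pos hb'.1,
    Nat.eq_of_mul_eq_mul_left n.factorial_pos hb'.2⟩

/-- All degrees of `H` are between `d` and `5`, and the degree sum is `5 * n - b`. -/
def Bounded {n : ℕ} (d b : ℕ) (H : SimpleGraph (Fin n)) : Prop :=
  (∀ v, d ≤ ndeg H v ∧ ndeg H v ≤ 5) ∧ b + dsum H = 5 * n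

lemma bounded_isoInvariant {n : ℕ} (d b : ℕ) : IsoInvariant (Bounded (n := n) d b) := by
  have key : ∀ H K : SimpleGraph (Fin n), (H ≃g K) → Bounded d b K → Bounded d b H := by
    intro H K φ h
    exact ⟨fun v => by rw [← ndeg_iso φ]; exact h.1 _, by rw [← dsum_iso φ]; exact h.2⟩
  rintro H K ⟨φ⟩
  exact ⟨key K H φ.symm, key H K φ⟩

lemma numClasses_congr {n : ℕ} {P Q : SimpleGraph (Fin n) → Prop} (h : ∀ H, P H ↔ Q H) :
    numClasses P = numClasses Q := by
  rw [show P = Q from funext fun H => propext (h H)]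

/-- Invariance of `Q` makes the two sets of classes disjoint, not only the two sets of graphs. -/
lemma numClasses_or {n : ℕ} {P Q : SimpleGraph (Fin n) → Prop} (hQ : IsoInvariant Q)
    (h : ∀ H, P H → ¬ Q H) :
    numClasses (fun H => P H ∨ Q H) = numClasses P + numClasses Q := by
  rw [numClasses, numClasses, numClasses, ← Set.ncard_union_eq _ (Set.toFinite _) (Set.toFinite _),
    ← Set.image_union]
  · rfl
  · refine Set.disjoint_left.2 ?_
    rintro _ ⟨H, hH, rfl⟩ ⟨K, hK, e⟩
    exact h H hH ((hQ K H (Quotient.exact e)).1 hK)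

/-- The number of vertices of degree two. -/
noncomputable def numTwo {n : ℕ} (H : SimpleGraph (Fin n)) : ℕ :=
  (Finset.univ.filter fun v => ndeg H v = 2).card

lemma wsum_eq {n : ℕ} (H : SimpleGraph (Fin n)) :
    wsum H = (∑ v, (5 - ndeg H v)) + 40 * numTwo H := by
  rw [numTwo, Finset.card_filter, Finset.mul_sum, ← Finset.sum_add_distrib, wsum]
  refine Finset.sum_congr rfl fun v _ => ?_
  rw [wt]
  rcases h : Nat.beq (ndeg H v) 2 with _ | _
  · rw [if_neg (fun h' => by rw [h'] at h; cases h)]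
    rfl
  · rw [if_pos (Nat.eq_of_beq_eq_true h)]
    rfl

lemma sum_deficit {n : ℕ} (H : SimpleGraph (Fin n)) (h : ∀ v, 2 ≤ ndeg H v ∧ ndeg H v ≤ 5) :
    (∑ v, (5 - ndeg H v)) + dsum H = 5 * n ∧ ∑ v, (5 - ndeg H v) ≤ 3 * n ∧
      3 * numTwo H ≤ ∑ v, (5 - ndeg H v) := by
  refine ⟨?_, ?_, ?_⟩
  · rw [dsum, ← Finset.sum_add_distrib, Finset.sum_congr rfl
      fun v _ => Nat.sub_add_cancel (h v).2]
    simp [mul_comm]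
  · refine (Finset.sum_le_sum (g := fun _ => 3) fun v _ => ?_).trans ?_
    · have := h v
      omega
    · simp [mul_comm]
  · rw [numTwo, Finset.card_filter, Finset.mul_sum]
    refine Finset.sum_le_sum fun v _ => ?_
    split_ifs <;> omega

/-- The sum of the deficits 5 - deg is at most 27, hence below 40, so the weight determines both
this sum and the number of vertices of degree two. Each such vertex has deficit 3, so for b at most
9 there are at most three. -/
lemma bounded_two_iff {n b : ℕ} (h9 : n ≤ 9) (hb : b ≤ 9) (H : SimpleGraph (Fin n)) :
    Bounded 2 b H ↔ (((Weighted b H ∨ Weighted (b + 40) H) ∨ Weighted (b + 80) H) ∨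
      Weighted (b + 120) H) := by
  simp only [Bounded, Weighted, ← and_or_left]
  refine and_congr_right fun h => ?_
  have h1 := wsum_eq H
  have h2 := sum_deficit H h
  omega

lemma bounded_three_iff {n b : ℕ} (h9 : n ≤ 9) (hb : b ≤ 9) (H : SimpleGraph (Fin n)) :
    Bounded 3 b H ↔ Weighted b H := by
  have h1 := wsum_eq H
  constructor
  · rintro ⟨h, h'⟩
    have h2' : ∀ v, 2 ≤ ndeg H v ∧ ndeg H v ≤ 5 := fun v => ⟨by have := h v; omega, (h v).2⟩
    have h2 := sum_deficit H h2'
    have h0 : numTwo H = 0 := Finset.card_eq_zero.2 (Finset.filter_eq_empty_iff.2 fun v _ => by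
      have := h v
      omega)
    exact ⟨h2', by omega⟩
  · rintro ⟨h, h'⟩
    have h2 := sum_deficit H h
    have h0 : numTwo H = 0 := by omega
    refine ⟨fun v => ⟨?_, (h v).2⟩, by omega⟩
    have h3 := Finset.filter_eq_empty_iff.1 (Finset.card_eq_zero.1 h0) (Finset.mem_univ v)
    have := h v
    omega

theorem numClasses_bounded {n b : ℕ} (h4 : 4 ≤ n) (h9 : n ≤ 9) (hb : b ≤ 9) :
    numClasses (Bounded (n := n) 2 b) = total2 n b ∧
      numClasses (Bounded (n := n) 3 b) = total3 n b := by
  obtain ⟨h3, h2⟩ := totals_eq h4 h9 hb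
  rw [numClasses_congr (bounded_three_iff h9 hb), h3, numClasses_congr (bounded_two_iff h9 hb),
    numClasses_or (weighted_isoInvariant _), numClasses_or (weighted_isoInvariant _),
    numClasses_or (weighted_isoInvariant _), h2]
  · exact ⟨rfl, rfl⟩
  · rintro H ⟨-, h⟩ ⟨-, h'⟩
    omega
  · rintro H (⟨-, h⟩ | ⟨-, h⟩) ⟨-, h'⟩ <;> omega
  · rintro H ((⟨-, h⟩ | ⟨-, h⟩) | ⟨-, h⟩) ⟨-, h'⟩ <;> omega

end Numbers

end TrappingSets

namespace TrappingSets

/-! ### Classes of graphs stable under deletion of a vertex of minimal degree -/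

section Classes

variable {k : ℕ}

/-- Every triangle lies in a closed set with at most `c` vertices. -/
def NP {V : Type*} (c : ℕ) (H : SimpleGraph V) : Prop :=
  ∀ x y z, H.Adj x y → H.Adj x z → H.Adj y z →
    ∃ A, TwoClosed H A ∧ x ∈ A ∧ y ∈ A ∧ z ∈ A ∧ A.ncard ≤ c

/-- Two-closed sets pull back along embeddings without growing, so the condition passes to graphs
with a vertex deleted. -/
lemma NP.of_embedding {V W : Type*} [Finite W] {c : ℕ} {H : SimpleGraph V} {K : SimpleGraph W}
    (φ : H ↪g K) (h : NP c K) : NP c H := by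
  intro x y z h1 h2 h3
  obtain ⟨A, hA, hx, hy, hz, hc⟩ := h (φ x) (φ y) (φ z) (φ.map_adj_iff.2 h1) (φ.map_adj_iff.2 h2)
    (φ.map_adj_iff.2 h3)
  refine ⟨φ ⁻¹' A, hA.preimage φ, hx, hy, hz, le_trans ?_ hc⟩
  exact Set.ncard_le_ncard_of_injOn φ (fun _ h => h) φ.injective.injOn (Set.toFinite A)

/-- The lower bounds for the degree sums. -/
def thr : ℕ → ℕ
  | 3 => 2
  | 4 => 8
  | 5 => 12
  | 6 => 16
  | 7 => 22
  | 8 => 28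
  | 9 => 36
  | _ => 0

/-- The additional conditions of the classes. -/
def Extra : (k : ℕ) → SimpleGraph (Fin k) → Prop
  | 7, H => NP 6 H ∨ 30 ≤ dsum H
  | 8, H => NP 7 H ∧ (NP 6 H ∨ 32 ≤ dsum H)
  | 9, H => NP 7 H ∧ ∀ v, 2 ≤ ndeg H v
  | _, _ => True

/-- A class of graphs that contains the exceptional graphs and is closed under the deletion of
vertices of minimal degree. -/
def Cls (k : ℕ) (H : SimpleGraph (Fin k)) : Prop :=
  (∀ v, ndeg H v ≤ 5) ∧ thr k ≤ dsum H ∧ Extra k H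

/-- Deletion of a vertex. -/
def del (H : SimpleGraph (Fin (k + 1))) (v : Fin (k + 1)) : SimpleGraph (Fin k) :=
  H.comap v.succAbove

/-- The deletion of a vertex gives an induced subgraph. -/
def delEmb (H : SimpleGraph (Fin (k + 1))) (v : Fin (k + 1)) : del H v ↪g H :=
  ⟨v.succAboveEmb, Iff.rfl⟩

lemma ndeg_eq_sum {n : ℕ} (H : SimpleGraph (Fin n)) [DecidableRel H.Adj] (v : Fin n) :
    ndeg H v = ∑ w, if H.Adj v w then 1 else 0 := by
  rw [← Finset.card_filter, ndeg, ← Set.ncard_coe_finset]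
  congr 1
  ext w
  simp

lemma ndeg_del (H : SimpleGraph (Fin (k + 1))) [DecidableRel H.Adj] (v : Fin (k + 1)) (i : Fin k) :
    ndeg H (v.succAbove i) = (if H.Adj v (v.succAbove i) then 1 else 0) + ndeg (del H v) i := by
  classical
  rw [ndeg_eq_sum, Fin.sum_univ_succAbove _ v, ndeg_eq_sum]
  simp only [H.adj_comm v]
  exact congrArg _ (Finset.sum_congr rfl fun w _ => if_congr Iff.rfl rfl rfl)

lemma dsum_del (H : SimpleGraph (Fin (k + 1))) (v : Fin (k + 1)) :
    dsum H = dsum (del H v) + 2 * ndeg H v := by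
  classical
  have h1 : ndeg H v = ∑ i : Fin k, if H.Adj v (v.succAbove i) then 1 else 0 := by
    rw [ndeg_eq_sum, Fin.sum_univ_succAbove _ v, if_neg (H.loopless.irrefl v), zero_add]
  rw [dsum, Fin.sum_univ_succAbove _ v, dsum]
  simp only [ndeg_del H v]
  rw [Finset.sum_add_distrib, ← h1]
  ring

lemma exists_min_degree (H : SimpleGraph (Fin (k + 1))) :
    ∃ v, (∀ w, ndeg H v ≤ ndeg H w) ∧ (k + 1) * ndeg H v ≤ dsum H := by
  obtain ⟨v, hv⟩ := Finite.exists_min (ndeg H)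
  refine ⟨v, hv, ?_⟩
  rw [dsum]
  calc (k + 1) * ndeg H v = ∑ _w : Fin (k + 1), ndeg H v := by simp
    _ ≤ _ := Finset.sum_le_sum fun w _ => hv w

/-- Outside a closed set with `c` vertices, all degrees are small. -/
lemma exists_small_degree {n c : ℕ} {H : SimpleGraph (Fin n)} (h : NP (c + 1) H) (h' : ¬ NP c H)
    (hcn : c + 1 < n) : ∃ v, ndeg H v + c + 1 ≤ n := by
  unfold NP at h'
  push Not at h'
  obtain ⟨x, y, z, h1, h2, h3, h4⟩ := h'
  obtain ⟨A, hA, hx, hy, hz, hc⟩ := h x y z h1 h2 h3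
  have hcard : A.ncard = c + 1 := by
    have := h4 A hA hx hy hz
    omega
  have hne : A ≠ Set.univ := by
    rintro rfl
    rw [Set.ncard_univ, Nat.card_fin] at hcard
    omega
  obtain ⟨v, hv⟩ := (Set.ne_univ_iff_exists_notMem A).1 hne
  refine ⟨v, ?_⟩
  -- Two neighbours in the closed set would force `v` into it.
  have hin : (H.neighborSet v ∩ A).ncard ≤ 1 := by
    rw [Set.ncard_le_one]
    intro a ha b hb
    by_contra hab
    exact hv (hA v a b ha.2 hb.2 hab ha.1 hb.1)
  have hout : (H.neighborSet v \ A).ncard + 1 ≤ (Aᶜ).ncard := by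
    have : (H.neighborSet v \ A).ncard < (Aᶜ).ncard := by
      refine Set.ncard_lt_ncard ⟨fun w hw => hw.2, fun hsub => ?_⟩ (Set.toFinite _)
      exact H.loopless.irrefl v (hsub hv).1
    exact this
  have hcompl := Set.ncard_add_ncard_compl A
  rw [Nat.card_fin] at hcompl
  have hsplit := Set.ncard_inter_add_ncard_sdiff_eq_ncard (H.neighborSet v) A
  rw [ndeg]
  omega

/-- The classes are closed under the deletion of a vertex of minimal degree. -/
theorem Cls.del {H : SimpleGraph (Fin (k + 1))} (hk : k < 9) (h : Cls (k + 1) H) :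
    ∃ v, (∀ w, ndeg H v ≤ ndeg H w) ∧ Cls k (del H v) := by
  classical
  obtain ⟨v, hv, hmin⟩ := exists_min_degree H
  obtain ⟨h5, ht, hE⟩ := h
  have hs := dsum_del H v
  have hv5 := h5 v
  have hNP : ∀ c, NP c H → NP c (TrappingSets.del H v) := fun c h => h.of_embedding (delEmb H v)
  have hd : ∀ i, ndeg (TrappingSets.del H v) i ≤ 5 := fun i => by
    have := ndeg_del H v i
    have := h5 (v.succAbove i)
    omega
  refine ⟨v, hv, hd, ?_, ?_⟩
  -- The minimal degree d is at most the average D / (k + 1), and deletion lowers D by 2d. The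
  -- values of `thr` from 36 = 45 - 9 downwards are compatible with this loss.
  · clear hE hNP hd hv h5
    generalize ndeg H v = d at *
    generalize dsum H = D at *
    generalize dsum (TrappingSets.del H v) = D' at *
    clear H v
    have : D' + 2 * d = D := hs.symm
    interval_cases k <;> simp only [thr] at ht ⊢ <;> interval_cases d <;> omega
  · interval_cases k
    all_goals try trivial
    · obtain ⟨h7, h6 | h6⟩ := hE
      · exact .inl (hNP 6 h6)
      · by_cases h6' : NP 6 H
        · exact .inl (hNP 6 h6')
        -- A closed set of seven of the eight vertices leaves a vertex of degree at most one, so the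
        -- deletion keeps a degree sum of at least 32 - 2 = 30.
        · obtain ⟨w, hw⟩ := exists_small_degree h7 h6' (by norm_num)
          have := hv w
          exact .inr (by omega)
    · obtain ⟨h7, h2⟩ := hE
      refine ⟨hNP 7 h7, ?_⟩
      by_cases h6' : NP 6 H
      · exact .inl (hNP 6 h6')
      -- Outside a closed set of seven of the nine vertices all degrees are at most two, so the
      -- deletion keeps a degree sum of at least 36 - 4 = 32.
      · obtain ⟨w, hw⟩ := exists_small_degree h7 h6' (by norm_num)
        have := hv w
        simp only [thr] at ht
        exact .inr (by omega)

end Classes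

end TrappingSets

namespace TrappingSets

/-! ### Adjacency matrices as lists of bit masks -/

section Rows

/-- Bit `i` of `m`, with fast kernel reduction. -/
def tb (m i : ℕ) : Bool := Nat.beq (Nat.land 1 (Nat.shiftRight m i)) 1

lemma tb_eq (m i : ℕ) : tb m i = m.testBit i := by
  have h1 : Nat.land 1 (Nat.shiftRight m i) = (m.testBit i).toNat := by
    change 1 &&& (m >>> i) = _
    rw [Nat.one_and_eq_mod_two, Nat.testBit_eq_decide_div_mod_eq, Nat.shiftRight_eq_div_pow]
    rcases Nat.mod_two_eq_zero_or_one (m / 2 ^ i) with h | h <;> simp [h]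
  rw [tb, h1]
  cases m.testBit i <;> rfl

/-- The row `i` of a list of rows. -/
noncomputable def rget (rows : List ℕ) (i : ℕ) : ℕ := nthP 0 rows i

lemma rget_cons_succ (r : ℕ) (rows : List ℕ) (i : ℕ) : rget (r :: rows) (i + 1) = rget rows i := rfl

lemma rget_of_le {rows : List ℕ} {i : ℕ} (h : rows.length ≤ i) : rget rows i = 0 := by
  induction rows generalizing i with
  | nil => rfl
  | cons r rows ih =>
    rcases i with _ | i
    · simp at h
    · exact ih (by simpa using h)

/-- The rows of an adjacency matrix with `k` vertices. -/
def Valid (k : ℕ) (rows : List ℕ) : Prop :=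
  rows.length = k ∧ ∀ i j, (rget rows i).testBit j = true →
    i < k ∧ j < k ∧ i ≠ j ∧ (rget rows j).testBit i = true

/-- The graph with the given rows. -/
def rg (k : ℕ) (rows : List ℕ) : SimpleGraph (Fin k) where
  Adj i j := i ≠ j ∧ ((rget rows i).testBit j = true ∨ (rget rows j).testBit i = true)
  symm := ⟨fun _ _ h => ⟨h.1.symm, h.2.symm⟩⟩
  loopless := ⟨fun _ h => h.1 rfl⟩

variable {k : ℕ} {rows : List ℕ}

lemma rg_adj (h : Valid k rows) {i j : Fin k} :
    (rg k rows).Adj i j ↔ (rget rows i).testBit j = true := by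
  constructor
  · rintro ⟨-, h' | h'⟩
    · exact h'
    · exact (h.2 _ _ h').2.2.2
  · exact fun h' => ⟨fun e => (h.2 _ _ h').2.2.1 (congrArg Fin.val e), .inl h'⟩

/-- Addition of a vertex with the neighbours in `M`. -/
noncomputable def extR (k : ℕ) (rows : List ℕ) (M : ℕ) : List ℕ :=
  List.rec (motive := fun _ => ℕ → List ℕ) (fun _ => [M])
    (fun r _ ih m => Nat.lor r (Nat.shiftLeft (Nat.land m 1) k) :: ih (Nat.shiftRight m 1)) rows M

lemma extR_spec (k : ℕ) (rows : List ℕ) (M : ℕ) :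
    (extR k rows M).length = rows.length + 1 ∧ rget (extR k rows M) rows.length = M ∧
      ∀ i < rows.length,
        rget (extR k rows M) i = rget rows i ||| ((M.testBit i).toNat <<< k) := by
  have key : ∀ (rows : List ℕ) (m : ℕ),
      let l := (List.rec (motive := fun _ => ℕ → List ℕ) (fun _ => [M])
        (fun r _ ih m => Nat.lor r (Nat.shiftLeft (Nat.land m 1) k) :: ih (Nat.shiftRight m 1))
          rows m : List ℕ)
      l.length = rows.length + 1 ∧ rget l rows.length = M ∧
        ∀ i < rows.length, rget l i = rget rows i ||| ((m.testBit i).toNat <<< k) := by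
    intro rows
    induction rows with
    | nil => exact fun m => ⟨rfl, rfl, fun i hi => absurd hi (by simp)⟩
    | cons r rows ih =>
      intro m
      obtain ⟨h1, h2, h3⟩ := ih (m >>> 1)
      refine ⟨congrArg (· + 1) h1, h2, fun i hi => ?_⟩
      rcases i with _ | i
      · change r ||| ((m &&& 1) <<< k) = r ||| _
        rw [Nat.and_one_is_mod, Nat.testBit_zero]
        rcases Nat.mod_two_eq_zero_or_one m with h | h <;> simp [h]
      · refine (h3 i (by simpa using hi)).trans ?_
        rw [Nat.testBit_shiftRight, add_comm 1 i, rget_cons_succ]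
  exact key rows M

lemma testBit_toNat_shiftLeft (b : Bool) (k j : ℕ) :
    (b.toNat <<< k).testBit j = (b && decide (j = k)) := by
  cases b
  · simp
  · simp [Nat.one_shiftLeft, Nat.testBit_two_pow, eq_comm]

lemma testBit_extR (h : rows.length = k) (M i j : ℕ) :
    (rget (extR k rows M) i).testBit j =
      if i < k then ((rget rows i).testBit j || (M.testBit i && decide (j = k)))
      else if i = k then M.testBit j else false := by
  obtain ⟨h1, h2, h3⟩ := extR_spec k rows M
  rw [h] at h1 h2 h3
  split_ifs with hi hi'
  · rw [h3 i hi, Nat.testBit_or, testBit_toNat_shiftLeft]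
  · rw [hi', h2]
  · rw [rget_of_le (by omega), Nat.zero_testBit]

lemma Valid.extR (h : Valid k rows) {M : ℕ} (hM : M < 2 ^ k) : Valid (k + 1) (extR k rows M) := by
  refine ⟨by rw [(extR_spec k rows M).1, h.1], fun i j hij => ?_⟩
  have hMk : ∀ j, M.testBit j = true → j < k := fun j hj => by
    by_contra hk
    rw [Nat.testBit_lt_two_pow (hM.trans_le (Nat.pow_le_pow_right (by norm_num) (by omega)))] at hj
    cases hj
  rw [testBit_extR h.1] at hij ⊢
  split_ifs at hij with hi hi'
  · rcases Bool.or_eq_true_iff.1 hij with h' | h'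
    · obtain ⟨-, h2, h3, h4⟩ := h.2 _ _ h'
      refine ⟨by omega, by omega, h3, ?_⟩
      rw [if_pos h2, h4, Bool.true_or]
    · rw [Bool.and_eq_true, decide_eq_true_iff] at h'
      refine ⟨by omega, by omega, by omega, ?_⟩
      rw [if_neg (by omega), if_pos h'.2, h'.1]
  · have := hMk j hij
    refine ⟨by omega, by omega, by omega, ?_⟩
    rw [if_pos this, hij, hi']
    simp

/-- A graph is determined by the deletion of a vertex and the neighbours of that vertex. -/
lemma exists_extR (h : Valid k rows) {H : SimpleGraph (Fin (k + 1))} {v : Fin (k + 1)}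
    (φ : del H v ≃g rg k rows) :
    ∃ M < 2 ^ k, ∃ ψ : H ≃g rg (k + 1) (extR k rows M), ψ v = Fin.last k := by
  classical
  -- The neighbours of `v`, renumbered by the given isomorphism; `v` becomes the last vertex.
  let M := Nat.ofBits fun i : Fin k => decide (H.Adj v (v.succAbove (φ.symm i)))
  have hM : M < 2 ^ k := Nat.ofBits_lt_two_pow _
  have hbit : ∀ i : Fin k, M.testBit i = decide (H.Adj v (v.succAbove (φ.symm i))) := fun i =>
    Nat.testBit_ofBits_lt _ _ i.2
  let e : Fin (k + 1) ≃ Fin (k + 1) := (finSuccEquiv' v).trans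
    ((Equiv.optionCongr φ.toEquiv).trans (finSuccEquiv' (Fin.last k)).symm)
  have e1 : e v = Fin.last k := by simp [e]
  have e2 : ∀ i, e (v.succAbove i) = (φ i).castSucc := fun i => by simp [e]
  refine ⟨M, hM, ⟨e, ?_⟩, e1⟩
  have hv := h.extR hM
  have hlast : ∀ i, (rg (k + 1) (extR k rows M)).Adj (Fin.last k) (φ i).castSucc ↔
      H.Adj v (v.succAbove i) := fun i => by
    rw [rg_adj hv, testBit_extR h.1, if_neg (by simp), if_pos (by simp)]
    have := hbit (φ i)
    simp only [Fin.val_castSucc, this, decide_eq_true_iff, RelIso.symm_apply_apply]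
  intro a b
  rcases Fin.eq_self_or_eq_succAbove v a with rfl | ⟨i, rfl⟩
  · rcases Fin.eq_self_or_eq_succAbove a b with rfl | ⟨j, rfl⟩
    · simp
    · rw [e1, e2]
      exact hlast j
  · rcases Fin.eq_self_or_eq_succAbove v b with rfl | ⟨j, rfl⟩
    · rw [e1, e2, SimpleGraph.adj_comm, hlast, SimpleGraph.adj_comm]
    · have h1 : (del H v).Adj i j ↔ H.Adj (v.succAbove i) (v.succAbove j) := Iff.rfl
      rw [e2, e2, rg_adj hv, testBit_extR h.1, ← h1, ← φ.map_adj_iff, rg_adj h]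
      have := (φ j).2.ne
      simp [this]

/-- The number of the bits of `m` below `k`. -/
noncomputable def pc (k m : ℕ) : ℕ :=
  Nat.rec (motive := fun _ => ℕ → ℕ) (fun _ => 0)
    (fun _ ih m => Nat.add (Nat.land m 1) (ih (Nat.shiftRight m 1))) k m

lemma pc_succ (k m : ℕ) : pc (k + 1) m = (m.testBit 0).toNat + pc k (m >>> 1) := by
  change (m &&& 1) + pc k (m >>> 1) = _
  rw [Nat.and_one_is_mod, Nat.testBit_zero]
  rcases Nat.mod_two_eq_zero_or_one m with h | h <;> simp [h]

lemma pc_eq (k m : ℕ) : pc k m = ∑ i : Fin k, (m.testBit i).toNat := by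
  induction k generalizing m with
  | zero => rfl
  | succ k ih =>
    rw [pc_succ, ih, Fin.sum_univ_succ]
    simp [Nat.testBit_shiftRight, add_comm]

lemma pc_eq_ncard (k m : ℕ) : pc k m = {i : Fin k | m.testBit i = true}.ncard := by
  classical
  rw [pc_eq, show {i : Fin k | m.testBit i = true} =
    ((Finset.univ.filter fun i : Fin k => m.testBit i = true : Finset (Fin k)) : Set (Fin k)) by
      ext; simp, Set.ncard_coe_finset, Finset.card_filter]
  refine Finset.sum_congr rfl fun i _ => ?_
  cases m.testBit i <;> rfl

lemma ndeg_rg (h : Valid k rows) (v : Fin k) : ndeg (rg k rows) v = pc k (rget rows v) := by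
  rw [pc_eq_ncard, ndeg]
  congr 1
  ext w
  exact rg_adj h

/-- The number `x` has at least two bits. -/
def two (x : ℕ) : Bool := !Nat.beq (Nat.land x (Nat.pred x)) 0

/-- Subtracting one changes no bit above the lowest one bit, so the conjunction with x - 1 clears
exactly that bit and is zero for at most one bit. -/
lemma two_iff (x : ℕ) :
    two x = true ↔ ∃ u w, u ≠ w ∧ x.testBit u = true ∧ x.testBit w = true := by
  have h0 : two x = true ↔ x &&& (x - 1) ≠ 0 := by
    rw [two, Bool.not_eq_true', ← Bool.not_eq_true, Nat.beq_eq]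
    rfl
  rw [h0]
  constructor
  · intro h
    by_contra hne
    push Not at hne
    rcases Nat.eq_zero_or_pos x with rfl | hx
    · simp at h
    obtain ⟨u, hu⟩ := Nat.exists_testBit_of_ne_zero hx.ne'
    have : x = 2 ^ u := Nat.eq_of_testBit_eq fun w => by
      rw [Nat.testBit_two_pow]
      rcases eq_or_ne u w with rfl | huw
      · simpa using hu
      · simpa [huw] using hne u w huw hu
    rw [this, Nat.and_two_pow_sub_one_eq_mod, Nat.mod_self] at h
    exact h rfl
  · rintro ⟨u, w, huw, hu, hw⟩ h
    have key : ∀ u w, u < w → x.testBit u = true → x.testBit w = true → False := by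
      intro u w huw hu hw
      have h1 : 2 ^ u ≤ x % 2 ^ w := by
        have : (x % 2 ^ w).testBit u = true := by
          rw [Nat.testBit_mod_two_pow]
          simp [huw, hu]
        exact Nat.ge_two_pow_of_testBit this
      have h2 : (x - 1) / 2 ^ w = x / 2 ^ w := by
        have e := Nat.div_add_mod x (2 ^ w)
        have hlt := Nat.mod_lt x (y := 2 ^ w) (by positivity)
        have hpos : 0 < 2 ^ u := by positivity
        have e2 : x - 1 = (x % 2 ^ w - 1) + 2 ^ w * (x / 2 ^ w) := by omega
        rw [e2, Nat.add_mul_div_left _ _ (by positivity), Nat.div_eq_of_lt (by omega), zero_add]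
      have h3 : (x - 1).testBit w = true := by
        rw [← hw, Nat.testBit_eq_decide_div_mod_eq, Nat.testBit_eq_decide_div_mod_eq, h2]
      have h4 : (x &&& (x - 1)).testBit w = true := by rw [Nat.testBit_and, hw, h3]; rfl
      rw [h, Nat.zero_testBit] at h4
      cases h4
    rcases Nat.lt_or_gt_of_ne huw with h' | h'
    · exact key u w h' hu hw
    · exact key w u h' hw hu

end Rows

end TrappingSets

namespace TrappingSets

/-! ### List operations built from recursors -/

section Combinators

/-- `List.all`, with fast kernel reduction. -/
noncomputable def allL {α : Type} (p : α → Bool) (l : List α) : Bool :=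
  List.rec (motive := fun _ => Bool) true (fun a _ ih => bif p a then ih else false) l

/-- All elements and the lists after them satisfy `p`. -/
noncomputable def allTails {α : Type} (p : α → List α → Bool) (l : List α) : Bool :=
  List.rec (motive := fun _ => Bool) true (fun a t ih => bif p a t then ih else false) l

/-- `List.append`, with fast kernel reduction. -/
noncomputable def appL {α : Type} (l l' : List α) : List α :=
  List.rec (motive := fun _ => List α) l' (fun a _ ih => a :: ih) l

/-- `List.filter`, with fast kernel reduction. -/
noncomputable def filterL {α : Type} (p : α → Bool) (l : List α) : List α :=
  List.rec (motive := fun _ => List α) [] (fun a _ ih => bif p a then a :: ih else ih) l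

/-- `List.flatMap`, with fast kernel reduction. -/
noncomputable def flatL {α β : Type} (f : α → List β) (l : List α) : List β :=
  List.rec (motive := fun _ => List β) [] (fun a _ ih => appL (f a) ih) l

/-- Two lists have the same length, and corresponding elements satisfy `p`. -/
noncomputable def allZip {α β : Type} (p : α → β → Bool) (l : List α) : List β → Bool :=
  List.rec (motive := fun _ => List β → Bool)
    (fun l' => List.rec (motive := fun _ => Bool) true (fun _ _ _ => false) l')
    (fun a _ ih l' => List.rec (motive := fun _ => Bool) false
      (fun b t _ => bif p a b then ih t else false) l') l

variable {α β : Type}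

lemma cond_false_right (a b : Bool) : (bif a then b else false) = true ↔ a = true ∧ b = true := by
  cases a <;> simp

lemma allL_iff (p : α → Bool) (l : List α) : allL p l = true ↔ ∀ a ∈ l, p a = true := by
  induction l with
  | nil => simp [allL]
  | cons a l ih =>
    change (bif p a then allL p l else false) = true ↔ _
    rw [cond_false_right, ih, List.forall_mem_cons]

lemma allTails_iff (p : α → List α → Bool) (l : List α) :
    allTails p l = true ↔ ∀ l₁ a t, l = l₁ ++ a :: t → p a t = true := by
  induction l with
  | nil => simp [allTails]
  | cons a l ih =>
    change (bif p a l then allTails p l else false) = true ↔ _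
    rw [cond_false_right, ih]
    constructor
    · rintro ⟨h1, h2⟩ l₁ b t e
      rcases l₁ with _ | ⟨c, l₁⟩
      · obtain ⟨rfl, rfl⟩ := List.cons.inj e
        exact h1
      · exact h2 l₁ b t (List.cons.inj e).2
    · exact fun h => ⟨h [] a l rfl, fun l₁ b t e => h (a :: l₁) b t (by rw [e]; rfl)⟩

lemma allTails_of_mem {p : α → List α → Bool} {l : List α}
    (h : ∀ a ∈ l, ∀ t, (∀ b ∈ t, b ∈ l) → p a t = true) : allTails p l = true := by
  rw [allTails_iff]
  rintro l₁ a t rfl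
  exact h a (by simp) t fun b hb => by simp [hb]

lemma appL_eq (l l' : List α) : appL l l' = l ++ l' := by
  induction l with
  | nil => rfl
  | cons a l ih => exact congrArg (a :: ·) ih

lemma filterL_eq (p : α → Bool) (l : List α) : filterL p l = l.filter p := by
  induction l with
  | nil => rfl
  | cons a l ih =>
    change (bif p a then a :: filterL p l else filterL p l) = _
    rw [ih, List.filter_cons]
    cases p a <;> rfl

lemma flatL_eq (f : α → List β) (l : List α) : flatL f l = l.flatMap f := by
  induction l with
  | nil => rfl
  | cons a l ih => exact (appL_eq _ _).trans (by rw [List.flatMap_cons, ← ih]; rfl)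

lemma mapL_eq (f : α → β) (l : List α) : mapL f l = l.map f := by
  induction l with
  | nil => rfl
  | cons a l ih => exact congrArg (f a :: ·) ih

lemma exists_of_allZip {p : α → β → Bool} {l : List α} {l' : List β} (h : allZip p l l' = true)
    {a : α} (ha : a ∈ l) : ∃ b, p a b = true := by
  induction l generalizing l' with
  | nil => simp at ha
  | cons c l ih =>
    rcases l' with _ | ⟨d, l'⟩
    · cases h
    · have h' : (bif p c d then allZip p l l' else false) = true := h
      rw [cond_false_right] at h'
      rcases List.mem_cons.1 ha with rfl | ha
      · exact ⟨d, h'.1⟩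
      · exact ih h'.2 ha

lemma nthP_eq (z : α) (l : List α) (i : ℕ) : nthP z l i = l.getD i z := by
  induction l generalizing i with
  | nil => simp [nthP]
  | cons a l ih =>
    rcases i with _ | i
    · rfl
    · exact (ih i).trans (by simp)

end Combinators

/-! ### Closure of a vertex set by repeated passes -/

section Closure

/-- One pass of the closure of the set `S`, where `p` is the bit of the first row. A vertex is added
if the set of its neighbours in `S` satisfies `q`. -/
noncomputable def passAux (q : ℕ → Bool) (rows : List ℕ) : ℕ → ℕ → ℕ :=
  List.rec (motive := fun _ => ℕ → ℕ → ℕ) (fun _ S => S)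
    (fun r _ ih p S => bif q (Nat.land r S) then force (ih (Nat.mul 2 p)) (Nat.lor S p)
      else ih (Nat.mul 2 p) S) rows

/-- One pass of the closure of the set `S`. -/
noncomputable def passN (q : ℕ → Bool) (rows : List ℕ) (S : ℕ) : ℕ := passAux q rows 1 S

/-- The closure of the set `S`. -/
noncomputable def closN (q : ℕ → Bool) (k : ℕ) (rows : List ℕ) (S : ℕ) : ℕ :=
  Nat.rec (motive := fun _ => ℕ → ℕ) (fun S => S)
    (fun _ ih S => force (fun S' => bif Nat.beq S' S then S else ih S') (passN q rows S)) k S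

variable {q : ℕ → Bool}

lemma passAux_cons (r : ℕ) (l : List ℕ) (off S : ℕ) : passAux q (r :: l) (2 ^ off) S =
    bif q (r &&& S) then passAux q l (2 ^ (off + 1)) (S ||| 2 ^ off)
      else passAux q l (2 ^ (off + 1)) S := by
  rw [pow_succ' 2 off]
  change (bif q (r &&& S) then force (passAux q l (2 * 2 ^ off)) (S ||| 2 ^ off) else _) = _
  rw [force_eq]
  rfl

/-- The induction principle for a pass: it suffices that a property survives the addition of one
admissible vertex. -/
lemma passAux_invariant (Q : ℕ → Prop) (l : List ℕ) (off : ℕ)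
    (h : ∀ i < l.length, ∀ S, Q S → q (rget l i &&& S) = true → Q (S ||| 2 ^ (off + i))) (S : ℕ)
    (hS : Q S) : Q (passAux q l (2 ^ off) S) := by
  induction l generalizing off S with
  | nil => exact hS
  | cons r l ih =>
    have h' : ∀ i < l.length, ∀ S, Q S → q (rget l i &&& S) = true →
        Q (S ||| 2 ^ (off + 1 + i)) := fun i hi S hS ht => by
      have := h (i + 1) (by simpa using hi) S hS ht
      rwa [show off + (i + 1) = off + 1 + i by ring] at this
    rw [passAux_cons]
    rcases ht : q (r &&& S) with _ | _
    · exact ih (off + 1) h' S hS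
    · exact ih (off + 1) h' _ (h 0 (by simp) S hS ht)

lemma passN_invariant (Q : ℕ → Prop) (rows : List ℕ)
    (h : ∀ i < rows.length, ∀ S, Q S → q (rget rows i &&& S) = true → Q (S ||| 2 ^ i)) (S : ℕ)
    (hS : Q S) : Q (passN q rows S) :=
  passAux_invariant Q rows 0 (by simpa using h) S hS

lemma le_passAux (l : List ℕ) (off S i : ℕ) (h : S.testBit i = true) :
    (passAux q l (2 ^ off) S).testBit i = true :=
  passAux_invariant (fun T => T.testBit i = true) l off
    (fun j _ T hT _ => by rw [Nat.testBit_or, hT]; rfl) S h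

lemma le_passN (rows : List ℕ) (S i : ℕ) (h : S.testBit i = true) :
    (passN q rows S).testBit i = true := le_passAux rows 0 S i h

/-- The predicate `q` is monotone. -/
def MonoBits (q : ℕ → Bool) : Prop := ∀ r S T : ℕ,
  (∀ i, S.testBit i = true → T.testBit i = true) → q (r &&& S) = true → q (r &&& T) = true

lemma monoBits_two : MonoBits two := by
  intro r S T h h2
  rw [two_iff] at h2 ⊢
  obtain ⟨u, w, huw, hu, hw⟩ := h2
  rw [Nat.testBit_and, Bool.and_eq_true] at hu hw
  exact ⟨u, w, huw, by rw [Nat.testBit_and, hu.1, h u hu.2]; rfl,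
    by rw [Nat.testBit_and, hw.1, h w hw.2]; rfl⟩

/-- Vertices are added during the pass, so the row is tested against a set that may have grown;
monotonicity of `q` keeps the test true. -/
lemma passAux_step (hq : MonoBits q) (l : List ℕ) (off S i : ℕ) (hi : i < l.length)
    (h : q (rget l i &&& S) = true) : (passAux q l (2 ^ off) S).testBit (off + i) = true := by
  induction l generalizing off S i with
  | nil => exact absurd hi (by simp)
  | cons r l ih =>
    rw [passAux_cons]
    rcases i with _ | i
    · have ht : q (r &&& S) = true := h
      rw [ht]
      refine le_passAux l (off + 1) _ off ?_
      rw [Nat.testBit_or, Nat.testBit_two_pow_self, Bool.or_true]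
    · have hs : off + (i + 1) = off + 1 + i := by ring
      rw [hs]
      rcases ht : q (r &&& S) with _ | _
      · exact ih (off + 1) S i (by simpa using hi) h
      · refine ih (off + 1) (S ||| 2 ^ off) i (by simpa using hi) (hq _ _ _ ?_ h)
        intro j hj
        rw [Nat.testBit_or, hj]
        rfl

lemma passN_step (hq : MonoBits q) (rows : List ℕ) (S i : ℕ) (hi : i < rows.length)
    (h : q (rget rows i &&& S) = true) : (passN q rows S).testBit i = true := by
  have := passAux_step hq rows 0 S i hi h
  rwa [zero_add] at this

variable {k : ℕ} {rows : List ℕ}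

/-- The set of vertices given by the bits of `S`. -/
def bits (k S : ℕ) : Set (Fin k) := {i | S.testBit i = true}

/-- The set `A` is closed. -/
def ClosedFor (q : ℕ → Bool) (k : ℕ) (rows : List ℕ) (A : Set (Fin k)) : Prop :=
  ∀ v : Fin k, ∀ S, bits k S ⊆ A → q (rget rows v &&& S) = true → v ∈ A

lemma bits_passN {S : ℕ} {A : Set (Fin k)} (hA : ClosedFor q k rows A)
    (hS : bits k S ⊆ A) : bits k (passN q rows S) ⊆ A := by
  refine passN_invariant (fun S => bits k S ⊆ A) rows ?_ S hS
  intro i hi S hS h2 j hj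
  have hj' : (S ||| 2 ^ i).testBit j = true := hj
  rw [Nat.testBit_or, Nat.testBit_two_pow, Bool.or_eq_true, decide_eq_true_iff] at hj'
  rcases hj' with hj' | rfl
  · exact hS hj'
  · exact hA j S hS h2

lemma closN_succ (k : ℕ) (rows : List ℕ) (S : ℕ) : closN q (k + 1) rows S =
    bif Nat.beq (passN q rows S) S then S else closN q k rows (passN q rows S) :=
  force_eq (fun S' => bif Nat.beq S' S then S else closN q k rows S') (passN q rows S)

lemma bits_closN {S : ℕ} {A : Set (Fin k)} (hA : ClosedFor q k rows A)
    (hS : bits k S ⊆ A) (m : ℕ) : bits k (closN q m rows S) ⊆ A := by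
  induction m generalizing S with
  | zero => exact hS
  | succ m ih =>
    rw [closN_succ]
    rcases Nat.beq (passN q rows S) S with _ | _
    · exact ih (bits_passN hA hS)
    · exact hS

lemma le_closN (rows : List ℕ) (m S i : ℕ) (h : S.testBit i = true) :
    (closN q m rows S).testBit i = true := by
  induction m generalizing S with
  | zero => exact h
  | succ m ih =>
    rw [closN_succ]
    rcases Nat.beq (passN q rows S) S with _ | _
    · exact ih _ (le_passN rows S i h)
    · exact h

/-- Bits from `k` on are never touched, so any change adds a bit below `k`. Hence `k` passes suffice
for stability. -/
lemma pc_lt_of_passN_ne (h : rows.length = k) {S : ℕ} (hS : passN q rows S ≠ S) :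
    pc k S < pc k (passN q rows S) := by
  rw [pc_eq_ncard, pc_eq_ncard]
  refine Set.ncard_lt_ncard ⟨fun i hi => le_passN rows S i hi, fun hsub => hS ?_⟩ (Set.toFinite _)
  refine Nat.eq_of_testBit_eq fun i => ?_
  by_cases hi : i < k
  · rw [Bool.eq_iff_iff]
    exact ⟨fun h' => hsub (a := ⟨i, hi⟩) h', fun h' => le_passN rows S i h'⟩
  · refine passN_invariant (fun T => T.testBit i = S.testBit i) rows (fun j hj T hT _ => ?_) S rfl
    rw [Nat.testBit_or, hT, Nat.testBit_two_pow_of_ne (by omega), Bool.or_false]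

/-- The result of the closure is closed under one more step. -/
lemma closN_stable (hq : MonoBits q) (h : rows.length = k) (m S : ℕ) (hm : k ≤ pc k S + m)
    (v : Fin k) (hv : q (rget rows v &&& closN q m rows S) = true) :
    v ∈ bits k (closN q m rows S) := by
  induction m generalizing S with
  | zero =>
    -- With no pass left, the bound `hm` says that the set is already everything.
    have hcard : {i : Fin k | S.testBit i = true} = Set.univ := by
      refine Set.eq_of_subset_of_ncard_le (Set.subset_univ _) ?_ (Set.toFinite _)
      rw [Set.ncard_univ, Nat.card_fin, ← pc_eq_ncard]
      exact hm
    have : v ∈ {i : Fin k | S.testBit i = true} := by rw [hcard]; trivial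
    exact this
  | succ m ih =>
    rw [closN_succ] at hv ⊢
    rcases hb : Nat.beq (passN q rows S) S with _ | _
    · rw [hb] at hv
      refine ih _ ?_ hv
      have := pc_lt_of_passN_ne (q := q) h (S := S) fun e => by
        rw [e, Nat.beq_refl] at hb
        cases hb
      omega
    · rw [hb] at hv
      have := passN_step hq rows S v (by rw [h]; exact v.2) hv
      rwa [Nat.eq_of_beq_eq_true hb] at this

lemma closedFor_two (h : Valid k rows) {A : Set (Fin k)} (hA : TwoClosed (rg k rows) A) :
    ClosedFor two k rows A := by
  intro v S hS h2
  obtain ⟨u, w, huw, hu, hw⟩ := (two_iff _).1 h2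
  rw [Nat.testBit_and, Bool.and_eq_true] at hu hw
  have hu' := (h.2 _ _ hu.1).2.1
  have hw' := (h.2 _ _ hw.1).2.1
  exact hA v ⟨u, hu'⟩ ⟨w, hw'⟩ (hS hu.2) (hS hw.2) (fun e => huw (congrArg Fin.val e))
    ((rg_adj h).2 hu.1) ((rg_adj h).2 hw.1)

end Closure

/-! ### Testing the closures of all triangles -/

section Triangles

/-- The rows with their indices, beginning with the given index. -/
noncomputable def idxAux (rows : List ℕ) : ℕ → List (ℕ × ℕ) :=
  List.rec (motive := fun _ => ℕ → List (ℕ × ℕ)) (fun _ => [])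
    (fun r _ ih i => (i, r) :: ih (Nat.succ i)) rows

/-- The rows with their indices. -/
noncomputable def idxL (rows : List ℕ) : List (ℕ × ℕ) := idxAux rows 0

lemma mem_idxAux (l : List ℕ) (i : ℕ) (x : ℕ × ℕ) (hx : x ∈ idxAux l i) :
    ∃ j, x = (i + j, rget l j) := by
  induction l generalizing i with
  | nil => exact absurd hx (by simp [idxAux])
  | cons r l ih =>
    rcases List.mem_cons.1 hx with rfl | hx
    · exact ⟨0, rfl⟩
    · obtain ⟨j, rfl⟩ := ih _ hx
      exact ⟨j + 1, by rw [rget_cons_succ, Nat.succ_eq_add_one, add_assoc, add_comm 1 j]⟩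

lemma mem_idxL {rows : List ℕ} {x : ℕ × ℕ} (hx : x ∈ idxL rows) : x.2 = rget rows x.1 := by
  obtain ⟨j, rfl⟩ := mem_idxAux rows 0 x hx
  simp

/-- The closures of the triangles have at most `c` vertices. -/
noncomputable def npN (c k : ℕ) (rows : List ℕ) : Bool :=
  allTails (fun a => allTails fun b t => bif tb a.2 b.1 then allL (fun x =>
    bif tb a.2 x.1 then bif tb b.2 x.1 then
      Nat.ble (pc k (closN two k rows (Nat.lor (Nat.shiftLeft 1 a.1)
        (Nat.lor (Nat.shiftLeft 1 b.1) (Nat.shiftLeft 1 x.1))))) c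
      else true else true) t else true) (idxL rows)

variable {k : ℕ} {rows : List ℕ}

/-- The computed closure lies in every two-closed set that contains the triangle. Only this
direction matters: the test prunes candidates and must never reject a member of a class. -/
lemma npN_of_np (h : Valid k rows) {c : ℕ} (hNP : NP c (rg k rows)) : npN c k rows = true := by
  refine allTails_of_mem fun a ha t ht => allTails_of_mem fun b hb t' ht' => ?_
  rcases h1 : tb a.2 b.1 with _ | _
  · rfl
  refine (allL_iff _ _).2 fun x hx => ?_
  rcases h2 : tb a.2 x.1 with _ | _
  · rfl
  rcases h3 : tb b.2 x.1 with _ | _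
  · rfl
  rw [tb_eq, mem_idxL ha] at h1 h2
  rw [tb_eq, mem_idxL (ht b hb)] at h3
  obtain ⟨ha', hb', -⟩ := h.2 _ _ h1
  have hx' := (h.2 _ _ h2).2.1
  obtain ⟨A, hA, h4, h5, h6, hc⟩ := hNP ⟨a.1, ha'⟩ ⟨b.1, hb'⟩ ⟨x.1, hx'⟩ ((rg_adj h).2 h1)
    ((rg_adj h).2 h2) ((rg_adj h).2 h3)
  refine Nat.ble_eq_true_of_le ((pc_eq_ncard _ _).trans_le (le_trans ?_ hc))
  refine Set.ncard_le_ncard (bits_closN (closedFor_two h hA) ?_ k) (Set.toFinite _)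
  intro i hi
  change ((1 <<< a.1) ||| ((1 <<< b.1) ||| (1 <<< x.1))).testBit i = true at hi
  simp only [Nat.one_shiftLeft, Nat.testBit_or, Nat.testBit_two_pow, Bool.or_eq_true,
    decide_eq_true_iff] at hi
  rcases hi with e | e | e
  · rwa [show i = ⟨a.1, ha'⟩ from Fin.ext e.symm]
  · rwa [show i = ⟨b.1, hb'⟩ from Fin.ext e.symm]
  · rwa [show i = ⟨x.1, hx'⟩ from Fin.ext e.symm]

end Triangles

end TrappingSets

namespace TrappingSets

/-! ### Generating all extensions by a vertex of minimal degree -/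

section Extensions

/-- The sets of `r` new neighbours with which all degrees are at least `d` and at most `5`. -/
noncomputable def genN (d : ℕ) (degs : List ℕ) : ℕ → List ℕ :=
  List.rec (motive := fun _ => ℕ → List ℕ) (fun r => bif Nat.beq r 0 then [0] else [])
    (fun x _ ih r => appL
      (bif Nat.blt x 5 then bif Nat.ble d (Nat.succ x) then bif Nat.beq r 0 then [] else
        mapL (fun M => Nat.succ (Nat.mul 2 M)) (ih (Nat.pred r)) else [] else [])
      (bif Nat.ble d x then mapL (Nat.mul 2) (ih r) else [])) degs

/-- The conditions say that after adding the new vertex every old degree lies between `d` and 5; the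
list is processed together with the bits of the mask, lowest first. -/
lemma mem_genN {d : ℕ} (degs : List ℕ) (M r : ℕ) (hM : M < 2 ^ degs.length)
    (h1 : ∀ i < degs.length, M.testBit i = true → degs.getD i 0 < 5 ∧ d ≤ degs.getD i 0 + 1)
    (h2 : ∀ i < degs.length, M.testBit i = false → d ≤ degs.getD i 0)
    (h3 : pc degs.length M = r) : M ∈ genN d degs r := by
  induction degs generalizing M r with
  | nil =>
    have hr : r = 0 := h3.symm
    have hM0 : M = 0 := by simpa using hM
    rw [hr, hM0]
    exact List.mem_singleton.2 rfl
  | cons x degs ih =>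
    have hb : ∀ i, (M >>> 1).testBit i = M.testBit (i + 1) := fun i => by
      rw [Nat.testBit_shiftRight, add_comm]
    have hM' : M >>> 1 < 2 ^ degs.length := by
      rw [List.length_cons, pow_succ] at hM
      rw [Nat.shiftRight_eq_div_pow]
      omega
    have ih' := ih (M >>> 1) (pc degs.length (M >>> 1)) hM'
      (fun i hi hbit => h1 (i + 1) (by simpa using hi) (by rw [← hb, hbit]))
      (fun i hi hbit => h2 (i + 1) (by simpa using hi) (by rw [← hb, hbit])) rfl
    rw [List.length_cons, pc_succ] at h3
    have h10 := h1 0 (by simp)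
    have h20 := h2 0 (by simp)
    rw [Nat.testBit_zero] at h10 h20 h3
    change M ∈ appL _ _
    rw [appL_eq, List.mem_append]
    have hdiv : M >>> 1 = M / 2 := by rw [Nat.shiftRight_eq_div_pow, pow_one]
    rcases Nat.mod_two_eq_zero_or_one M with hm | hm
    · right
      have hd : Nat.ble d x = true := Nat.ble_eq_true_of_le (h20 (by simp [hm]))
      rw [hd, cond_true, mapL_eq, List.mem_map]
      refine ⟨M >>> 1, ?_, ?_⟩
      · simp only [hm] at h3
        have : pc degs.length (M >>> 1) = r := by simpa using h3
        rwa [this] at ih'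
      · change 2 * (M >>> 1) = M
        omega
    · left
      obtain ⟨hx, hd⟩ := h10 (by simp [hm])
      have e1 : Nat.blt x 5 = true := Nat.ble_eq_true_of_le hx
      have e2 : Nat.ble d (Nat.succ x) = true := Nat.ble_eq_true_of_le hd
      have hr : r = pc degs.length (M >>> 1) + 1 := by simp [hm] at h3; omega
      rw [e1, e2, hr]
      simp only [cond_true]
      rw [show Nat.beq (pc degs.length (M >>> 1) + 1) 0 = false from rfl, cond_false, mapL_eq,
        List.mem_map]
      refine ⟨M >>> 1, ih', ?_⟩
      change 2 * (M >>> 1) + 1 = M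
      omega

/-- The additional conditions of the classes. -/
noncomputable def okN (k D : ℕ) (rows : List ℕ) : Bool :=
  bif Nat.beq k 7 then bif Nat.ble 30 D then true else npN 6 7 rows
  else bif Nat.beq k 8 then bif npN 7 8 rows then bif Nat.ble 32 D then true else npN 6 8 rows
    else false
  else bif Nat.beq k 9 then npN 7 9 rows else true

lemma okN_of_extra {k : ℕ} {rows : List ℕ} (h : Valid k rows) (hE : Extra k (rg k rows)) :
    okN k (dsum (rg k rows)) rows = true := by
  have key : ∀ c, NP c (rg k rows) → npN c k rows = true := fun c => npN_of_np h
  by_cases h7 : k = 7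
  · subst h7
    change (bif Nat.ble 30 _ then true else _) = true
    rcases hE with hE | hE
    · rw [key 6 hE]
      cases Nat.ble 30 (dsum (rg 7 rows)) <;> rfl
    · rw [Nat.ble_eq_true_of_le hE]; rfl
  by_cases h8 : k = 8
  · subst h8
    change (bif npN 7 8 rows then bif Nat.ble 32 _ then true else _ else false) = true
    rw [key 7 hE.1]
    rcases hE.2 with hE | hE
    · rw [key 6 hE]
      cases Nat.ble 32 (dsum (rg 8 rows)) <;> rfl
    · rw [Nat.ble_eq_true_of_le hE]; rfl
  by_cases h9 : k = 9
  · subst h9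
    exact key 7 hE.1
  have hf : ∀ m, k ≠ m → Nat.beq k m = false := fun m hm => by
    rw [← Bool.not_eq_true, Nat.beq_eq]
    exact hm
  rw [okN, hf 7 h7, hf 8 h8, hf 9 h9]
  rfl

/-- The sum of a list, with fast kernel reduction. -/
noncomputable def sumL (l : List ℕ) : ℕ :=
  List.rec (motive := fun _ => ℕ) 0 (fun a _ ih => Nat.add a ih) l

lemma sumL_eq (l : List ℕ) : sumL l = l.sum := by
  induction l with
  | nil => rfl
  | cons a l ih =>
    rw [List.sum_cons, ← ih]
    rfl

/-- Evaluation of all entries of a list before the application of `f`. -/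
noncomputable def forceL {α : Type} (l : List ℕ) : (List ℕ → α) → α :=
  List.rec (motive := fun _ => (List ℕ → α) → α) (fun f => f [])
    (fun a _ ih f => force (fun a => ih fun l => f (a :: l)) a) l

lemma forceL_eq {α : Type} (l : List ℕ) (f : List ℕ → α) : forceL l f = f l := by
  induction l generalizing f with
  | nil => rfl
  | cons a l ih =>
    change force (fun a => forceL l fun l => f (a :: l)) a = _
    rw [force_eq, ih]

/-- The extensions by a vertex of minimal degree `d`. -/
noncomputable def extsN (k : ℕ) (rows degs : List ℕ) (D d : ℕ) : List (List ℕ) :=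
  -- The bound 2 on `d` for k = 8 is the minimum degree demanded of the graphs with nine vertices.
  bif Nat.ble (thr (Nat.succ k)) D then bif Nat.ble (bif Nat.beq k 8 then 2 else 0) d then
    filterL (fun R => forceL R (okN (Nat.succ k) D))
      (mapL (fun M => force (extR k rows) M) (genN d degs d)) else [] else []

/-- The extensions by a vertex of minimal degree. -/
noncomputable def candsN (k : ℕ) (rows : List ℕ) : List (List ℕ) :=
  forceL (mapL (pc k) rows) fun degs => force (fun D =>
    flatL (fun d => extsN k rows degs (Nat.add D (Nat.mul 2 d)) d) [0, 1, 2, 3, 4, 5]) (sumL degs)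

lemma Cls.of_iso {k : ℕ} {H K : SimpleGraph (Fin k)} (φ : H ≃g K) (h : Cls k H) : Cls k K := by
  obtain ⟨h1, h2, h3⟩ := h
  have e : ∀ c, NP c H → NP c K := fun c h => h.of_embedding φ.symm.toEmbedding
  refine ⟨fun v => by rw [← ndeg_iso φ.symm]; exact h1 _, by rwa [dsum_iso φ], ?_⟩
  unfold Extra at h3 ⊢
  split at h3
  · rw [dsum_iso φ]
    exact h3.imp (e 6) id
  · rw [dsum_iso φ]
    exact ⟨e 7 h3.1, h3.2.imp (e 6) id⟩
  · exact ⟨e 7 h3.1, fun v => by rw [← ndeg_iso φ.symm]; exact h3.2 _⟩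
  · split <;> first | trivial | simp_all

variable {k : ℕ} {rows : List ℕ}

lemma del_last_rg (h : Valid k rows) {M : ℕ} (hM : M < 2 ^ k) :
    del (rg (k + 1) (extR k rows M)) (Fin.last k) = rg k rows := by
  ext i j
  change (rg (k + 1) (extR k rows M)).Adj _ _ ↔ _
  rw [rg_adj h, rg_adj (h.extR hM), Fin.succAbove_last, testBit_extR h.1]
  simp [j.2.ne]

lemma sum_ndeg_rg (h : Valid k rows) : dsum (rg k rows) = (rows.map (pc k)).sum := by
  rw [dsum, ← List.sum_ofFn]
  congr 1
  refine List.ext_getElem (by simp [h.1]) fun i h1 h2 => ?_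
  have hi : i < rows.length := by simpa using h2
  rw [List.getElem_ofFn, List.getElem_map, ndeg_rg h]
  change pc k (nthP 0 rows i) = _
  rw [nthP_eq, List.getD_eq_getElem _ _ hi]

/-- All members of the next class are found among the extensions. -/
theorem exists_cand (h : Valid k rows) {H : SimpleGraph (Fin (k + 1))} (hH : Cls (k + 1) H)
    {v : Fin (k + 1)} (hv : ∀ w, ndeg H v ≤ ndeg H w) (φ : del H v ≃g rg k rows) :
    ∃ R ∈ candsN k rows, Valid (k + 1) R ∧ Nonempty (H ≃g rg (k + 1) R) := by
  classical
  obtain ⟨M, hM, ψ, hψ⟩ := exists_extR h φ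
  have hV := h.extR hM
  have hK := hH.of_iso ψ
  refine ⟨_, ?_, hV, ⟨ψ⟩⟩
  have hmin : ∀ w, ndeg (rg (k + 1) (extR k rows M)) (Fin.last k) ≤ ndeg (rg (k + 1) (extR k rows M)) w := fun w => by
    obtain ⟨w, rfl⟩ := ψ.surjective w
    rw [← hψ, ndeg_iso ψ, ndeg_iso ψ]
    exact hv w
  set K := rg (k + 1) (extR k rows M) with hKdef
  have hd : ndeg K (Fin.last k) = pc k M := by
    rw [hKdef, ndeg_rg hV, pc_eq, Fin.sum_univ_castSucc, pc_eq]
    simp [testBit_extR h.1, Nat.testBit_lt_two_pow hM]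
  -- The new edges are counted at both of their ends.
  have hD : dsum K = (rows.map (pc k)).sum + 2 * pc k M := by
    rw [dsum_del K (Fin.last k), hKdef, del_last_rg h hM, sum_ndeg_rg h, ← hd]
  have hdeg : ∀ i : Fin k, ndeg K i.castSucc = (M.testBit i).toNat + pc k (rget rows i) := by
    intro i
    have h1 := ndeg_del K (Fin.last k) i
    rw [hKdef, del_last_rg h hM, ndeg_rg h, Fin.succAbove_last] at h1
    rw [hKdef, h1, rg_adj hV, testBit_extR h.1]
    cases hb : M.testBit i <;> simp [hb]
  -- Minimality of the new degree bounds the old vertices from below, and the class bounds them by 5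
  -- from above.
  have hgen : M ∈ genN (pc k M) (rows.map (pc k)) (pc k M) := by
    have hget : ∀ i < rows.length, (rows.map (pc k)).getD i 0 = pc k (rget rows i) := by
      intro i hi
      rw [rget, nthP_eq, List.getD_eq_getElem _ _ (by simpa using hi), List.getElem_map,
        List.getD_eq_getElem _ _ hi]
    refine mem_genN _ M _ (by rw [List.length_map, h.1]; exact hM) ?_ ?_
      (by rw [List.length_map, h.1])
    · intro i hi hb
      rw [List.length_map] at hi
      rw [hget i hi]
      rw [h.1] at hi
      have h1 := hdeg ⟨i, hi⟩
      have h2 := hmin (Fin.castSucc ⟨i, hi⟩)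
      have h3 := hK.1 (Fin.castSucc ⟨i, hi⟩)
      simp only [hb, Bool.toNat_true] at h1
      omega
    · intro i hi hb
      rw [List.length_map] at hi
      rw [hget i hi]
      rw [h.1] at hi
      have h1 := hdeg ⟨i, hi⟩
      have h2 := hmin (Fin.castSucc ⟨i, hi⟩)
      simp only [hb, Bool.toNat_false] at h1
      omega
  have h5 := hK.1 (Fin.last k)
  rw [candsN, forceL_eq, force_eq, flatL_eq, List.mem_flatMap, mapL_eq, sumL_eq]
  refine ⟨pc k M, ?_, ?_⟩
  · rw [hd] at h5
    interval_cases pc k M <;> simp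
  · change _ ∈ extsN k rows _ (_ + 2 * _) _
    rw [← hD, extsN, Nat.ble_eq_true_of_le hK.2.1, cond_true]
    have h2 : Nat.ble (bif Nat.beq k 8 then 2 else 0) (pc k M) = true := by
      rcases h8 : Nat.beq k 8 with _ | _
      · exact Nat.ble_eq_true_of_le (Nat.zero_le _)
      · have := Nat.eq_of_beq_eq_true h8
        subst this
        refine Nat.ble_eq_true_of_le ?_
        rw [← hd]
        exact hK.2.2.2 _
    rw [h2, cond_true, filterL_eq, List.mem_filter, mapL_eq, List.mem_map]
    refine ⟨⟨M, hgen, force_eq _ _⟩, ?_⟩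
    rw [forceL_eq]
    exact okN_of_extra hV hK.2.2

end Extensions

/-! ### Codes of graphs and certificates for isomorphism -/

section Certificates

/-- The rows of the graph with the code `N`. -/
noncomputable def rowsN (k N : ℕ) : List ℕ :=
  -- The neighbours of vertex k among the earlier vertices occupy the k bits from position k(k -
  -- 1)/2 on.
  Nat.rec (motive := fun _ => List ℕ) [] (fun k ih =>
    extR k ih (Nat.mod (Nat.shiftRight N (Nat.div (Nat.mul k (Nat.pred k)) 2)) (Nat.pow 2 k))) k

lemma valid_rowsN (k N : ℕ) : Valid k (rowsN k N) := by
  induction k with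
  | zero =>
    refine ⟨rfl, fun i j h => ?_⟩
    rw [show rget (rowsN 0 N) i = 0 from rget_of_le (Nat.zero_le i), Nat.zero_testBit] at h
    cases h
  | succ k ih => exact ih.extR (Nat.mod_lt _ (Nat.two_pow_pos k))

/-- The index, the row, the image and the row of the image, for the vertices of a graph. -/
noncomputable def matchL (T rows : List ℕ) : ℕ → ℕ → List (ℕ × ℕ × ℕ × ℕ) :=
  List.rec (motive := fun _ => ℕ → ℕ → List (ℕ × ℕ × ℕ × ℕ)) (fun _ _ => [])
    (fun r _ ih c i => force (fun q => (i, r, q, rget T q) ::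
      ih (Nat.div c 10) (Nat.succ i)) (Nat.mod c 10)) rows

lemma matchL_getElem? (T rows : List ℕ) (c off i : ℕ) (hi : i < rows.length) :
    (matchL T rows c off)[i]? =
      some (off + i, rget rows i, c / 10 ^ i % 10, rget T (c / 10 ^ i % 10)) := by
  induction rows generalizing c off i with
  | nil => exact absurd hi (by simp)
  | cons r rows ih =>
    change (force (fun q => (off, r, q, rget T q) :: matchL T rows (c / 10) (off + 1))
      (c % 10))[i]? = _
    rw [force_eq]
    rcases i with _ | i
    · simp [rget, nthP]
    · rw [List.getElem?_cons_succ, ih _ _ _ (by simpa using hi), Nat.div_div_eq_div_mul,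
        ← pow_succ', rget_cons_succ, show off + 1 + i = off + (i + 1) by ring]

/-- The digits of `c` describe an isomorphism. -/
noncomputable def isoN (k : ℕ) (rows T : List ℕ) (c : ℕ) : Bool :=
  allTails (fun a t => bif Nat.blt a.2.2.1 k then allL (fun b =>
    bif Nat.beq a.2.2.1 b.2.2.1 then false else
      bif tb a.2.1 b.1 then tb a.2.2.2 b.2.2.1 else !(tb a.2.2.2 b.2.2.1)) t else false)
    (matchL T rows c 0)

lemma allTails_getElem? {α : Type} {p : α → List α → Bool} {l : List α} (h : allTails p l = true)
    {i : ℕ} {a : α} (hi : l[i]? = some a) : p a (l.drop (i + 1)) = true := by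
  obtain ⟨hlt, rfl⟩ := List.getElem?_eq_some_iff.1 hi
  refine (allTails_iff p l).1 h (l.take i) _ _ ?_
  rw [← List.drop_eq_getElem_cons hlt, List.take_append_drop]

/-- Pairwise distinct digits below `k` give an injective, hence bijective, map; by symmetry it is
enough to compare the adjacencies for i < j. -/
lemma iso_of_isoN {k : ℕ} {rows T : List ℕ} (h : Valid k rows) (hT : Valid k T) {c : ℕ}
    (hc : isoN k rows T c = true) : Nonempty (rg k rows ≃g rg k T) := by
  have h1 : ∀ i < k, c / 10 ^ i % 10 < k ∧ ∀ j < k, i < j →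
      c / 10 ^ i % 10 ≠ c / 10 ^ j % 10 ∧
        (rget rows i).testBit j = (rget T (c / 10 ^ i % 10)).testBit (c / 10 ^ j % 10) := by
    intro i hi
    have h2 := allTails_getElem? hc (matchL_getElem? T rows c 0 i (by rw [h.1]; exact hi))
    rw [cond_false_right, allL_iff] at h2
    refine ⟨Nat.le_of_ble_eq_true h2.1, fun j hj hij => ?_⟩
    have hm := matchL_getElem? T rows c 0 j (by rw [h.1]; exact hj)
    have h3 := h2.2 _ (List.mem_of_getElem? (i := j - (i + 1)) (by
      rw [List.getElem?_drop, show i + 1 + (j - (i + 1)) = j by omega]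
      exact hm))
    simp only [tb_eq, zero_add] at h3
    rcases hb : Nat.beq (c / 10 ^ i % 10) (c / 10 ^ j % 10) with _ | _
    · rw [hb, cond_false] at h3
      refine ⟨fun e => (by rw [e, Nat.beq_refl] at hb; cases hb), ?_⟩
      rcases hx : (rget rows i).testBit j with _ | _ <;> rw [hx] at h3 <;> simp at h3 <;> simp [h3]
    · rw [hb] at h3
      cases h3
  let f : Fin k → Fin k := fun i => ⟨c / 10 ^ i.val % 10, (h1 i i.2).1⟩
  have hf : Function.Injective f := fun i j e => by
    have e' : c / 10 ^ i.val % 10 = c / 10 ^ j.val % 10 := congrArg Fin.val e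
    rcases lt_trichotomy i.val j.val with hlt | heq | hlt
    · exact absurd e' ((h1 i i.2).2 j j.2 hlt).1
    · exact Fin.ext heq
    · exact absurd e'.symm ((h1 j j.2).2 i i.2 hlt).1
  refine ⟨⟨Equiv.ofBijective f (Finite.injective_iff_bijective.1 hf), ?_⟩⟩
  intro i j
  change (rg k T).Adj (f i) (f j) ↔ (rg k rows).Adj i j
  rcases lt_trichotomy i.val j.val with hlt | heq | hlt
  · rw [rg_adj h, rg_adj hT, ((h1 i i.2).2 j j.2 hlt).2]
  · rw [Fin.ext heq]
    simp
  · rw [SimpleGraph.adj_comm, (rg k rows).adj_comm, rg_adj h, rg_adj hT,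
      ((h1 j j.2).2 i i.2 hlt).2]

/-- Every extension of a graph in `Ls` is isomorphic to a graph in `Lt`. -/
noncomputable def levelN (k : ℕ) (Ls Lt certs : List ℕ) : Bool :=
  -- The part of the certificate above the ten lowest digits is the index of the target in `Lt`. The
  -- default 2^40 signals an index out of range and is rejected.
  allZip (fun R c => force (fun N => bif Nat.beq N (2 ^ 40) then false else
      forceL (rowsN (Nat.succ k) N) fun T => forceL R fun R => isoN (Nat.succ k) R T c)
    (nthP (2 ^ 40) Lt (Nat.div c (10 ^ 10))))
    (flatL (fun N => forceL (rowsN k N) (candsN k)) Ls) certs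

/-- Every graph of the class is isomorphic to a graph with a code in `l`. -/
def Complete (k : ℕ) (l : List ℕ) : Prop :=
  ∀ H : SimpleGraph (Fin k), Cls k H → ∃ N ∈ l, Nonempty (H ≃g rg k (rowsN k N))

/-- Delete a vertex of minimal degree, replace the rest by its listed copy, and put the vertex back:
the result is one of the checked candidates, so its certificate leads into `Lt`. -/
theorem Complete.succ {k : ℕ} (hk : k < 9) {Ls Lt certs : List ℕ} (h : Complete k Ls)
    (hl : levelN k Ls Lt certs = true) : Complete (k + 1) Lt := by
  intro H hH
  obtain ⟨v, hv, hdel⟩ := hH.del hk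
  obtain ⟨N, hN, ⟨φ⟩⟩ := h _ hdel
  obtain ⟨R, hR, hV, ⟨ψ⟩⟩ := exists_cand (valid_rowsN k N) hH hv φ
  have hmem : R ∈ flatL (fun N => forceL (rowsN k N) (candsN k)) Ls := by
    rw [flatL_eq, List.mem_flatMap]
    exact ⟨N, hN, by rwa [forceL_eq]⟩
  obtain ⟨c, hc⟩ := exists_of_allZip hl hmem
  simp only [force_eq, forceL_eq] at hc
  rcases hb : Nat.beq (nthP (2 ^ 40) Lt (Nat.div c (10 ^ 10))) (2 ^ 40) with _ | _
  · rw [hb, cond_false] at hc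
    refine ⟨_, ?_, (iso_of_isoN hV (valid_rowsN _ _) hc).map ψ.trans⟩
    rw [nthP_eq] at hb ⊢
    by_cases hlt : Nat.div c (10 ^ 10) < Lt.length
    · rw [List.getD_eq_getElem _ _ hlt]
      exact List.getElem_mem hlt
    · rw [List.getD_eq_default _ _ (by omega), Nat.beq_refl] at hb
      cases hb
  · rw [hb] at hc
    cases hc

end Certificates

end TrappingSets

namespace TrappingSets

/-! ### Complete lists for the classes with up to nine vertices -/

section Lists

/-- The codes of the graphs in the classes. -/
def codes : ℕ → List ℕ
  | 0 =>
    [0]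
  | 1 =>
    [0]
  | 2 =>
    [0, 1]
  | 3 =>
    [1, 3, 7]
  | 4 =>
    [51, 15, 31, 63]
  | 5 =>
    [243, 591, 287, 627, 95, 799, 351, 63, 223, 127, 863, 255, 511, 1023]
  | 6 =>
    [12531, 24863, 20723, 5363, 6735, 17651, 9459, 17183, 6771, 28915, 3315, 8543, 1823, 4895,
     3663, 2399, 21279, 24927, 16511, 4319, 1375, 10591, 18207, 2175, 9843, 5919, 6495, 1247,
     1151, 863, 9567, 18559, 3871, 17535, 23155, 13087, 2911, 255, 3423, 16639, 1887, 22303,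
     29471, 4351, 25951, 1279, 7007, 20255, 20735, 19295, 3295, 17663, 3935, 12543, 5375, 511,
     8703, 15199, 3327, 1535, 28927, 8031, 20319, 25087, 19711, 9727, 3583, 31583, 1023, 26111,
     2047, 11775, 7679, 4095, 28159, 8191, 16383, 32767]
  | 7 =>
    [1728799, 1618163, 1396979, 192755, 127219, 323827, 1591423, 1364211, 1590399, 673919,
     1575775, 1589503, 575615, 1182559, 284447, 1196287, 87839, 121459, 1117023, 62239, 651507,
     1055583, 91487, 1099903, 1084255, 55071, 160543, 411775, 269151, 214143, 1097983, 1069311,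
     544543, 318067, 1067871, 151327, 72543, 545023, 39775, 182399, 1066239, 282879, 150367,
     1052511, 541951, 536831, 53023, 148735, 528223, 135007, 151807, 116863, 53503, 52063, 84831,
     83199, 69471, 529663, 45311, 267519, 70911, 1057279, 15199, 527615, 539487, 532991, 28927,
     1050111, 134399, 1581567, 270847, 8031, 1319423, 47967, 553215, 146271, 41471, 270175,
     1056607, 67071, 1090047, 61695, 1366643, 20319, 25087, 73567, 19711, 1115647, 151391,
     1073663, 9727, 150783, 1058303, 85855, 534015, 287231, 57855, 271871, 75263, 3583, 1052159,
     265727, 31583, 134655, 1049599, 64351, 26111, 2047, 1050623, 1074687, 288255, 91647, 11775,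
     67583, 536063, 1116159, 142847, 7679, 4095, 1052671, 269823, 1981279, 135167, 1751903,
     1700095, 260959, 1686367, 1402367, 1861119, 654175, 28159, 1715711, 1271295, 159231, 484863,
     878079, 8191, 1842687, 1056767, 1445887, 270335, 421375, 1207807, 1318911, 523103, 794623,
     1533439, 1702751, 945663, 1843199, 16383, 540671, 1589247, 1994239, 32767]
  | 8 =>
    [155382003, 119058675, 60338419, 93892851, 146100467, 159510771, 236472447, 24797471,
     173584627, 160974975, 25817331, 28991775, 218777727, 143257843, 87380211, 16408863,
     81088755, 205844723, 41242867, 11137267, 236471423, 142127347, 144896243, 41464051,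
     169996531, 147124467, 19525875, 92926195, 41210099, 160035059, 136966387, 140636403,
     148164851, 6942963, 202908159, 201866079, 140630643, 168311647, 202646015, 87347443,
     138951519, 85467647, 201879807, 202416639, 168325375, 152576511, 136854367, 143145823,
     201596767, 151141215, 143159551, 219685375, 168042335, 70787583, 151265119, 227143923,
     147118707, 202383199, 202442239, 202400255, 136868095, 138459999, 142654303, 142876511,
     70525439, 168862207, 151146335, 138682207, 202384895, 205005311, 139468639, 142757727,
     167922943, 142668031, 72393215, 138473727, 168830463, 152084991, 139502079, 151145727,
     137388543, 142757119, 7658099, 152068607, 142679903, 138563423, 167858015, 139470335,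
     36971007, 152053247, 76613119, 13949555, 141160691, 20455935, 51913215, 202378751, 38838783,
     152047103, 51421695, 40497395, 51447295, 7873023, 22061567, 143658495, 26281471, 7610879,
     134282079, 13672959, 20241011, 67173215, 4258655, 202377215, 201390943, 135292415,
     138476383, 134505983, 134309375, 68183551, 202401279, 47503987, 139462655, 17851903,
     5268991, 139486719, 134753791, 152069631, 33842687, 68225023, 4482559, 8480255, 202442751,
     168060415, 67644927, 134360575, 201862655, 34090495, 168308223, 138700287, 142697983,
     17313279, 8924671, 151531007, 9504767, 143142399, 16920063, 76613631, 135270399, 151137791,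
     134487551, 68161535, 202379263, 33824255, 210831359, 168041983, 17047039, 134352895,
     151264767, 9441279, 143659007, 4078431, 18529119, 5946207, 35306335, 87349875, 16912383,
     68808959, 26281983, 10088703, 134478687, 17038175, 35240799, 135620095, 136078847, 10074975,
     134245887, 134871903, 181721715, 68511231, 68969983, 34956799, 9790975, 6055423, 67763039,
     9042783, 135933439, 159231, 68824575, 35270143, 134376959, 18492927, 135489023, 67593727,
     68380159, 134702591, 18048511, 67986943, 134225919, 67268095, 16936447, 34039295, 201485823,
     9266687, 151154175, 1056767, 135274495, 136060415, 270335, 134488063, 18619903, 68165631,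
     68554751, 202383359, 17833983, 134639103, 152051711, 35000319, 33824767, 33975807,
     135425535, 168042495, 17985023, 135536639, 523103, 68427775, 34873343, 135012351, 1533439,
     1702751, 34077535, 67903487, 134740831, 68642303, 35087871, 10091359, 945663, 135163391,
     68054527, 1843199, 136060927, 68952063, 16383, 134234111, 540671, 134758399, 67649535,
     201867263, 1589247, 135806975, 1994239, 136211967, 32767, 134250495]
  | 9 =>
    [64579891443, 54997305471, 56465338611, 51900969203, 44183449843, 49538224371, 60349227519,
     35257970931, 1569321203, 60334547455, 57114161395, 2643063027, 1032450291, 18078101747,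
     26511679999, 43691549183, 37722124531, 5193199859, 56995696883, 21903306995, 5260308723,
     52437840115, 52277869407, 5327417587, 52278879743, 60331984895, 52751825759, 52752836095,
     56036437503, 55986644479, 53826577919, 52815212031, 5319959039, 44225857535, 7184327167,
     55975735539, 25980635135, 3963101695, 60331921407, 51855546995, 60297584127, 52815728639,
     60340373503, 2098733567, 42953751391, 53763704831, 10948249599, 34900687711, 51558136671,
     38660651871, 37783406591, 42968202079, 34915138399, 38673234783, 51574913887, 51674086239,
     28128118783, 38664794367, 36641700703, 35502289151, 36517310719, 51675686399, 51675227647,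
     51674479455, 42984913759, 38671743839, 38790325759, 35032688127, 35569100287, 43085293055,
     43085751807, 36517296991, 43084544863, 35568352095, 35468720991, 51675540991, 35501991423,
     34965579263, 6653282303, 38723216895, 36516264799, 22507286771, 36643155455, 35468436991,
     43085606399, 38790639103, 35501243231, 35439535615, 36823161459, 51675096575, 38723530239,
     36542492159, 51607201279, 987028083, 43017266687, 36642711039, 51741093375, 36576046591,
     51607594495, 51674310143, 43085161983, 43017659903, 38789408255, 51690761727, 38722299391,
     38672754175, 35501467135, 36575602175, 51675667967, 51741990911, 19528838655, 51608162303,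
     43018227711, 51691659263, 51674246655, 36643282431, 2597640819, 11053357683, 21625990655,
     53888577023, 38673325567, 38723260415, 19529736191, 38789344767, 43101724671, 51707650047,
     51675033087, 53889474559, 21626888191, 38806757375, 55986626559, 51675144191, 36642647551,
     13036056063, 43085209599, 38790242303, 6643936767, 51674619903, 43084685311, 13036953599,
     6644834303, 51573685087, 42983750495, 51574695423, 36517313375, 38723347967, 51674770943,
     11187575411, 43084836351, 51675668479, 43085733887, 51674365951, 43084431359, 51741474815,
     51675414527, 45547313779, 51673858047]
  | _ => []

/-- The isomorphisms from the extensions to the listed graphs. -/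
def isos : ℕ → List ℕ
  | 0 =>
    [0]
  | 1 =>
    [10, 10000000010]
  | 2 =>
    [210, 10000000210, 10000000201, 20000000210]
  | 3 =>
    [3210, 10000003210, 10000003201, 10000003021, 20000003210, 20000003120, 20000003102,
     30000003210]
  | 4 =>
    [43210, 43120, 30000043210, 30000042301, 41302, 41032, 10000043210, 32410, 32140,
     40000043210, 40000043201, 20000043210, 20000042310, 80000043210, 60000043210, 60000042310,
     60000043201, 60000042301, 50000043210, 100000043210, 100000043201, 70000043210, 90000043210,
     90000043201, 90000043021, 90000040321, 110000043210, 110000043120, 110000041320,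
     110000043102, 110000041302, 110000041032, 120000043210, 120000042310, 120000042130,
     120000042103, 130000043210]
  | 5 =>
    [100000543210, 30000543210, 60000543210, 50000543210, 60000542301, 30000542301, 50000542301,
     543210, 20000543210, 20000542301, 90000543210, 140000543210, 140000543120, 140000521430,
     140000512430, 40000543210, 30000352410, 30000325410, 30000352140, 30000325140, 40000521430,
     50000235140, 50000235104, 40000435021, 10000543210, 60000453210, 60000453120, 240000543210,
     60000413520, 80000543210, 60000450213, 80000523410, 60000450123, 80000523140, 60000410523,
     340000543210, 140000435210, 100000325410, 50000325140, 50000321540, 120000543210,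
     120000543201, 130000543210, 130000542310, 70000543210, 320000543210, 250000543210,
     250000542310, 220000543210, 250000543201, 250000542301, 220000543201, 350000543210,
     160000543210, 160000542310, 470000543210, 410000543210, 410000542310, 410000543201,
     410000542301, 420000543210, 200000543210, 150000543210, 150000534120, 110000543210,
     110000534120, 380000543210, 380000534120, 300000543210, 300000534120, 260000543210,
     210000543210, 250000435120, 250000453210, 210000534120, 170000543210, 440000543210,
     410000435120, 410000453210, 270000543210, 270000543201, 190000543210, 190000542310,
     190000524310, 500000543210, 380000453210, 380000452310, 380000425310, 380000453201,
     380000452301, 380000425301, 320000453210, 320000435210, 320000432510, 470000453210,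
     280000543210, 230000543210, 230000543120, 230000541320, 180000543210, 330000543210,
     310000543210, 310000543120, 310000541320, 290000543210, 400000543210, 360000543210,
     360000534120, 360000531420, 360000513240, 520000543210, 520000534120, 520000531420,
     520000513240, 460000543210, 460000542310, 490000543210, 490000534120, 460000524130,
     460000521430, 610000543210, 610000542310, 620000543210, 620000534120, 610000524130,
     610000521430, 570000543210, 570000534120, 570000531420, 570000513240, 670000543210,
     370000543210, 450000543210, 450000543201, 430000543210, 430000542310, 390000543210,
     580000543210, 540000543210, 540000542310, 510000543210, 540000543201, 540000542301,
     510000543201, 530000543210, 480000543210, 480000542310, 640000543210, 610000435210,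
     610000432510, 610000435201, 610000432501, 600000543210, 550000543210, 590000543210,
     590000543201, 590000543021, 560000543210, 560000534210, 660000543210, 660000543120,
     650000543210, 650000534210, 660000543102, 650000543201, 650000534201, 650000543021,
     650000534021, 630000543210, 720000543210, 710000543210, 710000534210, 710000543120,
     710000534120, 690000543210, 710000543102, 710000534102, 690000543201, 690000543021,
     740000543210, 740000543120, 740000543102, 680000543210, 700000543210, 700000543201,
     700000543021, 700000540321, 700000504321, 730000543210, 730000543120, 730000541320,
     730000514320, 730000543102, 730000541302, 730000514302, 730000541032, 730000514032,
     730000510432, 750000543210, 750000542310, 750000524310, 750000542130, 750000524130,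
     750000521430, 750000542103, 750000524103, 750000521403, 750000521043, 760000543210,
     760000534210, 760000532410, 760000532140, 760000532104, 770000543210]
  | 6 =>
    [10006543210, 10006542301, 10006451032, 10006450123, 10002536140, 10002536104, 6543210,
     6452310, 70006543210, 20006543210, 10004651032, 20006315240, 20005642301, 5364102,
     10005643210, 70005643210, 70004513620, 70004156302, 70004156032, 70004510623, 40006543210,
     30006543210, 50006543210, 40006315240, 50006315240, 50006542301, 30006542301, 40006312504,
     50006312504, 40006451032, 50006205341, 40006134052, 50006203514, 40006130425, 30006205341,
     200006543210, 200006451032, 510006543210, 390006543210, 390006542310, 120006543210,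
     230006543210, 390006453201, 390006452301, 230006453201, 120006453201, 270006543210,
     90006543210, 90006453201, 90006542310, 90006452301, 60006543210, 200005326410, 200005324610,
     290006543210, 290006542310, 120005643210, 120005463210, 290006542130, 120005643120,
     120005463120, 120005641320, 120005461320, 80006543210, 170006543210, 170006543120,
     330006543210, 170006513420, 330006345210, 330006452301, 170006451302, 330006432501,
     170006154302, 170006451032, 330006432051, 170006154032, 170006401532, 330006340215,
     170006104532, 820006543210, 820006452301, 240006543210, 180006543210, 130006543210,
     130006542310, 100006543210, 300006543210, 300006543201, 150006543210, 150006542310,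
     110006543210, 240005643210, 240005634120, 240005631420, 240005613240, 250006543210,
     160006543210, 250006134052, 140006543210, 140006134052, 160006134052, 190006543210,
     190006543201, 260006543210, 260006542310, 190006103254, 190006013254, 390004563120,
     390004563102, 290005463021, 270005461032, 150005643210, 220006543210, 220006534120,
     220006351420, 220006315240, 220006132540, 510005463210, 390005463120, 390005461320,
     300005643210, 380006543210, 360006543210, 360006534120, 280006543210, 280006534120,
     210006543210, 460006543210, 460006543201, 350006543210, 350006542310, 320006543210,
     350006245310, 520006543210, 520006543201, 500006543210, 410006543210, 370006543210,
     310006543210, 530006543210, 540006543210, 420006543210, 420006542310, 540006513240,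
     340006543210, 550006543210, 470006543210, 470006542310, 440006543210, 400006543210,
     560006543210, 490006543210, 490006542310, 480006543210, 430006543210, 580006543210,
     580006543201, 580006451032, 580006450132, 450006543210, 450006451032, 600006543210,
     600006453120, 590006543210, 570006543210, 570006453120, 760006543210, 760006543201,
     760006543021, 700006543210, 650006543210, 610006543210, 800006543210, 800006543201,
     800006543021, 720006543210, 690006543210, 620006543210, 730006543210, 730006453201,
     750006543210, 750006542310, 640006543210, 640006453201, 1260006543210, 1230006543210,
     1230006542310, 1230006453201, 1230006452301, 1210006543210, 680006543210, 680006542310,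
     630006543210, 630006453210, 790006543210, 790006543120, 760005643210, 760005634210,
     670006543210, 870006543210, 870006543120, 800005643210, 800005634210, 660006543210,
     810006543210, 810006543201, 810006451032, 810006450132, 740006543210, 740006451032,
     1240006543210, 1230001536240, 1230001532640, 1230001536204, 1230001532604, 1240006451032,
     710006543210, 850006543210, 850006534120, 770006543210, 770006534120, 780006543210,
     1230005631420, 1230005613240, 830006543210, 930006543210, 880006543210, 880006542310,
     930006513240, 880006245310, 1260005643210, 1260005613240, 840006543210, 960006543210,
     960006543201, 960006543021, 950006543210, 950006534210, 890006543210, 860006543210,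
     910006543210, 910006542310, 910006325410, 910006235410, 1240005643210, 900006543210,
     980006543210, 980006543120, 970006543210, 940006543210, 920006543210, 990006543210,
     1030006543210, 1010006543210, 1010006534210, 1000006543210, 1020006543210, 1050006543210,
     1050006453201, 1050006435021, 1050006430521, 1050006403251, 1050006043215, 1250006543210,
     1250006542310, 1290006543210, 1290006453201, 1290006534120, 1250006524130, 1290006435021,
     1250006521430, 1290006430521, 1290006403251, 1290006354102, 1290006345012, 1250006254103,
     1290006340512, 1250006251403, 1290006043215, 1290006304152, 1290006034125, 1250006215043,
     1250006210543, 1440006543210, 1440006534120, 1440006354102, 1440006531420, 1440006351402,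
     1470006543210, 1440006513240, 1470006534120, 1440006315042, 1440006310542, 1470006354102,
     1440006153204, 1440006135024, 1440006130524, 1440006103254, 1040006543210, 1060006543210,
     1110006543210, 1110006543120, 1100006543210, 1100006534210, 1090006543210, 1340006543210,
     1340006534210, 1320006543210, 1350006543210, 1270006543210, 1270006534210, 1350006543120,
     1270006543120, 1270006534120, 1280006543210, 1460006543210, 1460006534210, 1440005432610,
     1440005432160, 1070006543210, 1130006543210, 1130006543120, 1130006541320, 1130006514320,
     1080006543210, 1150006543210, 1150006543120, 1150006541320, 1150006514320, 1120006543210,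
     1160006543210, 1160006452310, 1140006543210, 1140006452310, 1340005643021, 1340005460321,
     1310006543210, 1310006452310, 1460005643021, 1170006543210, 1200006543210, 1200006534210,
     1200006354210, 1370006543210, 1180006543210, 1220006543210, 1220006542310, 1220006524310,
     1190006543210, 1390006543210, 1390006534210, 1390006532410, 1300006543210, 1330006543210,
     1330006452310, 1330006425310, 1330006243510, 1410006543210, 1410006534210, 1420006543210,
     1420006452310, 1410006352410, 1410006325410, 1480006543210, 1480006452310, 1480006425310,
     1480006243510, 1530006543210, 1360006543210, 1400006543210, 1400006534210, 1380006543210,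
     1450006543210, 1430006543210, 1430006534210, 1490006543210, 1500006543210, 1510006543210,
     1510006453210, 1520006543210, 1540006543210]
  | 7 =>
    [150076543210, 70076543210, 110076543210, 110076543201, 110071305264, 150071305264,
     110070315264, 70071305264, 230076543210, 210076543210, 230071345260, 80076543210,
     20076543210, 30076543210, 20017436052, 10076543210, 180076543210, 40076543210, 140076543210,
     40070234516, 160076543210, 180074560213, 40074560213, 140073206514, 40073206514,
     220076543210, 76543210, 40054673120, 40054762031, 76315240, 310076543210, 240076543210,
     240076542301, 50076543210, 20065471032, 20065470123, 160063542701, 250076543210,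
     170076543210, 170076450123, 160063451072, 40045012736, 310045327610, 230065327410,
     230065324710, 230065237401, 230065234701, 90076543210, 30064107532, 30064017523,
     30064105732, 30064015723, 60076543210, 280076543210, 390076543210, 170027546301,
     320076543210, 140067543210, 170041027653, 170027605341, 320076315240, 140067315240,
     170041750623, 150035647102, 150035641702, 150035641072, 200076543210, 280065327410,
     180065327410, 180063527140, 120076543210, 30046107532, 210025367410, 110065437120,
     80025367014, 80025360714, 110064527130, 70056427310, 70056423710, 200032107654,
     220054317620, 180056237401, 180056234701, 240025376410, 80053276104, 80052367014,
     230023567140, 230023567104, 150064537210, 90054671032, 70065427310, 360076543210,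
     250054763210, 320054763210, 250054276301, 250054723610, 320054672301, 250054327610,
     110056437120, 330076543210, 190076543210, 260076543210, 330076315240, 260076315240,
     300076543210, 260076542301, 190076542301, 330076312504, 260076312504, 300076542301,
     100076543210, 260076205341, 100076315240, 130076543210, 260076203514, 100076312504,
     130076542301, 190076205341, 300076205341, 130076205341, 990076543210, 920076543210,
     920076315240, 920076312504, 270076543210, 290076543210, 290076315240, 290076312504,
     550076543210, 360054327610, 280056327410, 280056324710, 240052376410, 240052374610,
     210052367410, 90067543210, 150053647102, 310032547610, 230032567140, 230032561740,
     390041573620, 560076543210, 560076523410, 320045176302, 560076523140, 320045176032,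
     390041570623, 320045106732, 230056327410, 310054327610, 460076543210, 400076543210,
     470076543210, 470076542310, 370076543210, 350076543210, 1010076543210, 1010076543120,
     930076543210, 930075634210, 530076543210, 530075634210, 1010076543102, 930076543201,
     930075634201, 530076543201, 530075634201, 930076543021, 930075634021, 530076543021,
     530075634021, 940076543210, 410076543210, 450076543210, 450075634210, 410075634210,
     340076543210, 690076543210, 690076543201, 690076543021, 510076543210, 510075634210,
     1050076543210, 1050076543120, 880076543210, 640076543210, 640075643210, 1050076543102,
     880076543201, 640076543201, 640075643201, 880076543021, 640076543021, 640075643021,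
     410067543210, 410065743210, 380076543210, 510067543210, 610076543210, 620076543210,
     620076542310, 460067543210, 400067453201, 600076543210, 600076543201, 500076543210,
     500076542310, 440076543210, 420076543210, 620067543210, 620067453201, 490076543210,
     470067543210, 470067453201, 670076543210, 630076543210, 540076543210, 520076543210,
     480076543210, 700076543210, 700076534120, 480067543210, 480067534120, 570076543210,
     1070076543210, 1020076543210, 960076543210, 740076543210, 780076543210, 1020076543120,
     960076543120, 740076543120, 780076543120, 980076543210, 640067543210, 770076543210,
     530067543210, 650076543210, 430076543210, 920032574610, 920032574160, 690067543210,
     750076543210, 730076543210, 730076542310, 600067543210, 500067451032, 820076543210,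
     820076543120, 1080076543210, 820076513420, 1080076345210, 820071563420, 910076543210,
     820076540213, 910076523410, 820076045213, 910072563410, 820076540123, 910076523140,
     820076045123, 910072563140, 820076510423, 1080076340215, 820071560423, 820076015423,
     910072513640, 820071065423, 1630076543210, 1190076543210, 1190074563210, 1190074523610,
     1190074523160, 1760076543210, 840076543210, 670067543210, 630067534120, 700067543210,
     1040076543210, 1040076534210, 900076543210, 900075643201, 1000076543210, 780057643210,
     780056743201, 780057634210, 780056734201, 580076543210, 990053276410, 920053274610,
     920053247610, 850076543210, 710076543210, 660076543210, 850076513240, 660076345210,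
     800076543210, 800076543201, 800076543021, 830076543210, 830076534210, 590076543210,
     810076543210, 790076543210, 720076543210, 720076453210, 870076543210, 870076543120,
     890076543210, 760076543210, 680076543210, 850067543210, 850067542310, 860076543210,
     850067245310, 960065734201, 960065734021, 930056743210, 880065734210, 760067543210,
     980065743210, 980065743201, 980065743021, 940065743210, 830067543210, 1000065743210,
     1000065743120, 980056743210, 980056734210, 800067543210, 1020065743201, 1020065743021,
     930065743210, 890067543210, 1040065743102, 1020056743201, 960056734201, 870067543210,
     1030076543210, 970076543210, 970076534210, 950076543210, 1070065743021, 1050065743210,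
     1010065743210, 970067543210, 1070056743021, 1070056734021, 1030067543210, 1100076543210,
     1100076534120, 1100076531420, 1100076513240, 1090076543210, 1060076543210, 1140076543210,
     1140076534120, 1140076531420, 1140076513240, 1120076543210, 1200076543210, 1200076543120,
     1200076541320, 1200076514320, 1110076543210, 1220076543210, 1220076543120, 1210076543210,
     1210076534210, 1170076543210, 1130076543210, 1230076543210, 1230076543120, 1250076543210,
     1250076534210, 1180076543210, 1280076543210, 1280076543120, 1260076543210, 1210067543210,
     1150076543210, 1370076543210, 1370076543120, 1310076543210, 1250067543210, 1290076543210,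
     1280067543210, 1280067534210, 1220067543210, 1160076543210, 1380076543210, 1370067543210,
     1370067534210, 1230067543210, 1200067543210, 1400076543210, 1390076543210, 1350076543210,
     1320076543210, 1240076543210, 1430076543210, 1410076543210, 1360076543210, 1340076543210,
     1420076543210, 1420076542310, 1420076524310, 1270076543210, 1270075643201, 1660076543210,
     1660076534210, 1450076543210, 1450075643201, 1660076532410, 1450076542310, 1450075642301,
     1450076524310, 1450075624301, 1300076543210, 1520076543210, 1520076542310, 1520076524310,
     1440076543210, 1400067543210, 1390067452310, 1330076543210, 1470076543210, 1430067543210,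
     1410067452310, 1570076543210, 1570076542310, 1570076524310, 1490076543210, 1460076543210,
     1580076543210, 1580076542310, 1580076524310, 1500076543210, 1540076543210, 1510076543210,
     1510076453210, 1480076543210, 1560076543210, 1530076543210, 1530076453210, 1590076543210,
     1590076453201, 1590074603251, 1590074063215, 1590070413265, 1640076543210, 1640076534210,
     1570067543210, 1550076543210, 1660065741032, 1660065714032, 1580067543210, 1610076543210,
     1600076543210, 1620076543210, 1600074365012, 1620074365012, 1670076543210, 1670076542310,
     1670073526410, 1650076543210, 1670072536410, 1690076543210, 1690076534120, 1690076354102,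
     1680076543210, 1730076543210, 1730076542310, 1700076543210, 1700076453201, 1730072546310,
     1800076543210, 1790076543210, 1770076543210, 1710076543210, 1810076543210, 1810076543120,
     1780076543210, 1720076543210, 1830076543210, 1830076542310, 1820076543210, 1750076543210,
     1740076543210, 1890076543210, 1870076543210, 1860076543210, 1840076543210, 1940076543210,
     1940076534210, 1920076543210, 1900076543210, 1850076543210, 1980076543210, 1980076534210,
     1970076543210, 1880076543210, 2020076543210, 2020076534210, 2000076543210, 1990076543210,
     1910076543210, 1930076543210, 2010076543210, 1950076543210, 1950075643201, 1960076543210,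
     2080076543210, 2080076534210, 2080076354210, 2050076543210, 2030076543210, 2120076543210,
     2120076534210, 2090076543210, 2040076543210, 2140076543210, 2140076534210, 2110076543210,
     2150076543210, 2100076543210, 2100075641032, 2060076543210, 2160076543210, 2120067543210,
     2070076543210, 2190076543210, 2140067543210, 2170076543210, 2170076452310, 2130076543210,
     2200076543210, 2200076534210, 2180076543210, 2240076543210, 2230076543210, 2210076543210,
     2220076543210, 2280076543210, 2280076453201, 2300076543210, 2290076543210, 2250076543210,
     2260076543210, 2320076543210, 2310076543210, 2320074560213, 2270076543210, 2330076543210,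
     2330076542310, 2330072546310, 2340076543210, 2360076543210, 2350076543210, 2370076543210,
     2390076543210, 2380076543210, 2400076543210, 2410076543210, 2420076543210, 2440076543210,
     2430076543210, 2450076543210, 2460076543210, 2470076543210, 2480076543210, 2490076543210,
     2500076543210, 2510076543210]
  | 8 =>
    [876543210, 20876543210, 50876543210, 10876543210, 10517460832, 20786543210, 10786543210,
     20486107532, 180876543210, 100876543210, 50485106372, 170876543210, 130876543210,
     70876543210, 130876315240, 70876315240, 30876543210, 130876312504, 70876312504, 30876542301,
     170867451032, 70867451032, 130867451032, 70867134052, 130867134052, 30867451032,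
     70867130425, 130867130425, 30867450123, 30876205341, 30867024153, 210876543210,
     210876315240, 210876312504, 210867451032, 210867134052, 210867130425, 200876543210,
     200854763210, 190876543210, 190876542301, 70687451032, 70645871032, 40876543210,
     40876542301, 210687451032, 180687315240, 430876543210, 320876543210, 320876543120,
     320876543102, 60876543210, 120876543210, 80876543210, 110876543210, 120876315240,
     110876315240, 120831765240, 110831765240, 110876542301, 80876542301, 120876312504,
     110876312504, 120831762504, 110831762504, 120867451032, 110876205341, 120867134052,
     110820765341, 120813674052, 110876203514, 120867130425, 110820763514, 120813670425,
     80876205341, 120831207564, 110831207564, 110820317564, 120813026475, 80820765341,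
     230876543210, 230854763210, 230854317260, 230854312706, 230867451032, 230845671032,
     230845136072, 230845130627, 810876543210, 810867451032, 180163407852, 370876543210,
     370875634210, 340876543210, 140876543210, 150876543210, 150875634210, 340876543120,
     140876543120, 150876543120, 150875634120, 90876543210, 210327584610, 210327584160,
     130786543210, 200584763210, 160876543210, 190786315240, 150642538710, 190786312504,
     150642537801, 350876543210, 210786543210, 170786543210, 200786543210, 200768543210,
     200786315240, 200768315240, 200786312504, 200768312504, 220876543210, 220876534120,
     220876531420, 220876513240, 260876543210, 260876542310, 220768453201, 220786543210,
     240876543210, 240876543120, 1170876543210, 880876543210, 880876345210, 390876543210,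
     1170867452301, 880867452301, 880867432501, 390867452301, 880867432051, 390867452031,
     880876340215, 390876540213, 390867402531, 390876045213, 270876543210, 300876543210,
     300876534210, 240786543210, 300786543210, 300786543120, 290876543210, 500876543210,
     500876534210, 330876543210, 330875643201, 500876532410, 330876542310, 330875642301,
     330876524310, 330875624301, 250876543210, 340765843201, 340765843021, 290687543210,
     310876543210, 310867452310, 280876543210, 280867452310, 320675834210, 280786543210,
     350325874106, 340675843201, 300678543210, 350532874106, 350532847106, 270687543210,
     370756843021, 320765834210, 310687452310, 370576843021, 310786543210, 450876543210,
     450876534210, 330786543210, 370657843021, 370675480321, 410876543210, 410876542310,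
     410876524310, 380876543210, 780876543210, 460876543210, 460875643201, 460857643021,
     460876534210, 460875634201, 460857634021, 360876543210, 360867543120, 360865743102,
     560876543210, 560867543120, 560865743102, 560876534210, 560867534120, 560865734102,
     420876543210, 810753286410, 810753268410, 430765843210, 430756834210, 400876543210,
     430675843210, 430675483210, 500657841032, 500657814032, 410786543210, 470876543210,
     470875613240, 440876543210, 440875613240, 520876543210, 530876543210, 510876543210,
     480876543210, 520786543210, 490876543210, 520784365012, 490874365012, 490786543210,
     530786543210, 480784365012, 540876543210, 1170786543210, 1170784563210, 1170748563210,
     1170784523610, 1170748523610, 1170742583610, 1170784523160, 1170748523160, 1170742583160,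
     1170742513860, 590876543210, 590876542310, 590873526410, 590872536410, 500786543210,
     600876543210, 570876543210, 590786543210, 570874563210, 580876543210, 580876534120,
     580876354102, 550876543210, 650876543210, 650876453201, 580786543210, 740876543210,
     740876542310, 640876543210, 740872546310, 680876543210, 660876543210, 690876543210,
     620876543210, 670876543210, 670876543120, 700876543210, 610876543210, 710876543210,
     740786543210, 740786453201, 710873546210, 730876543210, 730876542310, 720876543210,
     630876543210, 930876543210, 930876543120, 1160876543210, 930876513420, 1160876345210,
     930871563420, 1160836745210, 1160867452301, 930867451302, 1160867432501, 930867154302,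
     1160863472501, 930817654302, 930867451032, 1160867432051, 930867154032, 1160863472051,
     930817654032, 930867401532, 1160876340215, 930860471532, 1160836740215, 930867104532,
     1160863402751, 930817604532, 930860174532, 1160836047215, 930810674532, 1470876543210,
     1470856743210, 1470856347210, 1470867452301, 1470865472301, 1470865432701, 1470865432071,
     1470856340217, 1550876543210, 1550867452301, 760876543210, 790876543210, 690786543210,
     770876543210, 770876543120, 700786543210, 830876543210, 790786543210, 660786543210,
     830786543210, 760786543210, 680786543210, 870876543210, 770786543210, 670786543210,
     860876543210, 860876542310, 720786543210, 800876543210, 860786543210, 730786543210,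
     820876543210, 850876543210, 840876543210, 750876543210, 970876543210, 900876543210,
     840786543210, 910876543210, 900786543210, 850786543210, 910786543210, 970786543210,
     820786543210, 950876543210, 950876534210, 1000876543210, 890876543210, 1040876543210,
     940876543210, 920876543210, 1070876543210, 1070876534210, 1000786543210, 1020876543210,
     920786543210, 990876543210, 1050876543210, 1070786543210, 950786543210, 1060876543210,
     1010876543210, 980876543210, 1040786543210, 1020786543210, 1360876543210, 1100876543210,
     1100867243510, 1100876534210, 1100867234510, 960876543210, 1190876543210, 1190876534210,
     1060786543210, 1060785643201, 1330876543210, 1180876543210, 1100768452310, 1100786543210,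
     1180867452310, 1030876543210, 1190768452310, 1190786543210, 1150876543210, 1150876534210,
     1150876354210, 1080876543210, 1200876543210, 1200876453210, 1150786543210, 1210876543210,
     1120876543210, 1110876543210, 1400876543210, 1220876543210, 1220867543210, 1220876534210,
     1220867534210, 1090876543210, 1270876543210, 1270876534210, 1230876543210, 1230876452310,
     1140876543210, 1390876543210, 1280876543210, 1290876543210, 1220786543210, 1240876543210,
     1130876543210, 1300876543210, 1270786543210, 1210786543210, 1210785641032, 1330768325410,
     1230786543210, 1320876543210, 1320876534210, 1260876543210, 1290687543210, 1290678534210,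
     1250876543210, 1300687543210, 1360768452310, 1320786543210, 1350876543210, 1340876543210,
     1310876543210, 1390768534210, 1340786543210, 1390678534210, 1350786543210, 1380876543210,
     1370876543210, 1420876543210, 1410876543210, 1400768543210, 1380786543210, 1410786543210,
     1410786453201, 1450876543210, 1450874560213, 1450786543210, 1430876543210, 1440876543210,
     1440873546210, 1480876543210, 1460876543210, 1480786543210, 1500876543210, 1490876543210,
     1500786543210, 1520876543210, 1510876543210, 1520786543210, 1530876543210, 1540876543210,
     1560876543210]
  | _ => []

lemma levelN_0 : levelN 0 (codes 0) (codes 1) (isos 0) = true := by decide +kernel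
lemma levelN_1 : levelN 1 (codes 1) (codes 2) (isos 1) = true := by decide +kernel
lemma levelN_2 : levelN 2 (codes 2) (codes 3) (isos 2) = true := by decide +kernel
lemma levelN_3 : levelN 3 (codes 3) (codes 4) (isos 3) = true := by decide +kernel
lemma levelN_4 : levelN 4 (codes 4) (codes 5) (isos 4) = true := by decide +kernel
lemma levelN_5 : levelN 5 (codes 5) (codes 6) (isos 5) = true := by decide +kernel
lemma levelN_6 : levelN 6 (codes 6) (codes 7) (isos 6) = true := by decide +kernel
lemma levelN_7 : levelN 7 (codes 7) (codes 8) (isos 7) = true := by decide +kernel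
lemma levelN_8 : levelN 8 (codes 8) (codes 9) (isos 8) = true := by decide +kernel

/-- The induction starts with the graph without vertices. The lists may contain redundant graphs;
only completeness is claimed. -/
theorem complete_codes {k : ℕ} (hk : k ≤ 9) : Complete k (codes k) := by
  induction k with
  | zero =>
    intro H _
    exact ⟨0, by simp [codes], ⟨⟨Equiv.refl _, fun {i} => i.elim0⟩⟩⟩
  | succ k ih =>
    refine (ih (by omega)).succ (by omega) (certs := isos k) ?_
    have : k < 9 := by omega
    interval_cases k
    exacts [levelN_0, levelN_1, levelN_2, levelN_3, levelN_4, levelN_5, levelN_6, levelN_7,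
      levelN_8]

end Lists

end TrappingSets

namespace TrappingSets

/-! ### Deciding percolation and connectivity by closures -/

section Percolation

variable {k : ℕ} {rows : List ℕ}

/-- The closure of `S` consists of all vertices. -/
noncomputable def fullN (q : ℕ → Bool) (k : ℕ) (rows : List ℕ) (S : ℕ) : Bool :=
  Nat.beq (pc k (closN q k rows S)) k

lemma fullN_iff (q : ℕ → Bool) (S : ℕ) :
    fullN q k rows S = true ↔ bits k (closN q k rows S) = Set.univ := by
  rw [fullN, Nat.beq_eq, pc_eq_ncard]
  constructor
  · intro h
    refine Set.eq_of_subset_of_ncard_le (Set.subset_univ _) ?_ (Set.toFinite _)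
    rw [Set.ncard_univ, Nat.card_fin]
    exact h.ge
  · intro h
    change (bits k (closN q k rows S)).ncard = k
    rw [h, Set.ncard_univ, Nat.card_fin]

/-- The computed closure is the least two-closed set containing the given one. -/
lemma percolates_iff (h : Valid k rows) (S : ℕ) :
    Percolates (rg k rows) (bits k S) ↔ fullN two k rows S = true := by
  rw [fullN_iff]
  constructor
  · refine fun hp => hp _ ?_ fun i hi => le_closN rows k S i hi
    intro v u w hu hw huw hvu hvw
    refine closN_stable monoBits_two h.1 k S (by omega) v ?_
    refine (two_iff _).2 ⟨u, w, fun e => huw (Fin.ext e), ?_, ?_⟩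
    · rw [Nat.testBit_and, (rg_adj h).1 hvu, hu]; rfl
    · rw [Nat.testBit_and, (rg_adj h).1 hvw, hw]; rfl
  · intro hfull A hA hS
    rw [Set.eq_univ_iff_forall]
    intro v
    refine bits_closN (closedFor_two h hA) hS k ?_
    rw [hfull]
    trivial

/-- The number `x` is not zero. -/
def nz (x : ℕ) : Bool := !Nat.beq x 0

lemma nz_iff (x : ℕ) : nz x = true ↔ ∃ u, x.testBit u = true := by
  have h0 : nz x = true ↔ x ≠ 0 := by
    rw [nz, Bool.not_eq_true', ← Bool.not_eq_true, Nat.beq_eq]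
  rw [h0]
  exact ⟨Nat.exists_testBit_of_ne_zero, fun ⟨u, hu⟩ e => by simp [e] at hu⟩

lemma monoBits_nz : MonoBits nz := by
  intro r S T h h2
  rw [nz_iff] at h2 ⊢
  obtain ⟨u, hu⟩ := h2
  rw [Nat.testBit_and, Bool.and_eq_true] at hu
  exact ⟨u, by rw [Nat.testBit_and, hu.1, h u hu.2]; rfl⟩

/-- When one neighbour suffices for being added, the closure of vertex 0 (the mask 1) is its
connected component. -/
lemma connected_iff_fullN (h : Valid k rows) (hk : 0 < k) :
    (rg k rows).Connected ↔ fullN nz k rows 1 = true := by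
  have h0 : ∀ i : Fin k, i ∈ bits k 1 ↔ i = ⟨0, hk⟩ := fun i => by
    simp [bits, Nat.testBit_one_eq_true_iff_self_eq_zero, Fin.ext_iff]
  rw [fullN_iff]
  constructor
  · intro hc
    rw [Set.eq_univ_iff_forall]
    intro v
    obtain ⟨w⟩ := hc.preconnected ⟨0, hk⟩ v
    have key : ∀ a b : Fin k, (rg k rows).Walk a b → a ∈ bits k (closN nz k rows 1) →
        b ∈ bits k (closN nz k rows 1) := by
      intro a b w
      induction w with
      | nil => exact id
      | @cons a b c hab w ih =>
        intro ha
        refine ih (closN_stable monoBits_nz h.1 k 1 (by omega) b ((nz_iff _).2 ⟨a, ?_⟩))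
        rw [Nat.testBit_and, (rg_adj h).1 hab.symm, ha]
        rfl
    exact key _ _ w (le_closN rows k 1 _ ((h0 _).2 rfl))
  · intro hfull
    have hA : ClosedFor nz k rows {v | (rg k rows).Reachable ⟨0, hk⟩ v} := by
      intro v S hS hv
      obtain ⟨u, hu⟩ := (nz_iff _).1 hv
      rw [Nat.testBit_and, Bool.and_eq_true] at hu
      have hu' := (h.2 _ _ hu.1).2.1
      have hadj : (rg k rows).Adj v ⟨u, hu'⟩ := (rg_adj h).2 hu.1
      exact (hS (a := ⟨u, hu'⟩) hu.2).trans hadj.symm.reachable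
    have hall : ∀ v, (rg k rows).Reachable ⟨0, hk⟩ v := fun v => by
      refine bits_closN hA (fun i hi => ?_) k (show v ∈ bits k (closN nz k rows 1) by
        rw [hfull]; trivial)
      rw [(h0 i).1 hi]
      exact SimpleGraph.Reachable.refl _
    have : Nonempty (Fin k) := ⟨⟨0, hk⟩⟩
    exact ⟨fun u v => (hall u).symm.trans (hall v)⟩

end Percolation

/-! ### Depth-first search for percolating cycles -/

section Search

/-- Some element satisfies `p`. -/
noncomputable def anyL {α : Type} (p : α → Bool) (l : List α) : Bool :=
  List.rec (motive := fun _ => Bool) false (fun a _ ih => bif p a then true else ih) l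

/-- Some element and the list after it satisfy `p`. -/
noncomputable def anyTails {α : Type} (p : α → List α → Bool) (l : List α) : Bool :=
  List.rec (motive := fun _ => Bool) false (fun a t ih => bif p a t then true else ih) l

lemma cond_true_left (a b : Bool) : (bif a then true else b) = true ↔ a = true ∨ b = true := by
  cases a <;> simp

lemma anyL_iff {α : Type} (p : α → Bool) (l : List α) :
    anyL p l = true ↔ ∃ a ∈ l, p a = true := by
  induction l with
  | nil => simp [anyL]
  | cons a l ih =>
    change (bif p a then true else anyL p l) = true ↔ _
    rw [cond_true_left, ih]
    simp

/-- Search for a path with `c` more vertices from `t` that ends at a neighbour of `s` and completes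
`S` to a percolating set. -/
noncomputable def dfsN (k : ℕ) (rows : List ℕ) (t : List (ℕ × ℕ)) (s c : ℕ) : ℕ → ℕ → Bool :=
  Nat.rec (motive := fun _ => ℕ → ℕ → Bool)
    (fun r S => bif tb r s then fullN two k rows S else false)
    (fun _ ih r S => anyL (fun x => bif tb r x.1 then bif tb S x.1 then false else
      force (ih x.2) (Nat.lor S (Nat.shiftLeft 1 x.1)) else false) t) c

/-- Some cycle with `c + 1` vertices percolates. -/
noncomputable def percN (k : ℕ) (rows : List ℕ) (c : ℕ) : Bool :=
  anyTails (fun a t => dfsN k rows t a.1 c a.2 (Nat.shiftLeft 1 a.1)) (idxL rows)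

variable {k : ℕ} {rows : List ℕ}

/-- The list `t` consists of the vertices after `s` with their rows. -/
def IsTail (k : ℕ) (rows : List ℕ) (s : ℕ) (t : List (ℕ × ℕ)) : Prop :=
  ∀ x : ℕ × ℕ, x ∈ t ↔ s < x.1 ∧ x.1 < k ∧ x.2 = rget rows x.1

lemma bits_lor (S : ℕ) (x : Fin k) : bits k (S ||| (1 <<< x.val)) = insert x (bits k S) := by
  ext i
  simp only [bits, Nat.testBit_or, Nat.one_shiftLeft, Nat.testBit_two_pow, Set.mem_ofPred_eq,
    Set.mem_insert_iff, Bool.or_eq_true, decide_eq_true_iff, Fin.ext_iff]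
  tauto

/-- `S` holds the vertices visited so far and `f 0` is the current one. The remaining `c` vertices
must be new, distinct and later than the start `s`; percolation is tested only once the cycle
closes. -/
lemma dfsN_iff (h : Valid k rows) {s : Fin k} {t : List (ℕ × ℕ)} (ht : IsTail k rows s t) (c : ℕ)
    (cur : Fin k) (S : ℕ) : dfsN k rows t s c (rget rows cur) S = true ↔
      ∃ f : ℕ → Fin k, f 0 = cur ∧ (∀ i < c, s < f (i + 1) ∧ (rg k rows).Adj (f i) (f (i + 1)) ∧
        f (i + 1) ∉ bits k S) ∧ (∀ i < c, ∀ j < i, f (i + 1) ≠ f (j + 1)) ∧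
          (rg k rows).Adj (f c) s ∧
            Percolates (rg k rows) (bits k S ∪ {v | ∃ i < c, f (i + 1) = v}) := by
  induction c generalizing cur S with
  | zero =>
    change (bif tb (rget rows cur) s then fullN two k rows S else false) = true ↔ _
    rw [cond_false_right, tb_eq, ← rg_adj h, ← percolates_iff h]
    constructor
    · rintro ⟨h1, h2⟩
      refine ⟨fun _ => cur, rfl, fun i hi => absurd hi (by omega), fun i hi => absurd hi (by omega),
        h1, ?_⟩
      simpa using h2
    · rintro ⟨f, rfl, -, -, h1, h2⟩
      exact ⟨h1, by simpa using h2⟩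
  | succ c ih =>
    change anyL (fun x => bif tb (rget rows cur) x.1 then bif tb S x.1 then false else
      force (dfsN k rows t s c x.2) (S ||| (1 <<< x.1)) else false) t = true ↔ _
    rw [anyL_iff]
    have hS : ∀ x : Fin k, x ∈ bits k S ↔ tb S x = true := fun x => by rw [tb_eq]; rfl
    have e : (∃ x ∈ t, (bif tb (rget rows cur) x.1 then bif tb S x.1 then false else
        force (dfsN k rows t s c x.2) (S ||| (1 <<< x.1)) else false) = true) ↔
        ∃ x : Fin k, s < x ∧ (rg k rows).Adj cur x ∧ x ∉ bits k S ∧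
          dfsN k rows t s c (rget rows x) (S ||| (1 <<< x.val)) = true := by
      constructor
      · rintro ⟨x, hx, h1⟩
        obtain ⟨h2, h3, h4⟩ := (ht x).1 hx
        rw [cond_false_right, force_eq, h4] at h1
        refine ⟨⟨x.1, h3⟩, h2, (rg_adj h).2 (by rw [← tb_eq]; exact h1.1), ?_, ?_⟩
        · rw [hS]
          intro h5
          change tb S x.1 = true at h5
          rw [h5] at h1
          cases h1.2
        · rcases h5 : tb S x.1 with _ | _ <;> rw [h5] at h1
          · exact h1.2
          · cases h1.2
      · rintro ⟨x, h1, h2, h3, h4⟩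
        refine ⟨(x.val, rget rows x), (ht _).2 ⟨h1, x.2, rfl⟩, ?_⟩
        rw [hS, Bool.not_eq_true] at h3
        rw [cond_false_right, force_eq, tb_eq]
        exact ⟨(rg_adj h).1 h2, by rw [h3]; exact h4⟩
    rw [e]
    constructor
    · rintro ⟨x, h1, h2, h3, h4⟩
      obtain ⟨g, hg0, hg1, hg2, hg3, hg4⟩ := (ih x _).1 h4
      rw [bits_lor] at hg4
      simp only [bits_lor, Set.mem_insert_iff, not_or] at hg1
      refine ⟨fun i => Nat.casesOn i cur g, rfl, fun i hi => ?_, fun i hi j hj => ?_, hg3, ?_⟩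
      · rcases i with _ | i
        · exact ⟨by rw [← hg0] at h1; exact h1, by rw [← hg0] at h2; exact h2,
            by rw [← hg0] at h3; exact h3⟩
        · obtain ⟨g1, g2, g3⟩ := hg1 i (by omega)
          exact ⟨g1, g2, g3.2⟩
      · rcases i with _ | i
        · omega
        rcases j with _ | j
        · have := (hg1 i (by omega)).2.2.1
          rw [← hg0] at this
          exact this
        · exact hg2 i (by omega) j (by omega)
      · refine Eq.mp (congrArg _ ?_) hg4
        ext v
        simp only [Set.mem_union, Set.mem_insert_iff, Set.mem_ofPred_eq]
        constructor
        · rintro ((rfl | hv) | ⟨i, hi, rfl⟩)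
          · exact .inr ⟨0, by omega, hg0⟩
          · exact .inl hv
          · exact .inr ⟨i + 1, by omega, rfl⟩
        · rintro (hv | ⟨i, hi, rfl⟩)
          · exact .inl (.inr hv)
          · rcases i with _ | i
            · exact .inl (.inl hg0)
            · exact .inr ⟨i, by omega, rfl⟩
    · rintro ⟨f, rfl, hf1, hf2, hf3, hf4⟩
      obtain ⟨a1, a2, a3⟩ := hf1 0 (by omega)
      refine ⟨f 1, a1, a2, a3, (ih _ _).2 ⟨fun i => f (i + 1), rfl, fun i hi => ?_,
        fun i hi j hj => hf2 (i + 1) (by omega) (j + 1) (by omega), hf3, ?_⟩⟩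
      · obtain ⟨b1, b2, b3⟩ := hf1 (i + 1) (by omega)
        refine ⟨b1, b2, ?_⟩
        rw [bits_lor, Set.mem_insert_iff, not_or]
        exact ⟨hf2 (i + 1) (by omega) 0 (by omega), b3⟩
      · refine Eq.mp (congrArg _ ?_) hf4
        rw [bits_lor]
        ext v
        simp only [Set.mem_union, Set.mem_insert_iff, Set.mem_ofPred_eq]
        constructor
        · rintro (hv | ⟨i, hi, rfl⟩)
          · exact .inl (.inr hv)
          · rcases i with _ | i
            · exact .inl (.inl rfl)
            · exact .inr ⟨i, by omega, rfl⟩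
        · rintro ((rfl | hv) | ⟨i, hi, rfl⟩)
          · exact .inr ⟨0, by omega, rfl⟩
          · exact .inl hv
          · exact .inr ⟨i + 1, by omega, rfl⟩

/-- The list handed over with a vertex is exactly that of the later vertices, which is what the
search requires. -/
lemma anyTails_idxL (h : rows.length = k) (p : ℕ × ℕ → List (ℕ × ℕ) → Bool)
    (P : Fin k → Prop) (hp : ∀ s : Fin k, ∀ t, IsTail k rows s t → (p (s, rget rows s) t = true ↔ P s)) :
    anyTails p (idxL rows) = true ↔ ∃ s, P s := by
  have key : ∀ (l : List ℕ) (off : ℕ), off + l.length = k → (∀ i, rget l i = rget rows (off + i)) →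
      (∀ x : ℕ × ℕ, x ∈ idxAux l off ↔ off ≤ x.1 ∧ x.1 < k ∧ x.2 = rget rows x.1) ∧
      (anyTails p (idxAux l off) = true ↔ ∃ s : Fin k, off ≤ s ∧ P s) := by
    intro l
    induction l with
    | nil =>
      intro off hk _
      rw [List.length_nil] at hk
      refine ⟨fun x => ⟨fun hx => absurd hx (by simp [idxAux]), fun hx => by omega⟩, ?_⟩
      exact ⟨fun h => Bool.noConfusion h, fun ⟨s, hs, _⟩ => absurd s.2 (by omega)⟩
    | cons r l ih =>
      intro off hk hr
      rw [List.length_cons] at hk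
      obtain ⟨h2, h3⟩ := ih (off + 1) (by omega) fun i => by
        rw [show off + 1 + i = off + (i + 1) by ring, ← hr, rget_cons_succ]
      have hr0 : r = rget rows off := hr 0
      refine ⟨fun x => ?_, ?_⟩
      · change x ∈ (off, r) :: idxAux l (off + 1) ↔ _
        rw [List.mem_cons, h2]
        constructor
        · rintro (rfl | ⟨a, b⟩)
          · exact ⟨le_rfl, (by omega), hr0⟩
          · exact ⟨(by omega), b⟩
        · rintro ⟨a, b, c⟩
          rcases a.eq_or_lt with e | a
          · exact .inl (Prod.ext e.symm (c.trans (by rw [← e, hr0])))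
          · exact .inr ⟨a, b, c⟩
      · have h4 : p (off, r) (idxAux l (off + 1)) = true ↔ P ⟨off, by omega⟩ := by
          rw [hr0]
          exact hp ⟨off, by omega⟩ _ h2
        refine (cond_true_left _ _).trans ((or_congr h4 h3).trans ?_)
        constructor
        · rintro (hP | ⟨s, hs, hP⟩)
          · exact ⟨_, le_rfl, hP⟩
          · exact ⟨s, by omega, hP⟩
        · rintro ⟨s, hs, hP⟩
          rcases hs.eq_or_lt with e | e
          · left
            rwa [show (⟨off, by omega⟩ : Fin k) = s from Fin.ext e]
          · exact .inr ⟨s, e, hP⟩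
  refine (key rows 0 (by omega) fun i => by rw [zero_add]).2.trans ?_
  simp

/-- A cycle may begin at its smallest vertex. -/
lemma CycleOn.exists_rotate {H : SimpleGraph (Fin k)} {m : ℕ} {f : ℕ → Fin k} (h : CycleOn H m f) :
    ∃ g, CycleOn H m g ∧ g '' Set.Iio m = f '' Set.Iio m ∧ ∀ i < m, 0 < i → g 0 < g i := by
  obtain ⟨h3, h0, hinj, hadj⟩ := h
  obtain ⟨a, ha, hmin⟩ := Finset.exists_min_image (Finset.range m) f ⟨0, by simp; omega⟩
  rw [Finset.mem_range] at ha
  have hmod : ∀ i, i % m < m := fun i => Nat.mod_lt _ (by omega)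
  -- The cycle is read modulo its length, with the minimal vertex at offset `a`; a shift modulo `m`
  -- is injective.
  have hinj' : ∀ i < m, ∀ j < m, f ((i + a) % m) = f ((j + a) % m) → i = j := by
    intro i hi j hj e
    have e1 := hinj (x₁ := (i + a) % m) (x₂ := (j + a) % m) (hmod _) (hmod _) e
    have e2 : i ≡ j [MOD m] := Nat.ModEq.add_right_cancel' a e1
    rwa [Nat.ModEq, Nat.mod_eq_of_lt hi, Nat.mod_eq_of_lt hj] at e2
  refine ⟨fun i => f ((i + a) % m), ⟨h3, ?_, fun i hi j hj e => hinj' i hi j hj e, ?_⟩, ?_, ?_⟩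
  · simp only [zero_add, Nat.add_mod_left]
  · intro i hi
    have e : f ((i + 1 + a) % m) = f ((i + a) % m + 1) := by
      have hlt := hmod (i + a)
      rw [show i + 1 + a = i + a + 1 by ring, Nat.add_mod, Nat.mod_eq_of_lt (b := m) (a := 1) (by omega)]
      rcases (Nat.succ_le_of_lt hlt).eq_or_lt with e | e
      · rw [show (i + a) % m + 1 = m from e, Nat.mod_self, h0]
      · rw [Nat.mod_eq_of_lt e]
    simp only
    rw [e]
    exact hadj _ (hmod _)
  · ext v
    constructor
    · rintro ⟨i, _, rfl⟩
      exact ⟨_, hmod _, rfl⟩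
    · rintro ⟨j, hj, rfl⟩
      refine ⟨(j + (m - a)) % m, hmod _, ?_⟩
      simp only [Nat.mod_add_mod]
      rw [show j + (m - a) + a = j + m by omega, Nat.add_mod_right, Nat.mod_eq_of_lt hj]
  · intro i hi hpos
    refine lt_of_le_of_ne ?_ fun e => hpos.ne (hinj' 0 (by omega) i hi e)
    simp only [zero_add, Nat.mod_eq_of_lt ha]
    exact hmin _ (Finset.mem_range.2 (hmod _))

/-- Every cycle can be rotated to begin at its smallest vertex, and then all other vertices lie in
the tail that is searched. -/
lemma percN_iff (h : Valid k rows) {c : ℕ} (hc : 2 ≤ c) :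
    percN k rows c = true ↔ PercCyc (rg k rows) (c + 1) := by
  rw [percN, anyTails_idxL h.1 _ _ fun s t ht => dfsN_iff h ht c s (1 <<< s.val)]
  have hb : ∀ s : Fin k, bits k (1 <<< s.val) = {s} := fun s => by
    have := bits_lor (k := k) 0 s
    rw [Nat.zero_or] at this
    rw [this]
    ext i
    simp [bits]
  have hset : ∀ f : ℕ → Fin k, ({f 0} : Set (Fin k)) ∪ {v | ∃ i < c, f (i + 1) = v} =
      f '' Set.Iio (c + 1) := fun f => by
    ext v
    simp only [Set.mem_union, Set.mem_singleton_iff, Set.mem_ofPred_eq, Set.mem_image, Set.mem_Iio]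
    constructor
    · rintro (rfl | ⟨i, hi, rfl⟩)
      · exact ⟨0, by omega, rfl⟩
      · exact ⟨i + 1, by omega, rfl⟩
    · rintro ⟨i, hi, rfl⟩
      rcases i with _ | i
      · exact .inl rfl
      · exact .inr ⟨i, by omega, rfl⟩
  constructor
  · rintro ⟨s, f, rfl, hf1, hf2, hf3, hf4⟩
    rw [hb, hset] at hf4
    -- The search path has no value prescribed at `c + 1`; it is reset to the start there, as a
    -- closed cycle requires.
    let F : ℕ → Fin k := fun i => if i = c + 1 then f 0 else f i
    have hF : ∀ i < c + 1, F i = f i := fun i hi => if_neg (by omega)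
    refine ⟨F, ⟨by omega, ?_, ?_, ?_⟩, ?_⟩
    · rw [hF 0 (by omega)]
      exact if_pos rfl
    · have hne : ∀ i < c + 1, ∀ j < i, f i ≠ f j := by
        intro i hi j hj
        rcases i with _ | i
        · omega
        rcases j with _ | j
        · exact (hf1 i (by omega)).1.ne'
        · exact hf2 i (by omega) j (by omega)
      intro i hi j hj e
      rw [hF i hi, hF j hj] at e
      rcases lt_trichotomy i j with hij | hij | hij
      · exact absurd e.symm (hne j hj i hij)
      · exact hij
      · exact absurd e (hne i hi j hij)
    · intro i hi
      rw [hF i hi]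
      rcases Nat.lt_succ_iff_lt_or_eq.1 hi with hi' | rfl
      · rw [hF (i + 1) (by omega)]
        exact (hf1 i hi').2.1
      · rw [show F (i + 1) = f 0 from if_pos rfl]
        exact hf3
    · rwa [Set.image_congr (f := F) (g := f) (s := Set.Iio (c + 1)) fun i hi => hF i hi]
  · rintro ⟨f, hf, hp⟩
    obtain ⟨g, ⟨-, g0, ginj, gadj⟩, himg, hlt⟩ := hf.exists_rotate
    refine ⟨g 0, g, rfl, fun i hi => ⟨hlt (i + 1) (by omega) (by omega), gadj i (by omega), ?_⟩,
      fun i hi j hj e => ?_, ?_, ?_⟩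
    · rw [hb, Set.mem_singleton_iff]
      exact (hlt (i + 1) (by omega) (by omega)).ne'
    · have := ginj (x₁ := i + 1) (x₂ := j + 1) (by simp; omega) (by simp; omega) e
      omega
    · have := gadj c (by omega)
      rwa [g0] at this
    · rwa [hb, hset, himg]

end Search

end TrappingSets

namespace TrappingSets

/-! ### The smallest percolating cycle determines the type -/

section Types

variable {k : ℕ} {rows : List ℕ}

/-- The smallest length of a percolating cycle with more than `c` vertices, or zero. -/
noncomputable def typeAux (k : ℕ) (rows : List ℕ) (m : ℕ) : ℕ → ℕ :=
  Nat.rec (motive := fun _ => ℕ → ℕ) (fun _ => 0)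
    (fun _ ih c => bif percN k rows c then Nat.succ c else force ih (Nat.succ c)) m

/-- The smallest length of a percolating cycle, or zero if there is none. -/
noncomputable def lenN (k : ℕ) (rows : List ℕ) : ℕ := typeAux k rows (k - 2) 2

/-- The `m` tests cover the lengths from c + 1 to c + m, and zero reports that all of them failed.
-/
lemma typeAux_spec (h : Valid k rows) (m c : ℕ) (hc : 2 ≤ c) :
    (typeAux k rows m c = 0 ∧ ∀ j, c < j → j ≤ c + m → ¬ PercCyc (rg k rows) j) ∨
      (c < typeAux k rows m c ∧ PercCyc (rg k rows) (typeAux k rows m c) ∧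
        ∀ j, c < j → j < typeAux k rows m c → ¬ PercCyc (rg k rows) j) := by
  induction m generalizing c with
  | zero => exact .inl ⟨rfl, fun j h1 h2 => by omega⟩
  | succ m ih =>
    have e : typeAux k rows (m + 1) c =
        bif percN k rows c then c + 1 else typeAux k rows m (c + 1) := by
      change (bif percN k rows c then c + 1 else force (typeAux k rows m) (c + 1)) = _
      rw [force_eq]
    rw [e]
    rcases hp : percN k rows c with _ | _
    · have hn : ¬ PercCyc (rg k rows) (c + 1) := by
        rw [← percN_iff h hc, hp]
        simp
      have hstep : ∀ j, c < j → j = c + 1 ∨ c + 1 < j := fun j hj => by omega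
      rw [cond_false]
      rcases ih (c + 1) (by omega) with ⟨h1, h2⟩ | ⟨h1, h2, h3⟩
      · refine .inl ⟨h1, fun j hj hj' => ?_⟩
        rcases hstep j hj with rfl | hj
        · exact hn
        · exact h2 j hj (by omega)
      · refine .inr ⟨by omega, h2, fun j hj hj' => ?_⟩
        rcases hstep j hj with rfl | hj
        · exact hn
        · exact h3 j hj hj'
    · rw [cond_true]
      exact .inr ⟨by omega, (percN_iff h hc).1 hp, fun j h1 h2 => by omega⟩

lemma PercCyc.le_card {H : SimpleGraph (Fin k)} {m : ℕ} (h : PercCyc H m) : m ≤ k := by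
  obtain ⟨f, ⟨-, -, hinj, -⟩, -⟩ := h
  have := Set.ncard_le_ncard_of_injOn (s := Set.Iio m) (t := Set.univ) f (fun _ _ => trivial) hinj
    (Set.toFinite _)
  rwa [Set.ncard_univ, Nat.card_fin, Set.ncard_eq_toFinset_card', Set.toFinset_Iio,
    Nat.card_Iio] at this

lemma PercCyc.three_le {V : Type*} {H : SimpleGraph V} {m : ℕ} (h : PercCyc H m) : 3 ≤ m := by
  obtain ⟨f, hf, -⟩ := h
  exact hf.1

/-- The type that belongs to the smallest length of a percolating cycle. -/
def ofLength (T : ℕ) : Option ℕ := if T = 0 then none else some (2 * T)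

/-- The lengths from 3 to `k` are all tested, and no cycle is longer than the number of vertices. -/
lemma graphType_iff (h : Valid k rows) (t : Option ℕ) :
    GraphType (rg k rows) t ↔ ofLength (lenN k rows) = t := by
  have hspec := typeAux_spec h (k - 2) 2 le_rfl
  change (lenN k rows = 0 ∧ _) ∨ (2 < lenN k rows ∧ PercCyc (rg k rows) (lenN k rows) ∧
    ∀ j, 2 < j → j < lenN k rows → ¬ PercCyc (rg k rows) j) at hspec
  generalize lenN k rows = T at hspec ⊢
  rcases hspec with ⟨rfl, h2⟩ | ⟨h1, h2, h3⟩
  · have hno : ∀ j, ¬ PercCyc (rg k rows) j := fun j hj =>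
      h2 j hj.three_le (by have := hj.le_card; have := hj.three_le; omega) hj
    rcases t with _ | x
    · exact iff_of_true hno rfl
    · refine iff_of_false ?_ (by simp [ofLength])
      rintro ⟨⟨j, -, hj⟩, -⟩
      exact hno j hj
  · have hl : IsLeast {y | ∃ j, y = 2 * j ∧ PercCyc (rg k rows) j} (2 * T) := by
      refine ⟨⟨T, rfl, h2⟩, ?_⟩
      rintro _ ⟨j, rfl, hj⟩
      by_contra hlt
      exact h3 j hj.three_le (by omega) hj
    have hT : T ≠ 0 := by omega
    rw [ofLength, if_neg hT]
    rcases t with _ | x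
    · exact iff_of_false (fun hn => hn T h2) (by simp)
    · rw [Option.some.injEq]
      exact ⟨fun hx => hl.unique hx, fun e => e ▸ hl⟩

lemma graphType_six_iff {V : Type*} (H : SimpleGraph V) :
    GraphType H (some 6) ↔ PercCyc H 3 := by
  constructor
  · rintro ⟨⟨j, hj, h⟩, -⟩
    rwa [show j = 3 by omega] at h
  · refine fun h => ⟨⟨3, rfl, h⟩, ?_⟩
    rintro _ ⟨j, rfl, hj⟩
    have := hj.three_le
    omega

lemma GraphType.eq_six {V : Type*} {H : SimpleGraph V} {t : Option ℕ} (h : GraphType H t)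
    (h3 : PercCyc H 3) : t = some 6 := by
  rcases t with _ | x
  · exact absurd h3 (h 3)
  · exact congrArg some (h.unique ((graphType_six_iff H).2 h3))

lemma graphType_iso {V W : Type*} {H : SimpleGraph V} {K : SimpleGraph W} (φ : H ≃g K)
    (t : Option ℕ) : GraphType H t ↔ GraphType K t := by
  rcases t with _ | x
  · exact forall_congr' fun k => not_congr (percCyc_iso φ k)
  · simp only [GraphType, percCyc_iso φ]

/-- The component of the cycle is two-closed, hence everything. So graphs with a percolating
triangle can be counted without testing connectedness. -/
lemma PercCyc.connected {V : Type*} {H : SimpleGraph V} {m : ℕ} (h : PercCyc H m) :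
    H.Connected := by
  obtain ⟨f, ⟨h3, h0, -, hadj⟩, hp⟩ := h
  have hall := hp {v | H.Reachable (f 0) v} (fun v u w hu _ _ hvu _ => hu.trans hvu.symm.reachable) (by
    rintro _ ⟨i, hi, rfl⟩
    have hi' : i < m := hi
    clear hi
    induction i with
    | zero => exact SimpleGraph.Reachable.refl _
    | succ i ih => exact (ih (by omega)).trans (hadj i (by omega)).reachable)
  have hr : ∀ v, H.Reachable (f 0) v := Set.eq_univ_iff_forall.1 hall
  have : Nonempty V := ⟨f 0⟩
  exact ⟨fun u v => (hr u).symm.trans (hr v)⟩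

end Types

/-! ### A numerical invariant that separates the exceptional graphs -/

section Invariant

/-- The sum of the squares of the numbers of common neighbours. -/
noncomputable def codeg {k : ℕ} (H : SimpleGraph (Fin k)) (v : Fin k) : ℕ :=
  ∑ u, (H.neighborSet v ∩ H.neighborSet u).ncard ^ 2

open Classical in
/-- A numerical invariant of graphs. -/
noncomputable def graphInv {k : ℕ} (H : SimpleGraph (Fin k)) : ℕ :=
  ∑ v, (codeg H v + ∑ u, if H.Adj v u then codeg H u ^ 2 else 0) ^ 2

lemma graphInv_iso {k : ℕ} {H K : SimpleGraph (Fin k)} (φ : H ≃g K) : graphInv K = graphInv H := by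
  classical
  have hn : ∀ v, K.neighborSet (φ v) = φ '' H.neighborSet v := fun v => by
    ext w
    obtain ⟨w, rfl⟩ := φ.surjective w
    rw [φ.injective.mem_set_image]
    exact φ.map_adj_iff
  have hc : ∀ v, codeg K (φ v) = codeg H v := fun v => by
    rw [codeg, ← Equiv.sum_comp φ.toEquiv]
    refine Finset.sum_congr rfl fun u _ => ?_
    change (K.neighborSet (φ v) ∩ K.neighborSet (φ u)).ncard ^ 2 = _
    rw [hn, hn, ← Set.image_inter φ.injective, Set.ncard_image_of_injective _ φ.injective]
  rw [graphInv, ← Equiv.sum_comp φ.toEquiv]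
  refine Finset.sum_congr rfl fun v _ => ?_
  rw [← Equiv.sum_comp φ.toEquiv]
  change (codeg K (φ v) + ∑ u, if K.Adj (φ v) (φ u) then codeg K (φ u) ^ 2 else 0) ^ 2 = _
  simp only [hc, φ.map_adj_iff]

/-- The square of a number. -/
def sqN (x : ℕ) : ℕ := Nat.mul x x

/-- The sum of the squares of the entries of a list at the bits of `r`. -/
noncomputable def dotN (l : List ℕ) : ℕ → ℕ :=
  List.rec (motive := fun _ => ℕ → ℕ) (fun _ => 0)
    (fun a _ ih r => Nat.add (Nat.mul (Nat.land r 1) (sqN a)) (ih (Nat.shiftRight r 1))) l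

/-- The sum of squares in the definition of the invariant. -/
noncomputable def sumInv (cs rows : List ℕ) : List ℕ → ℕ :=
  List.rec (motive := fun _ => List ℕ → ℕ) (fun _ => 0)
    (fun r _ ih l => List.rec (motive := fun _ => ℕ) 0
      (fun a l _ => Nat.add (sqN (Nat.add a (dotN cs r))) (ih l)) l) rows

/-- The invariant of the graph with the given rows. -/
noncomputable def invN (k : ℕ) (rows : List ℕ) : ℕ :=
  forceL (mapL (fun r => sumL (mapL (fun r' => sqN (pc k (Nat.land r r'))) rows)) rows) fun cs =>
    sumInv cs rows cs

variable {k : ℕ} {rows : List ℕ}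

lemma sum_map_eq (h : rows.length = k) (g : ℕ → ℕ) :
    (rows.map g).sum = ∑ i : Fin k, g (rget rows i) := by
  rw [← List.sum_ofFn]
  congr 1
  refine List.ext_getElem (by simp [h]) fun i h1 h2 => ?_
  have hi : i < rows.length := by simpa using h1
  rw [List.getElem_ofFn, List.getElem_map]
  change _ = g (nthP 0 rows i)
  rw [nthP_eq, List.getD_eq_getElem _ _ hi]

lemma dotN_eq (l : List ℕ) (r : ℕ) :
    dotN l r = ∑ i : Fin l.length, if r.testBit i = true then rget l i ^ 2 else 0 := by
  induction l generalizing r with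
  | nil => rfl
  | cons a l ih =>
    change (r &&& 1) * (a * a) + dotN l (r >>> 1) = _
    rw [ih, List.length_cons, Fin.sum_univ_succ, Nat.and_one_is_mod]
    congr 1
    · rw [Fin.val_zero, Nat.testBit_zero]
      change _ = if _ then a ^ 2 else 0
      rcases Nat.mod_two_eq_zero_or_one r with h | h <;> simp [h, sq]
    · refine Finset.sum_congr rfl fun i _ => ?_
      rw [Nat.testBit_shiftRight, add_comm 1]
      rfl

lemma sumInv_eq (cs rows l : List ℕ) (h : rows.length = l.length) :
    sumInv cs rows l = ∑ i : Fin l.length, (rget l i + dotN cs (rget rows i)) ^ 2 := by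
  induction rows generalizing l with
  | nil =>
    rcases l with _ | ⟨a, l⟩
    · rfl
    · simp at h
  | cons r rows ih =>
    rcases l with _ | ⟨a, l⟩
    · simp at h
    · change (a + dotN cs r) * (a + dotN cs r) + sumInv cs rows l = _
      rw [ih l (by simpa using h), ← sq]
      exact (Fin.sum_univ_succ (n := l.length) fun i : Fin (l.length + 1) =>
        (rget (a :: l) i + dotN cs (rget (r :: rows) i)) ^ 2).symm

lemma rget_map {rows : List ℕ} {i : ℕ} (hi : i < rows.length) (g : ℕ → ℕ) :
    rget (rows.map g) i = g (rget rows i) := by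
  rw [rget, rget, nthP_eq, nthP_eq, List.getD_eq_getElem _ _ (by simpa using hi), List.getElem_map,
    List.getD_eq_getElem _ _ hi]

/-- Common neighbours of two vertices are the common bits of their rows. -/
lemma invN_eq (h : Valid k rows) : invN k rows = graphInv (rg k rows) := by
  classical
  have hset : ∀ v u : Fin k, (rg k rows).neighborSet v ∩ (rg k rows).neighborSet u =
      {i : Fin k | (rget rows v &&& rget rows u).testBit i = true} := fun v u => by
    ext i
    rw [Set.mem_inter_iff, SimpleGraph.mem_neighborSet, SimpleGraph.mem_neighborSet, rg_adj h,
      rg_adj h, Set.mem_ofPred_eq, Nat.testBit_and, Bool.and_eq_true]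
  have hc : ∀ v : Fin k, codeg (rg k rows) v =
      (rows.map fun r' => sqN (pc k (Nat.land (rget rows v) r'))).sum := fun v => by
    rw [sum_map_eq h.1, codeg]
    refine Finset.sum_congr rfl fun u _ => ?_
    rw [hset, ← pc_eq_ncard, sq]
    rfl
  obtain ⟨hlen, -⟩ := id h
  subst hlen
  set cs := rows.map fun r => (rows.map fun r' => sqN (pc rows.length (Nat.land r r'))).sum with hcs
  have hcs' : ∀ v : Fin rows.length, rget cs v = codeg (rg rows.length rows) v := fun v => by
    rw [hcs, rget_map v.2, hc]
  have e : invN rows.length rows = sumInv cs rows cs := by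
    rw [invN, forceL_eq]
    simp only [mapL_eq, sumL_eq]
    rfl
  have hl : cs.length = rows.length := by simp [hcs]
  rw [e, sumInv_eq _ _ _ hl.symm, graphInv]
  refine Fintype.sum_equiv (finCongr hl) _ _ fun v => ?_
  rw [dotN_eq]
  congr 2
  · exact hcs' (finCongr hl v)
  · refine Fintype.sum_equiv (finCongr hl) _ _ fun u => ?_
    refine if_congr (rg_adj h (i := finCongr hl v) (j := finCongr hl u)).symm ?_ rfl
    rw [← hcs' (finCongr hl u)]
    rfl

end Invariant

end TrappingSets

namespace TrappingSets

/-! ### The exceptional graphs and their tags -/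

section Exceptional

/-- The degrees are between two and five, the degree sum is large, and no triangle percolates. -/
noncomputable def excTest (k : ℕ) (rows : List ℕ) : Bool :=
  bif allL (fun r => force (fun d => bif Nat.ble 2 d then Nat.ble d 5 else false) (pc k r)) rows then
    bif Nat.ble (Nat.mul 5 k) (Nat.add (sumL (mapL (pc k) rows)) 9) then !(percN k rows 2) else false
  else false

/-- The codes of the exceptional graphs. -/
noncomputable def excN (k : ℕ) : List ℕ :=
  filterL (fun N => forceL (rowsN k N) (excTest k)) (codes k)

/-- The deficit of the degree sum, plus ten times the smallest length of a percolating cycle, plus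
two hundred if all degrees are at least three. -/
noncomputable def tagRows (k : ℕ) (rows : List ℕ) : ℕ :=
  -- A disconnected graph gets 1 in place of the length, a value that `lenN` never takes. The only
  -- such tag is 19, for the disjoint union of a triangle and a complete graph on six vertices.
  Nat.add (Nat.sub (Nat.mul 5 k) (sumL (mapL (pc k) rows)))
    (Nat.add (Nat.mul 10 (bif fullN nz k rows 1 then lenN k rows else 1))
      (bif allL (fun r => Nat.ble 3 (pc k r)) rows then 200 else 0))

/-- The tag of the graph with the code `N`. -/
noncomputable def tagN (k N : ℕ) : ℕ := forceL (rowsN k N) (tagRows k)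

/-- The list is strictly increasing. -/
noncomputable def incN (l : List ℕ) : ℕ → Bool :=
  List.rec (motive := fun _ => ℕ → Bool) (fun _ => true)
    (fun a _ ih prev => force (fun a => bif Nat.blt prev a then ih a else false) a) l

/-- The tags of the exceptional graphs. -/
def tags : ℕ → List ℕ
  | 7 =>
    [49]
  | 8 =>
    [248, 248, 248, 58, 48, 8, 58, 48, 56]
  | 9 =>
    [249, 249, 249, 249, 249, 249, 259, 249, 49, 249, 249, 49, 49, 249, 249, 249, 249, 249, 249,
     249, 249, 247, 249, 247, 259, 249, 249, 249, 259, 249, 249, 249, 259, 249, 249, 249, 49,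
     249, 209, 249, 259, 259, 247, 259, 59, 249, 49, 49, 59, 59, 249, 49, 49, 49, 49, 9, 247, 59,
     59, 49, 49, 9, 9, 9, 59, 49, 59, 59, 59, 49, 49, 59, 59, 59, 49, 9, 59, 59, 49, 49, 59, 245,
     59, 49, 69, 49, 49, 49, 249, 9, 59, 59, 59, 49, 9, 59, 59, 49, 59, 9, 69, 9, 59, 49, 49, 59,
     59, 49, 9, 9, 49, 69, 9, 59, 9, 69, 49, 249, 49, 247, 59, 59, 59, 59, 59, 49, 9, 257, 59,
     49, 247, 9, 59, 49, 69, 59, 59, 9, 69, 59, 9, 57, 47, 57, 57, 47, 7, 247, 57, 7, 67, 9, 69,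
     57, 7, 245, 19]
  | _ => []

lemma tags_eq : ∀ k ∈ [4, 5, 6, 7, 8, 9], mapL (tagN k) (excN k) = tags k := by decide +kernel

/-- The codes of the exceptional graphs are stored in increasing order of the invariant, so
comparing neighbours in the list proves all values distinct. -/
lemma incN_excN : ∀ k ∈ [4, 5, 6, 7, 8, 9],
    incN (mapL (fun N => forceL (rowsN k N) (invN k)) (excN k)) 0 = true := by decide +kernel

lemma nodup_of_incN (l : List ℕ) (p : ℕ) (h : incN l p = true) :
    l.Nodup ∧ ∀ a ∈ l, p < a := by
  induction l generalizing p with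
  | nil => simp
  | cons a l ih =>
    change force (fun a => bif Nat.blt p a then incN l a else false) a = true at h
    rw [force_eq, cond_false_right] at h
    obtain ⟨h1, h2⟩ := ih a h.2
    have hpa : p < a := Nat.le_of_ble_eq_true h.1
    refine ⟨List.nodup_cons.2 ⟨fun ha => lt_irrefl _ (h2 a ha), h1⟩, fun b hb => ?_⟩
    rcases List.mem_cons.1 hb with rfl | hb
    · exact hpa
    · exact hpa.trans (h2 b hb)

variable {k : ℕ}

lemma nodup_inv (hk : k ∈ [4, 5, 6, 7, 8, 9]) :
    ((excN k).map fun N => graphInv (rg k (rowsN k N))).Nodup := by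
  have h := (nodup_of_incN _ _ (incN_excN k hk)).1
  rw [mapL_eq] at h
  simpa only [forceL_eq, invN_eq (valid_rowsN k _)] using h

lemma allL_rows {rows : List ℕ} (h : Valid k rows) (p : ℕ → Bool) :
    allL p rows = true ↔ ∀ v : Fin k, p (rget rows v) = true := by
  have hr : ∀ i (hi : i < rows.length), rget rows i = rows[i] := fun i hi => by
    rw [rget, nthP_eq, List.getD_eq_getElem _ _ hi]
  rw [allL_iff]
  constructor
  · intro hp v
    have hv : v.val < rows.length := by rw [h.1]; exact v.2
    rw [hr v hv]
    exact hp _ (List.getElem_mem hv)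
  · intro hp a ha
    obtain ⟨i, hi, rfl⟩ := List.getElem_of_mem ha
    rw [← hr i hi]
    exact hp ⟨i, by rw [← h.1]; exact hi⟩

lemma mem_excN {N : ℕ} : N ∈ excN k ↔ N ∈ codes k ∧
    (∀ v, 2 ≤ ndeg (rg k (rowsN k N)) v ∧ ndeg (rg k (rowsN k N)) v ≤ 5) ∧
      5 * k ≤ dsum (rg k (rowsN k N)) + 9 ∧ ¬ PercCyc (rg k (rowsN k N)) 3 := by
  have hV := valid_rowsN k N
  rw [excN, filterL_eq, List.mem_filter, forceL_eq, excTest, cond_false_right, cond_false_right,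
    allL_rows hV, mapL_eq, sumL_eq, ← sum_ndeg_rg hV, ← percN_iff hV le_rfl]
  simp only [force_eq, cond_false_right, ← ndeg_rg hV, Nat.ble_eq, Bool.not_eq_true']
  rw [Bool.not_eq_true]
  rfl

lemma tagN_spec (N : ℕ) :
    tagN k N = (5 * k - dsum (rg k (rowsN k N))) +
      (10 * (bif fullN nz k (rowsN k N) 1 then lenN k (rowsN k N) else 1) +
        bif allL (fun r => Nat.ble 3 (pc k r)) (rowsN k N) then 200 else 0) := by
  rw [tagN, forceL_eq, tagRows, mapL_eq, sumL_eq, ← sum_ndeg_rg (valid_rowsN k N)]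
  rfl

lemma lenN_le (k : ℕ) (rows : List ℕ) (h : Valid k rows) : lenN k rows ≤ k ∧ lenN k rows ≠ 1 := by
  rcases typeAux_spec h (k - 2) 2 le_rfl with ⟨h1, -⟩ | ⟨h1, h2, -⟩
  · exact ⟨(show lenN k rows = 0 from h1) ▸ Nat.zero_le _, by rw [lenN, h1]; omega⟩
  · exact ⟨h2.le_card, by rw [lenN]; omega⟩

/-- The properties of an exceptional graph that can be read off from its tag. -/
lemma tagN_iff {N : ℕ} (hk : k ∈ [4, 5, 6, 7, 8, 9]) (hN : N ∈ excN k) :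
    (∀ b, b + dsum (rg k (rowsN k N)) = 5 * k ↔ tagN k N % 10 = b) ∧
      ((rg k (rowsN k N)).Connected ↔ tagN k N / 10 % 20 ≠ 1) ∧
        ((rg k (rowsN k N)).Connected → ∀ t, GraphType (rg k (rowsN k N)) t ↔
          ofLength (tagN k N / 10 % 20) = t) ∧
            ((∀ v, 3 ≤ ndeg (rg k (rowsN k N)) v) ↔ 200 ≤ tagN k N) := by
  have hV := valid_rowsN k N
  have hk4 : 0 < k ∧ k ≤ 9 := by
    simp only [List.mem_cons, List.not_mem_nil, or_false] at hk
    omega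
  obtain ⟨-, h5, h9, -⟩ := mem_excN.1 hN
  have hD : dsum (rg k (rowsN k N)) ≤ 5 * k := by
    rw [dsum]
    refine (Finset.sum_le_sum fun v _ => (h5 v).2).trans ?_
    simp [mul_comm]
  have h3 : (∀ v, 3 ≤ ndeg (rg k (rowsN k N)) v) ↔
      allL (fun r => Nat.ble 3 (pc k r)) (rowsN k N) = true := by
    rw [allL_rows hV]
    simp only [← ndeg_rg hV, Nat.ble_eq]
  rw [tagN_spec, h3, connected_iff_fullN hV hk4.1]
  have hl := lenN_le k _ hV
  simp only [graphType_iff hV]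
  generalize dsum (rg k (rowsN k N)) = D at *
  generalize lenN k (rowsN k N) = T at *
  rcases fullN nz k (rowsN k N) 1 with _ | _ <;>
    rcases allL (fun r => Nat.ble 3 (pc k r)) (rowsN k N) with _ | _ <;>
      simp only [cond_true, cond_false, true_implies, false_implies, Bool.false_eq_true, true_iff,
        false_iff, true_and]
  · exact ⟨fun b => by omega, by omega, by omega⟩
  · exact ⟨fun b => by omega, by omega, by omega⟩
  -- The deficit is a single digit and T is at most 9, so the three parts of the tag do not overlap.
  · have e : (5 * k - D + (10 * T + 0)) / 10 % 20 = T := by omega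
    rw [e]
    exact ⟨fun b => by omega, hl.2, fun _ => Iff.rfl, by omega⟩
  · have e : (5 * k - D + (10 * T + 200)) / 10 % 20 = T := by omega
    rw [e]
    exact ⟨fun b => by omega, hl.2, fun _ => Iff.rfl, by omega⟩

lemma percCyc_three {V : Type*} {H : SimpleGraph V} {x y z : V} (h1 : H.Adj x y) (h2 : H.Adj x z)
    (h3 : H.Adj y z) (hp : Percolates H {x, y, z}) : PercCyc H 3 := by
  let f : ℕ → V := fun i => if i = 1 then y else if i = 2 then z else x
  have f0 : f 0 = x := rfl
  have f1 : f 1 = y := rfl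
  have f2 : f 2 = z := rfl
  have f3 : f 3 = x := rfl
  refine ⟨f, ⟨le_rfl, rfl, ?_, ?_⟩, fun A hA hsub => hp A hA ?_⟩
  · intro i hi j hj e
    have hi' : i < 3 := hi
    have hj' : j < 3 := hj
    interval_cases i <;> interval_cases j <;> simp only [f0, f1, f2] at e
    exacts [rfl, absurd e h1.ne, absurd e h2.ne, absurd e h1.ne', rfl, absurd e h3.ne,
      absurd e h2.ne', absurd e h3.ne', rfl]
  · intro i hi
    interval_cases i
    exacts [h1, h3, h2.symm]
  · rintro v (rfl | rfl | rfl)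
    · exact hsub ⟨0, by simp, rfl⟩
    · exact hsub ⟨1, by simp, rfl⟩
    · exact hsub ⟨2, by simp, rfl⟩

/-- A triangle that does not percolate lies in a proper two-closed set, which misses at least one
vertex. -/
lemma np_of_not_percCyc {H : SimpleGraph (Fin (k + 1))} (h : ¬ PercCyc H 3) : NP k H := by
  intro x y z h1 h2 h3
  have hp : ¬ Percolates H {x, y, z} := fun hp => h (percCyc_three h1 h2 h3 hp)
  unfold Percolates at hp
  push Not at hp
  obtain ⟨A, hA, hsub, hne⟩ := hp
  refine ⟨A, hA, hsub (by simp), hsub (by simp), hsub (by simp), ?_⟩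
  have : A.ncard < (Set.univ : Set (Fin (k + 1))).ncard :=
    Set.ncard_lt_ncard (Set.ssubset_univ_iff.2 hne) (Set.toFinite _)
  rw [Set.ncard_univ, Nat.card_fin] at this
  omega

/-- A closed set missing exactly one vertex would leave that vertex with at most one neighbour. -/
lemma np_of_degree {n c : ℕ} {H : SimpleGraph (Fin n)} (h : NP (c + 1) H) (hd : ∀ v, 2 ≤ ndeg H v)
    (hn : n = c + 2) : NP c H := by
  by_contra h'
  obtain ⟨v, hv⟩ := exists_small_degree h h' (by omega)
  have := hd v
  omega

/-- The exceptional graphs belong to the classes. -/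
lemma cls_of_not_percCyc {b : ℕ} (h4 : 4 ≤ k) (h9 : k ≤ 9) (hb : b ≤ 9) {H : SimpleGraph (Fin k)}
    (hH : Bounded 2 b H) (hp : ¬ PercCyc H 3) : Cls k H := by
  obtain ⟨hd, hs⟩ := hH
  refine ⟨fun v => (hd v).2, ?_, ?_⟩
  · interval_cases k <;> simp only [thr] <;> omega
  · interval_cases k
    all_goals try trivial
    · exact .inl (np_of_not_percCyc hp)
    · have h7 := np_of_not_percCyc hp
      exact ⟨h7, .inl (np_of_degree h7 (fun v => (hd v).1) rfl)⟩
    · exact ⟨np_of_degree (np_of_not_percCyc hp) (fun v => (hd v).1) rfl, fun v => (hd v).1⟩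

/-- The defining conditions of `excN` are invariant, so they pass to the listed copy of the graph.
-/
lemma exists_excN {b : ℕ} (h4 : 4 ≤ k) (h9 : k ≤ 9) (hb : b ≤ 9) {H : SimpleGraph (Fin k)}
    (hH : Bounded 2 b H) (hp : ¬ PercCyc H 3) :
    ∃ N ∈ excN k, Nonempty (H ≃g rg k (rowsN k N)) := by
  obtain ⟨N, hN, ⟨φ⟩⟩ := complete_codes h9 H (cls_of_not_percCyc h4 h9 hb hH hp)
  have hK := (bounded_isoInvariant 2 b H _ ⟨φ⟩).1 hH
  refine ⟨N, mem_excN.2 ⟨hN, hK.1, ?_, fun h => hp ((percCyc_iso φ 3).2 h)⟩, ⟨φ⟩⟩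
  have := hK.2
  omega

/-- The numbers of exceptional graphs with an invariant property. -/
theorem numClasses_exc {b : ℕ} (h4 : 4 ≤ k) (h9 : k ≤ 9) (hb : b ≤ 9)
    {Q : SimpleGraph (Fin k) → Prop} (hQ : IsoInvariant Q) (p : ℕ → Bool)
    (hp : ∀ N ∈ excN k, tagN k N % 10 = b → (Q (rg k (rowsN k N)) ↔ p (tagN k N) = true)) :
    numClasses (fun H => (Bounded 2 b H ∧ ¬ PercCyc H 3) ∧ Q H) =
      ((tags k).filter fun t => Nat.beq (t % 10) b && p t).length := by
  have hmem : k ∈ [4, 5, 6, 7, 8, 9] := by interval_cases k <;> simp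
  have hinv := nodup_inv hmem
  have hnd := hinv.of_map _
  rw [← tags_eq k hmem, mapL_eq, List.filter_map, List.length_map,
    ← List.toFinset_card_of_nodup (hnd.filter _), ← Set.ncard_coe_finset, numClasses]
  symm
  refine Set.ncard_congr (fun N _ => Quotient.mk (graphSetoid k) (rg k (rowsN k N))) ?_ ?_ ?_
  · intro N hN
    rw [Finset.mem_coe, List.mem_toFinset, List.mem_filter, Function.comp_apply, Bool.and_eq_true,
      Nat.beq_eq] at hN
    obtain ⟨hN, hb', hpN⟩ := hN
    obtain ⟨-, h5, -, hperc⟩ := mem_excN.1 hN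
    exact ⟨_, ⟨⟨⟨h5, ((tagN_iff hmem hN).1 b).2 hb'⟩, hperc⟩, (hp N hN hb').2 hpN⟩, rfl⟩
  · intro N M hN hM e
    rw [Finset.mem_coe, List.mem_toFinset, List.mem_filter] at hN hM
    obtain ⟨φ⟩ : Nonempty (rg k (rowsN k N) ≃g rg k (rowsN k M)) := Quotient.exact e
    -- Isomorphic listed graphs have equal invariants, hence equal codes.
    exact List.inj_on_of_nodup_map hinv hN.1 hM.1 (graphInv_iso φ).symm
  · rintro _ ⟨H, ⟨⟨hH, hperc⟩, hQH⟩, rfl⟩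
    obtain ⟨N, hN, hφ⟩ := exists_excN h4 h9 hb hH hperc
    have hb' := ((tagN_iff hmem hN).1 b).1 ((bounded_isoInvariant 2 b H _ hφ).1 hH).2
    refine ⟨N, ?_, Quotient.sound ⟨(Classical.choice hφ).symm⟩⟩
    rw [Finset.mem_coe, List.mem_toFinset, List.mem_filter, Function.comp_apply, Bool.and_eq_true,
      Nat.beq_eq]
    exact ⟨hN, hb', (hp N hN hb').1 ((hQ H _ hφ).1 hQH)⟩

end Exceptional

end TrappingSets

namespace TrappingSets

/-! ### Assembling the table -/

section Counting

variable {a b d : ℕ}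

/-- The normal graphs of minimum degree at least `d` and of type `t`. -/
def TypedNormal (a b d : ℕ) (t : Option ℕ) (H : SimpleGraph (Fin a)) : Prop :=
  Normal a b H ∧ (∀ v, d ≤ ndeg H v) ∧ GraphType H t

/-- A tag encodes a graph with all degrees at least `d`, for `d = 2, 3`. -/
def tagDegree (d t : ℕ) : Bool := Nat.beq d 2 || Nat.ble 200 t

/-- A tag encodes a connected graph of type `T`. -/
def tagType (T : Option ℕ) (t : ℕ) : Bool :=
  !Nat.beq (t / 10 % 20) 1 && decide (ofLength (t / 10 % 20) = T)

/-- The number of tags of the class `b` with the property `p`. -/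
def tagCount (k b : ℕ) (p : ℕ → Bool) : ℕ :=
  ((tags k).filter fun t => Nat.beq (t % 10) b && p t).length

lemma mem_sizes (h4 : 4 ≤ a) (h9 : a ≤ 9) : a ∈ [4, 5, 6, 7, 8, 9] := by
  interval_cases a <;> simp

lemma forall_le_ndeg_iff_tagDegree (ha : a ∈ [4, 5, 6, 7, 8, 9]) (hd : d = 2 ∨ d = 3) {N : ℕ}
    (hN : N ∈ excN a) :
    (∀ v, d ≤ ndeg (rg a (rowsN a N)) v) ↔ tagDegree d (tagN a N) = true := by
  rw [tagDegree, Bool.or_eq_true, Nat.beq_eq, Nat.ble_eq]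
  rcases hd with rfl | rfl
  · exact ⟨fun _ => .inl rfl, fun _ v => ((mem_excN.1 hN).2.1 v).1⟩
  · rw [(tagN_iff ha hN).2.2.2]
    simp

lemma connected_and_graphType_iff_tagType (ha : a ∈ [4, 5, 6, 7, 8, 9]) {N : ℕ} (hN : N ∈ excN a)
    (t : Option ℕ) :
    ((rg a (rowsN a N)).Connected ∧ GraphType (rg a (rowsN a N)) t) ↔
      tagType t (tagN a N) = true := by
  obtain ⟨-, hc, ht, -⟩ := tagN_iff ha hN
  rw [tagType, Bool.and_eq_true, decide_eq_true_iff, Bool.not_eq_true', ← Bool.not_eq_true,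
    Nat.beq_eq]
  exact ⟨fun h => ⟨hc.1 h.1, (ht h.1 t).1 h.2⟩, fun h => ⟨hc.2 h.1, (ht (hc.2 h.1) t).2 h.2⟩⟩

lemma forall_le_ndeg_isoInvariant (d : ℕ) :
    IsoInvariant (fun H : SimpleGraph (Fin a) => ∀ v, d ≤ ndeg H v) := by
  rintro H K ⟨φ⟩
  exact ⟨fun h v => by rw [← φ.apply_symm_apply v, ndeg_iso]; exact h _,
    fun h v => by rw [← ndeg_iso φ v]; exact h _⟩

/-- The structures that are not layered supersets of a cycle of length six. -/
lemma numClasses_typedNormal_of_ne_six (h4 : 4 ≤ a) (h9 : a ≤ 9) (hb : b ≤ 9)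
    (hd : d = 2 ∨ d = 3) {t : Option ℕ} (ht : t ≠ some 6) :
    numClasses (TypedNormal a b d t) = tagCount a b fun s => tagDegree d s && tagType t s := by
  have ha := mem_sizes h4 h9
  rw [tagCount, ← numClasses_exc h4 h9 hb
    (Q := fun H => (∀ v, d ≤ ndeg H v) ∧ H.Connected ∧ GraphType H t)]
  · refine numClasses_congr fun H => ⟨?_, ?_⟩
    · rintro ⟨⟨hc, hH⟩, hdeg, hT⟩
      -- A type other than LSS_6 excludes percolating triangles, so the graph is exceptional.
      exact ⟨⟨hH, fun h3 => ht (hT.eq_six h3)⟩, hdeg, hc, hT⟩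
    · rintro ⟨⟨hH, -⟩, hdeg, hc, hT⟩
      exact ⟨⟨hc, hH⟩, hdeg, hT⟩
  · rintro H K ⟨φ⟩
    exact and_congr (forall_le_ndeg_isoInvariant d H K ⟨φ⟩)
      (and_congr φ.connected_iff (graphType_iso φ t))
  · intro N hN _
    rw [Bool.and_eq_true, forall_le_ndeg_iff_tagDegree ha hd hN,
      connected_and_graphType_iff_tagType ha hN]

/-- The graphs of a class are the layered supersets of triangles and the exceptional ones. -/
lemma numClasses_bounded_eq_add (h4 : 4 ≤ a) (h9 : a ≤ 9) (hb : b ≤ 9) (hd : d = 2 ∨ d = 3) :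
    numClasses (Bounded (n := a) d b) =
      numClasses (TypedNormal a b d (some 6)) + tagCount a b (tagDegree d) := by
  have ha := mem_sizes h4 h9
  have hinv := forall_le_ndeg_isoInvariant (a := a) d
  rw [tagCount, ← numClasses_exc h4 h9 hb hinv _
    fun N hN _ => forall_le_ndeg_iff_tagDegree ha hd hN, ← numClasses_or]
  · refine numClasses_congr fun H => ⟨fun h => ?_, ?_⟩
    · have h2 : Bounded 2 b H := ⟨fun v => ⟨by have := (h.1 v).1; omega, (h.1 v).2⟩, h.2⟩
      by_cases h3 : PercCyc H 3
      · exact .inl ⟨⟨h3.connected, h2⟩, fun v => (h.1 v).1, (graphType_six_iff H).2 h3⟩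
      · exact .inr ⟨⟨h2, h3⟩, fun v => (h.1 v).1⟩
    · rintro (⟨⟨-, hH⟩, hdeg, -⟩ | ⟨⟨hH, -⟩, hdeg⟩) <;>
        exact ⟨fun v => ⟨hdeg v, (hH.1 v).2⟩, hH.2⟩
  · rintro H K ⟨φ⟩
    exact and_congr (and_congr (bounded_isoInvariant 2 b H K ⟨φ⟩) (not_congr (percCyc_iso φ 3)))
      (hinv H K ⟨φ⟩)
  · rintro H ⟨-, -, h⟩ ⟨⟨-, h3⟩, -⟩
    exact h3 ((graphType_six_iff H).1 h)

/-- The entries other than LSS_6 are counts of tags; the LSS_6 entry is the Burnside total minus all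
exceptional graphs, disconnected ones included. -/
lemma tagCount_eq_table : ∀ a ∈ [4, 5, 6, 7, 8, 9], ∀ b ∈ List.range 10,
    (∀ t ∈ [none, some 8, some 10, some 12],
      (tagCount a b fun s => tagDegree 2 s && tagType t s) = TableD5G6.ts a b t ∧
      (tagCount a b fun s => tagDegree 3 s && tagType t s) = TableD5G6.as a b t) ∧
    total2 a b = TableD5G6.ts a b (some 6) + tagCount a b (tagDegree 2) ∧
    total3 a b = TableD5G6.as a b (some 6) + tagCount a b (tagDegree 3) := by
  decide +kernel

lemma mem_types_of_tagType : ∀ a ∈ [4, 5, 6, 7, 8, 9], ∀ s ∈ tags a, s / 10 % 20 ≠ 1 →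
    ofLength (s / 10 % 20) ∈ [none, some 8, some 10, some 12] := by
  decide +kernel

lemma five_le_of_mem_tags : ∀ a ∈ [4, 5, 6, 7, 8, 9], ∀ s ∈ tags a, 5 ≤ s % 10 := by
  decide +kernel

lemma tagCount_eq_zero (ha : a ∈ [4, 5, 6, 7, 8, 9]) (d : ℕ) {t : Option ℕ}
    (ht : t ∉ [none, some 8, some 10, some 12]) :
    (tagCount a b fun s => tagDegree d s && tagType t s) = 0 := by
  rw [tagCount, List.length_eq_zero_iff, List.filter_eq_nil_iff]
  intro s hs h
  rw [Bool.and_eq_true, Bool.and_eq_true, tagType, Bool.and_eq_true, decide_eq_true_iff,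
    Bool.not_eq_true', ← Bool.not_eq_true] at h
  obtain ⟨-, -, h1, h2⟩ := h
  exact ht (h2 ▸ mem_types_of_tagType a ha s hs fun h => h1 (Nat.beq_eq ▸ h))

lemma entry_eq_zero {t : Option ℕ} (h6 : t ≠ some 6) (ht : t ∉ [none, some 8, some 10, some 12])
    (n6 n8 n10 n12 na : ℕ) : TableD5G6.entry n6 n8 n10 n12 na t = 0 := by
  unfold TableD5G6.entry
  split <;> simp_all

lemma table_eq_zero {t : Option ℕ} (h6 : t ≠ some 6)
    (ht : t ∉ [none, some 8, some 10, some 12]) (a b : ℕ) :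
    TableD5G6.ts a b t = 0 ∧ TableD5G6.as a b t = 0 := by
  constructor
  · unfold TableD5G6.ts
    split <;> exact entry_eq_zero h6 ht ..
  · unfold TableD5G6.as
    split <;> exact entry_eq_zero h6 ht ..

/-- The numbers of graphs of every type. -/
theorem numClasses_typedNormal (h4 : 4 ≤ a) (h9 : a ≤ 9) (hb : b ≤ 9) (t : Option ℕ) :
    numClasses (TypedNormal a b 2 t) = TableD5G6.ts a b t ∧
      numClasses (TypedNormal a b 3 t) = TableD5G6.as a b t := by
  have ha := mem_sizes h4 h9
  have htab := tagCount_eq_table a ha b (List.mem_range.2 (by omega))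
  by_cases h6 : t = some 6
  · subst h6
    have h2 := numClasses_bounded_eq_add h4 h9 hb (d := 2) (.inl rfl)
    have h3 := numClasses_bounded_eq_add h4 h9 hb (d := 3) (.inr rfl)
    have htot := numClasses_bounded h4 h9 hb
    omega
  · rw [numClasses_typedNormal_of_ne_six h4 h9 hb (.inl rfl) h6,
      numClasses_typedNormal_of_ne_six h4 h9 hb (.inr rfl) h6]
    by_cases ht : t ∈ [none, some 8, some 10, some 12]
    · exact htab.1 t ht
    · rw [tagCount_eq_zero ha 2 ht, tagCount_eq_zero ha 3 ht, (table_eq_zero h6 ht a b).1,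
        (table_eq_zero h6 ht a b).2]
      exact ⟨rfl, rfl⟩

lemma hasLSSType_iff_graphType (X : ETS 5 6 a b) {H : SimpleGraph (Fin a)}
    (φ : sgraph X.G X.S ≃g H) (t : Option ℕ) : X.G.HasLSSType X.S t ↔ GraphType H t :=
  (hasLSSType_iff (noFour_ets X) X.isElementary t).trans (graphType_iso φ t)

lemma numStructures_eq_numClasses (P : ETS 5 6 a b → Prop) (Q : SimpleGraph (Fin a) → Prop)
    (hPQ : ∀ X H, Nonempty (sgraph X.G X.S ≃g H) → (P X ↔ Q H)) :
    ETS.numStructures 5 6 a b P = (numClasses (fun H => Normal a b H ∧ Q H) : ℕ∞) := by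
  rw [numStructures_eq P Q hPQ, numClasses, Set.Finite.cast_ncard_eq (Set.toFinite _)]

theorem numTS_eq (h4 : 4 ≤ a) (h9 : a ≤ 9) (hb : b ≤ 9) (t : Option ℕ) :
    ETS.numTS 5 6 a b t = (TableD5G6.ts a b t : ℕ∞) := by
  rw [ETS.numTS, numStructures_eq_numClasses _ (fun H => GraphType H t)
    fun X H ⟨φ⟩ => hasLSSType_iff_graphType X φ t, ← (numClasses_typedNormal h4 h9 hb t).1]
  exact congrArg _ (numClasses_congr fun H =>
    ⟨fun h => ⟨h.1, fun v => (h.1.2.1 v).1, h.2⟩, fun h => ⟨h.1, h.2.2⟩⟩)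

theorem numAS_eq (h4 : 4 ≤ a) (h9 : a ≤ 9) (hb : b ≤ 9) (t : Option ℕ) :
    ETS.numAS 5 6 a b t = (TableD5G6.as a b t : ℕ∞) := by
  rw [ETS.numAS, numStructures_eq_numClasses _ (fun H => (∀ v, 3 ≤ ndeg H v) ∧ GraphType H t),
    ← (numClasses_typedNormal h4 h9 hb t).2]
  · rfl
  · rintro X H ⟨φ⟩
    rw [isAbsorbing_iff X.leftRegular (noFour_ets X) X.isElementary,
      hasLSSType_iff_graphType X φ t]
    refine and_congr_left fun _ => ⟨fun h v => ?_, fun h v => ?_⟩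
    · rw [← φ.apply_symm_apply v, ndeg_iso]
      exact h _
    · rw [← ndeg_iso φ v]
      exact h _

/-- Degrees are at most a - 1, so b is at least 5a - a(a - 1), which is at least 5 for a from 1 to
3; connectedness excludes a = 0. -/
lemma four_le_of_normal (hb : b < 5) {H : SimpleGraph (Fin a)} (hH : Normal a b H) : 4 ≤ a := by
  obtain ⟨hc, -, hs⟩ := hH
  have hpos : 0 < a := Fin.pos_iff_nonempty.2 hc.nonempty
  have hdeg : ∀ v, ndeg H v ≤ a - 1 := fun v => by
    have h1 : H.neighborSet v ⊆ {v}ᶜ := fun w hw => (H.ne_of_adj hw).symm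
    have h2 := Set.ncard_le_ncard h1 (Set.toFinite _)
    rwa [Set.ncard_compl, Set.ncard_singleton, Nat.card_fin] at h2
  have hsum : dsum H ≤ a * (a - 1) := by
    have := Finset.sum_le_card_nsmul Finset.univ (fun v => ndeg H v) _ fun v _ => hdeg v
    simpa [dsum] using this
  by_contra h
  interval_cases a <;> omega

/-- Without a percolating triangle the normal graph would be exceptional, but the last digit of
every tag, which is `b`, is at least 5. -/
theorem isLSSOfCycle_six (h9 : a ≤ 9) (hb : b < 5) (X : ETS 5 6 a b) :
    X.G.IsLSSOfCycle X.S 6 := by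
  obtain ⟨H, hH, ⟨φ⟩⟩ := exists_normal X
  have h4 := four_le_of_normal hb hH
  have ha := mem_sizes h4 h9
  refine isLSSOfCycle_of_percCyc (noFour_ets X) X.isElementary (k := 3) ((percCyc_iso φ 3).2 ?_)
  by_contra h3
  obtain ⟨N, hN, ⟨ψ⟩⟩ := exists_excN h4 h9 (by omega) hH.2 h3
  have h1 := ((tagN_iff ha hN).1 b).1 (dsum_iso ψ ▸ hH.2.2)
  have h2 : tagN a N ∈ tags a := by
    rw [← tags_eq a ha, mapL_eq]
    exact List.mem_map_of_mem hN
  have h5 := five_le_of_mem_tags a ha _ h2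
  omega

end Counting

end TrappingSets

theorem mainTheorem3 :
    (∀ a b : ℕ, 4 ≤ a → a ≤ 9 → b ≤ 9 → ∀ t : Option ℕ,
      ETS.numTS 5 6 a b t = (TableD5G6.ts a b t : ℕ∞) ∧
      ETS.numAS 5 6 a b t = (TableD5G6.as a b t : ℕ∞)) ∧
    (∀ a b : ℕ, a < 10 → b < 5 → ∀ X : ETS 5 6 a b, X.G.IsLSSOfCycle X.S 6) :=
  ⟨fun _ _ h4 h9 hb t =>
    ⟨TrappingSets.numTS_eq h4 h9 hb t, TrappingSets.numAS_eq h4 h9 hb t⟩,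
    fun _ _ ha hb X => TrappingSets.isLSSOfCycle_six (by omega) hb X⟩
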